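/- Let $d \ge 2$. For $R>0$ let $\mathrm{dist}_R(x,y) := \min_{k\in (R\mathbb{Z})^d}|x-y-k|$ be the periodic distance on the torus $[0,R)^d$, where $|\cdot|$ is the Euclidean norm. For $p\ge 1$ and two measures $\mu,\nu$ on $[0,R)^d$ of the same finite mass let $$\tilde W_{[0,R)^d;p}(\mu,\nu) := \Big(\inf_{\pi} \int \mathrm{dist}_R(x,y)^p \, d\pi(x,y)\Big)^{1/p}$$ be the $p$-Wasserstein distance on the torus, the infimum being over all measures $\pi$ with marginals $\mu$ and $\nu$. There are constants $C = C(d,p) <\infty$, $p\ge1$, depending only on $d$ and $p$, with the following property. For every dyadic radius $R = 2^k$, $k\in\mathbb{Z}$, let $\mu=\mu_R$ be a Poisson point process of unit intensity on the torus $[0,R)^d$, all these processes being defined on a common probability space with an arbitrary joint law (for instance, the restrictions to $[0,R)^d$ of one Poisson point process of unit intensity on $\mathbb{R}^d$). Then there is a random radius $r_*$, almost surely finite, such that almost surely, for all dyadic radii $R\ge r_*$ and all $p \ge 1$, $$\tilde W_{[0,R)^d;p}^p(\mu, n) \le C R^d \begin{cases} \ln^{\frac p2} R & \text{if } d=2,\\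 1 & \text{if } d\ge 3,\end{cases}$$ where $n = \frac{\mu([0,R)^d)}{R^d}$ is the (random) number density, identified with the measure $n\,dx$ on $[0,R)^d$. -/

import Mathlib

open MeasureTheory ProbabilityTheory
open scoped ENNReal NNReal

/-- The half-open cube `[0, R)^d` in Euclidean space, a fundamental domain of the torus
`ℝ^d / (R ℤ)^d`. -/
def torusBox (d : ℕ) (R : ℝ) : Set (EuclideanSpace ℝ (Fin d)) :=
  {x | ∀ i, x i ∈ Set.Ico 0 R}

/-- The periodic distance `dist(x, y + (R ℤ)^d) = min_{k ∈ (R ℤ)^d} |x - y - k|`, with `|·|` the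
Euclidean norm. -/
noncomputable def torusDist {d : ℕ} (R : ℝ) (x y : EuclideanSpace ℝ (Fin d)) : ℝ :=
  ⨅ k : Fin d → ℤ, dist x (y + WithLp.toLp 2 (fun i => R * (k i : ℝ)))

/-- The `p`-Wasserstein distance on the torus `[0, R)^d` between (the restrictions to `[0, R)^d` of)
two measures on `ℝ^d`, of arbitrary mass; it is `∞` if the two masses differ. -/
noncomputable def torusWasserstein {d : ℕ} (R p : ℝ)
    (μ ν : Measure (EuclideanSpace ℝ (Fin d))) : ℝ≥0∞ :=
  (⨅ (π : Measure (EuclideanSpace ℝ (Fin d) × EuclideanSpace ℝ (Fin d)))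
      (_ : π.map Prod.fst = μ.restrict (torusBox d R))
      (_ : π.map Prod.snd = ν.restrict (torusBox d R)),
    ∫⁻ z, ENNReal.ofReal (torusDist R z.1 z.2 ^ p) ∂π) ^ (1 / p)

/-- The random measure `μ`, defined on the probability space `(Ω, P)`, is a Poisson point process
with intensity measure `Λ`: the number of points in a measurable set `A` of finite `Λ`-measure is
Poisson distributed with parameter `Λ A`, and the numbers of points in finitely many pairwise
disjoint measurable sets are independent. -/
structure IsPoissonProcess {Ω X : Type*} [MeasurableSpace Ω] [MeasurableSpace X]
    (P : Measure Ω) (μ : Ω → Measure X) (Λ : Measure X) : Prop where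
  measurable : Measurable μ
  law_count : ∀ A : Set X, MeasurableSet A → Λ A ≠ ∞ →
    P.map (fun ω => μ ω A) =
      (poissonMeasure (Λ A).toNNReal).map (fun n : ℕ => (n : ℝ≥0∞))
  indep_count : ∀ (m : ℕ) (A : Fin m → Set X), (∀ i, MeasurableSet (A i)) →
    Pairwise (Function.onFun Disjoint A) → iIndepFun (fun i ω => μ ω (A i)) P

/-- The number density `μ([0, R)^d) / R^d`. -/
noncomputable def numberDensity {d : ℕ} (R : ℝ) (μ : Measure (EuclideanSpace ℝ (Fin d))) : ℝ≥0∞ :=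
  μ (torusBox d R) / ENNReal.ofReal (R ^ d)

/-! Bisect the box `[0, R)^d` repeatedly, cycling through the coordinate directions; this gives a
binary tree of dyadic cells. Run a second hierarchy on the same tree, but cut each box in the ratio
of the masses that `μ` gives to the two dyadic children. By construction the second cell at a node
has the same `n dx`-mass as the `μ`-mass of the dyadic cell there (`numberDensity_mul_volume_cell`).
Coupling the two cells at each leaf `w` bounds the cost by `∑ μ(w) δ_w ^ p`, where `δ_w` bounds
distances between the two cells (`torusWasserstein_rpow_le_sum`). The mismatch of the two
hierarchies obeys a recursion, `drift`, that is linear in the shifts of the cuts, and a shift is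
about the side of the cell times the relative fluctuation of its mass.

A cell of volume `V` has side of order `V ^ (1/d)` and relative Poisson fluctuation of order `V ^
(-1/2)`, so one cut moves by `V ^ (1/d - 1/2)`. For `d ≥ 3` this is summable over the scales, and
displacements are bounded. For `d = 2` every scale contributes order one; the contributions add up
in variance, over about `log R` scales, so displacements have order `√(log R)`.

For `d ≥ 3`, fluctuations `V ^ (-5/12)` are admitted, which is still summable and fails with
stretched exponentially small probability. A leaf below a failing cell is handled at its last good
ancestor, at the price of the diameter of that ancestor; on `SpatialGood` there are few such leaves
at every scale.

For `d = 2`, with `R = 2 ^ k` and leaves of area of order `k`, the displacement is linearized in the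
leaf masses with error of order `√k`. The linear part is split at depth `m ≈ √k`: scales coarser
than `m` have variance of order `√k` and are controlled uniformly by a union bound over `2 ^ m`
nodes; scales finer than `m` give `2 ^ m` independent blocks, for which Chebyshev's inequality
controls the spatial average of an exponential of the displacement over `√k`. This is `PlanarGood`.

The failure probabilities are summable in `k`, and Borel–Cantelli concludes. The good events do not
involve `p`, so one random radius serves all `p`. -/

/-! ### Binary hierarchies of boxes -/

/-- The half-open box with lower corner `a` and side lengths `h`. -/
def halfOpenBox {d : ℕ} (a h : Fin d → ℝ) : Set (EuclideanSpace ℝ (Fin d)) :=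
  {x | ∀ i, x i ∈ Set.Ico (a i) (a i + h i)}

lemma halfOpenBox_eq_preimage {d : ℕ} (a h : Fin d → ℝ) :
    halfOpenBox a h = (MeasurableEquiv.toLp 2 (Fin d → ℝ)).symm ⁻¹'
      (Set.univ.pi fun i => Set.Ico (a i) (a i + h i)) := by
  ext x
  simp [halfOpenBox]

lemma measurableSet_halfOpenBox {d : ℕ} (a h : Fin d → ℝ) : MeasurableSet (halfOpenBox a h) := by
  rw [halfOpenBox_eq_preimage]
  exact (MeasurableEquiv.measurable _) (MeasurableSet.univ_pi fun _ => measurableSet_Ico)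

lemma volume_halfOpenBox {d : ℕ} (a h : Fin d → ℝ) :
    volume (halfOpenBox a h) = ∏ i, ENNReal.ofReal (h i) := by
  rw [halfOpenBox_eq_preimage,
    (EuclideanSpace.volume_preserving_symm_measurableEquiv_toLp (Fin d)).measure_preimage_equiv,
    volume_pi_pi]
  simp [Real.volume_Ico]

/-- The direction orthogonal to which the cells of depth `s` are cut. -/
def cutDir (d : ℕ) [NeZero d] (s : ℕ) : Fin d := Fin.ofNat d s

/-- Side lengths of the `c`-th cell of depth `s` in the hierarchy of boxes obtained from `[0, R)^d`
by successively cutting each box in two; `ρ s c` is the fraction occupied by the lower part. -/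
noncomputable def cellSide {d : ℕ} [NeZero d] (ρ : ℕ → ℕ → ℝ) (R : ℝ) : ℕ → ℕ → Fin d → ℝ
  | 0, _ => fun _ => R
  | s + 1, c => fun i =>
      if i = cutDir d s then
        (if c % 2 = 0 then ρ s (c / 2) else 1 - ρ s (c / 2)) * cellSide ρ R s (c / 2) i
      else cellSide ρ R s (c / 2) i

/-- Lower corner of the `c`-th cell of depth `s`, see `cellSide`. -/
noncomputable def cellPos {d : ℕ} [NeZero d] (ρ : ℕ → ℕ → ℝ) (R : ℝ) : ℕ → ℕ → Fin d → ℝ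
  | 0, _ => fun _ => 0
  | s + 1, c => fun i =>
      if i = cutDir d s ∧ c % 2 ≠ 0 then
        cellPos ρ R s (c / 2) i + ρ s (c / 2) * cellSide ρ R s (c / 2) i
      else cellPos ρ R s (c / 2) i

/-- The `c`-th cell of depth `s`, see `cellSide`. -/
noncomputable def cell {d : ℕ} [NeZero d] (ρ : ℕ → ℕ → ℝ) (R : ℝ) (s c : ℕ) :
    Set (EuclideanSpace ℝ (Fin d)) :=
  halfOpenBox (cellPos ρ R s c) (cellSide ρ R s c)

/-- The cells of the dyadic hierarchy. -/
noncomputable def dyadicCell (d : ℕ) [NeZero d] (R : ℝ) (s c : ℕ) :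
    Set (EuclideanSpace ℝ (Fin d)) :=
  cell (fun _ _ => 1 / 2) R s c

lemma cell_zero {d : ℕ} [NeZero d] (ρ : ℕ → ℕ → ℝ) (R : ℝ) (c : ℕ) :
    (cell ρ R 0 c : Set (EuclideanSpace ℝ (Fin d))) = torusBox d R := by
  simp [cell, halfOpenBox, torusBox, cellPos, cellSide]

lemma measurableSet_cell {d : ℕ} [NeZero d] (ρ : ℕ → ℕ → ℝ) (R : ℝ) (s c : ℕ) :
    MeasurableSet (cell ρ R s c : Set (EuclideanSpace ℝ (Fin d))) :=
  measurableSet_halfOpenBox _ _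

section Split

variable {d : ℕ} [NeZero d] {ρ : ℕ → ℕ → ℝ} {R : ℝ}

lemma even_div_two (c : ℕ) : 2 * c / 2 = c := by omega

lemma odd_div_two (c : ℕ) : (2 * c + 1) / 2 = c := by omega

lemma odd_mod_two (c : ℕ) : (2 * c + 1) % 2 = 1 := by omega

lemma cellSide_nonneg (hρ0 : ∀ s c, 0 ≤ ρ s c) (hρ1 : ∀ s c, ρ s c ≤ 1) (hR : 0 ≤ R)
    (s c : ℕ) (i : Fin d) : 0 ≤ cellSide ρ R s c i := by
  induction s generalizing c with
  | zero => exact hR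
  | succ s ih =>
    have h0 := hρ0 s (c / 2)
    have h1 := sub_nonneg.2 (hρ1 s (c / 2))
    have h := ih (c / 2)
    simp only [cellSide]
    split_ifs
    · exact mul_nonneg h0 h
    · exact mul_nonneg h1 h
    · exact h

lemma cell_eq_union (hρ0 : ∀ s c, 0 ≤ ρ s c) (hρ1 : ∀ s c, ρ s c ≤ 1) (hR : 0 ≤ R)
    (s c : ℕ) :
    (cell ρ R s c : Set (EuclideanSpace ℝ (Fin d))) =
      cell ρ R (s + 1) (2 * c) ∪ cell ρ R (s + 1) (2 * c + 1) := by
  ext x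
  have hs := cellSide_nonneg hρ0 hρ1 hR s c (cutDir d s)
  have h0 := hρ0 s c
  have h1 := hρ1 s c
  have h2 : 0 ≤ ρ s c * cellSide ρ R s c (cutDir d s) := mul_nonneg h0 hs
  have h3 : ρ s c * cellSide ρ R s c (cutDir d s) ≤ cellSide ρ R s c (cutDir d s) :=
    mul_le_of_le_one_left hs h1
  simp only [cell, halfOpenBox, cellPos, cellSide, Set.mem_ofPred_eq, Set.mem_union, even_div_two,
    odd_div_two, odd_mod_two, Nat.mul_mod_right, ne_eq, not_true_eq_false, and_false, if_false,
    if_true, one_ne_zero, not_false_eq_true, and_true, Set.mem_Ico]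
  constructor
  · intro h
    by_cases hx : x (cutDir d s) < cellPos ρ R s c (cutDir d s)
        + ρ s c * cellSide ρ R s c (cutDir d s)
    · left
      intro i
      split_ifs with hi
      · subst hi; exact ⟨(h _).1, hx⟩
      · exact h i
    · right
      intro i
      split_ifs with hi
      · subst hi; exact ⟨not_lt.1 hx, by linarith [(h (cutDir d s)).2]⟩
      · exact h i
  · rintro (h | h) i
    · have := h i
      split_ifs at this with hi
      · subst hi; exact ⟨this.1, by linarith [this.2]⟩
      · exact this
    · have := h i
      split_ifs at this with hi
      · subst hi; exact ⟨by linarith [this.1], by linarith [this.2]⟩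
      · exact this

lemma disjoint_cell_children (s c : ℕ) :
    Disjoint (cell ρ R (s + 1) (2 * c) : Set (EuclideanSpace ℝ (Fin d)))
      (cell ρ R (s + 1) (2 * c + 1)) := by
  rw [Set.disjoint_left]
  intro x h h'
  have h := (h (cutDir d s)).2
  have h' := (h' (cutDir d s)).1
  simp [cellPos, cellSide, odd_div_two] at h h'
  linarith

lemma cell_subset_parent (hρ0 : ∀ s c, 0 ≤ ρ s c) (hρ1 : ∀ s c, ρ s c ≤ 1) (hR : 0 ≤ R)
    (s c : ℕ) :
    (cell ρ R (s + 1) c : Set (EuclideanSpace ℝ (Fin d))) ⊆ cell ρ R s (c / 2) := by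
  rw [cell_eq_union hρ0 hρ1 hR s (c / 2)]
  rcases Nat.mod_two_eq_zero_or_one c with h | h
  · have : 2 * (c / 2) = c := by omega
    rw [this]; exact Set.subset_union_left
  · have : 2 * (c / 2) + 1 = c := by omega
    rw [this]; exact Set.subset_union_right

lemma cell_subset_ancestor (hρ0 : ∀ s c, 0 ≤ ρ s c) (hρ1 : ∀ s c, ρ s c ≤ 1) (hR : 0 ≤ R)
    (s j c : ℕ) :
    (cell ρ R (s + j) c : Set (EuclideanSpace ℝ (Fin d))) ⊆ cell ρ R s (c / 2 ^ j) := by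
  induction j generalizing c with
  | zero => simp
  | succ j ih =>
    refine (cell_subset_parent hρ0 hρ1 hR (s + j) c).trans ((ih (c / 2)).trans ?_)
    rw [Nat.div_div_eq_div_mul, pow_succ']

lemma volume_cell_even (hρ0 : ∀ s c, 0 ≤ ρ s c)
    (s c : ℕ) :
    volume (cell ρ R (s + 1) (2 * c) : Set (EuclideanSpace ℝ (Fin d))) =
      ENNReal.ofReal (ρ s c) * volume (cell ρ R s c : Set (EuclideanSpace ℝ (Fin d))) := by
  rw [cell, cell, volume_halfOpenBox, volume_halfOpenBox,
    ← Finset.mul_prod_erase _ _ (Finset.mem_univ (cutDir d s)),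
    ← Finset.mul_prod_erase _ _ (Finset.mem_univ (cutDir d s)), ← mul_assoc,
    ← ENNReal.ofReal_mul (hρ0 s c)]
  congr 1
  · simp [cellSide]
  · refine Finset.prod_congr rfl fun i hi => ?_
    simp [cellSide, Finset.ne_of_mem_erase hi]

lemma volume_cell_odd (hρ1 : ∀ s c, ρ s c ≤ 1)
    (s c : ℕ) :
    volume (cell ρ R (s + 1) (2 * c + 1) : Set (EuclideanSpace ℝ (Fin d))) =
      ENNReal.ofReal (1 - ρ s c) * volume (cell ρ R s c : Set (EuclideanSpace ℝ (Fin d))) := by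
  have := hρ1 s c
  rw [cell, cell, volume_halfOpenBox, volume_halfOpenBox,
    ← Finset.mul_prod_erase _ _ (Finset.mem_univ (cutDir d s)),
    ← Finset.mul_prod_erase _ _ (Finset.mem_univ (cutDir d s)), ← mul_assoc,
    ← ENNReal.ofReal_mul (by linarith)]
  congr 1
  · simp [cellSide, odd_div_two]
  · refine Finset.prod_congr rfl fun i hi => ?_
    simp [cellSide, Finset.ne_of_mem_erase hi, odd_div_two]

lemma sum_range_two_mul {M : Type*} [AddCommMonoid M] (f : ℕ → M) (n : ℕ) :
    ∑ c ∈ Finset.range (2 * n), f c = ∑ c ∈ Finset.range n, (f (2 * c) + f (2 * c + 1)) := by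
  induction n with
  | zero => simp
  | succ n ih =>
    rw [Finset.sum_range_succ, ← ih, show 2 * (n + 1) = 2 * n + 1 + 1 by ring,
      Finset.sum_range_succ, Finset.sum_range_succ, add_assoc]

lemma restrict_torusBox_eq_sum_cell (hρ0 : ∀ s c, 0 ≤ ρ s c) (hρ1 : ∀ s c, ρ s c ≤ 1) (hR : 0 ≤ R)
    (ν : Measure (EuclideanSpace ℝ (Fin d))) (s : ℕ) :
    ν.restrict (torusBox d R) = ∑ c ∈ Finset.range (2 ^ s), ν.restrict (cell ρ R s c) := by
  induction s with
  | zero => simp [cell_zero]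
  | succ s ih =>
    rw [ih, pow_succ', sum_range_two_mul]
    refine Finset.sum_congr rfl fun c _ => ?_
    rw [cell_eq_union hρ0 hρ1 hR s c,
      Measure.restrict_union (disjoint_cell_children s c) (measurableSet_cell _ _ _ _)]

/-- The index `c` is not restricted to `c < 2 ^ s`: every index at depth `0` denotes the whole box,
so larger indices repeat cells. The hypothesis on `c / 2 ^ s` says that both indices descend from
the same root. -/
lemma disjoint_cell (hρ0 : ∀ s c, 0 ≤ ρ s c) (hρ1 : ∀ s c, ρ s c ≤ 1) (hR : 0 ≤ R)
    (s : ℕ) {c c' : ℕ} (hc : c / 2 ^ s = c' / 2 ^ s) (h : c ≠ c') :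
    Disjoint (cell ρ R s c : Set (EuclideanSpace ℝ (Fin d))) (cell ρ R s c') := by
  induction s generalizing c c' with
  | zero => simp at hc; exact absurd hc h
  | succ s ih =>
    by_cases hp : c / 2 = c' / 2
    · rcases Nat.lt_or_gt_of_ne h with h | h
      · have e1 : c = 2 * (c / 2) := by omega
        have e2 : c' = 2 * (c / 2) + 1 := by omega
        rw [e2, e1, even_div_two]; exact disjoint_cell_children _ _
      · have e1 : c' = 2 * (c / 2) := by omega
        have e2 : c = 2 * (c / 2) + 1 := by omega
        rw [e2, e1]; exact (disjoint_cell_children _ _).symm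
    · rw [pow_succ', ← Nat.div_div_eq_div_mul, ← Nat.div_div_eq_div_mul] at hc
      exact (ih hc hp).mono (cell_subset_parent hρ0 hρ1 hR s c)
        (cell_subset_parent hρ0 hρ1 hR s c')

end Split

lemma volume_dyadicCell {d : ℕ} [NeZero d] {R : ℝ} (hR : 0 ≤ R) (s c : ℕ) :
    volume (dyadicCell d R s c) = ENNReal.ofReal (R ^ d / 2 ^ s) := by
  induction s generalizing c with
  | zero =>
    rw [dyadicCell, cell, volume_halfOpenBox]
    simp [cellSide, ENNReal.ofReal_pow hR]
  | succ s ih =>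
    have key : ∀ c', volume (dyadicCell d R (s + 1) c) =
        ENNReal.ofReal (1 / 2) * volume (dyadicCell d R s c') →
        volume (dyadicCell d R (s + 1) c) = ENNReal.ofReal (R ^ d / 2 ^ (s + 1)) := by
      intro c' h
      rw [h, ih, ← ENNReal.ofReal_mul (by norm_num)]
      congr 1; rw [pow_succ]; field_simp
    rcases Nat.mod_two_eq_zero_or_one c with h | h
    · obtain ⟨c', rfl⟩ : ∃ c', c = 2 * c' := ⟨c / 2, by omega⟩
      exact key c' (volume_cell_even (fun _ _ => by norm_num) s c')
    · obtain ⟨c', rfl⟩ : ∃ c', c = 2 * c' + 1 := ⟨c / 2, by omega⟩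
      refine key c' ((volume_cell_odd (fun _ _ => by norm_num) s c').trans ?_)
      norm_num [dyadicCell]

/-! ### Masses on the tree and the proportional hierarchy -/

/-- The mass given by `μ` to the dyadic cells of `[0, R)^d`. -/
noncomputable def cellCount {d : ℕ} [NeZero d] (R : ℝ) (μ : Measure (EuclideanSpace ℝ (Fin d)))
    (s c : ℕ) : ℝ :=
  (μ (dyadicCell d R s c)).toReal

/-- The fraction of the mass of a cell that its first child carries. -/
noncomputable def countRatio (N : ℕ → ℕ → ℝ) (s c : ℕ) : ℝ := N (s + 1) (2 * c) / N s c

/-- A nonnegative function on the nodes of the binary tree that is additive under splitting. -/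
structure IsTreeMass (N : ℕ → ℕ → ℝ) : Prop where
  nonneg : ∀ s c, 0 ≤ N s c
  add : ∀ s c, N s c = N (s + 1) (2 * c) + N (s + 1) (2 * c + 1)

namespace IsTreeMass

variable {N : ℕ → ℕ → ℝ}

lemma countRatio_nonneg (h : IsTreeMass N) (s c : ℕ) : 0 ≤ countRatio N s c :=
  div_nonneg (h.nonneg _ _) (h.nonneg _ _)

lemma countRatio_le_one (h : IsTreeMass N) (s c : ℕ) : countRatio N s c ≤ 1 :=
  div_le_one_of_le₀ (by rw [h.add s c]; linarith [h.nonneg (s + 1) (2 * c + 1)]) (h.nonneg _ _)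

lemma countRatio_mul (h : IsTreeMass N) (s c : ℕ) :
    countRatio N s c * N s c = N (s + 1) (2 * c) := by
  rw [countRatio]
  -- In an empty cell the ratio is `0 / 0 = 0`; this is harmless because both children are empty.
  by_cases h0 : N s c = 0
  · have := h.add s c
    rw [h0, mul_zero]
    linarith [h.nonneg (s + 1) (2 * c), h.nonneg (s + 1) (2 * c + 1)]
  · field_simp

lemma one_sub_countRatio_mul (h : IsTreeMass N) (s c : ℕ) :
    (1 - countRatio N s c) * N s c = N (s + 1) (2 * c + 1) := by
  rw [sub_mul, h.countRatio_mul, h.add s c]; ring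

end IsTreeMass

lemma dyadicCell_subset {d : ℕ} [NeZero d] {R : ℝ} (hR : 0 ≤ R) (s c : ℕ) :
    dyadicCell d R s c ⊆ torusBox d R := by
  have := cell_subset_ancestor (d := d) (ρ := fun _ _ => 1 / 2) (fun _ _ => by norm_num)
    (fun _ _ => by norm_num) hR 0 s c
  rwa [zero_add, cell_zero] at this

lemma isTreeMass_cellCount {d : ℕ} [NeZero d] {R : ℝ} (hR : 0 ≤ R)
    {μ : Measure (EuclideanSpace ℝ (Fin d))} (hμ : μ (torusBox d R) ≠ ∞) :
    IsTreeMass (cellCount R μ) where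
  nonneg _ _ := ENNReal.toReal_nonneg
  add s c := by
    have hf : ∀ s c, μ (dyadicCell d R s c) ≠ ∞ := fun s c =>
      ne_top_of_le_ne_top hμ (measure_mono (dyadicCell_subset hR s c))
    rw [cellCount, cellCount, cellCount, ← ENNReal.toReal_add (hf _ _) (hf _ _)]
    congr 1
    rw [dyadicCell, cell_eq_union (fun _ _ => by norm_num) (fun _ _ => by norm_num) hR s c,
      measure_union (disjoint_cell_children s c) (measurableSet_cell _ _ _ _)]
    rfl

/-- The cells cut proportionally to the mass of `μ` carry, with the number density of `μ` as
density, the same mass as the dyadic cells with respect to `μ`. -/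
lemma numberDensity_mul_volume_cell {d : ℕ} [NeZero d] {R : ℝ} (hR : 0 < R)
    {μ : Measure (EuclideanSpace ℝ (Fin d))} (hμ : μ (torusBox d R) ≠ ∞) (s c : ℕ)  :
    numberDensity R μ *
      volume (cell (countRatio (cellCount R μ)) R s c : Set (EuclideanSpace ℝ (Fin d))) =
      μ (dyadicCell d R s c) := by
  have hN := isTreeMass_cellCount hR.le hμ
  have hf : ∀ s c, ENNReal.ofReal (cellCount R μ s c) = μ (dyadicCell d R s c) := fun s c =>
    ENNReal.ofReal_toReal (ne_top_of_le_ne_top hμ (measure_mono (dyadicCell_subset hR.le s c)))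
  induction s generalizing c with
  | zero =>
    rw [dyadicCell, cell_zero, cell_zero, numberDensity,
      ← cell_zero (d := d) (fun _ _ => 1 / 2) R 0]
    have := volume_dyadicCell (d := d) hR.le 0 0
    rw [dyadicCell, pow_zero, div_one] at this
    rw [this, ENNReal.div_mul_cancel (by simpa using pow_pos hR d) ENNReal.ofReal_ne_top]
  | succ s ih =>
    rcases Nat.mod_two_eq_zero_or_one c with h | h
    · obtain ⟨c', rfl⟩ : ∃ c', c = 2 * c' := ⟨c / 2, by omega⟩
      rw [volume_cell_even hN.countRatio_nonneg, mul_left_comm, ih, ← hf, ← hf,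
        ← ENNReal.ofReal_mul (hN.countRatio_nonneg _ _), hN.countRatio_mul]
    · obtain ⟨c', rfl⟩ : ∃ c', c = 2 * c' + 1 := ⟨c / 2, by omega⟩
      rw [volume_cell_odd hN.countRatio_le_one, mul_left_comm, ih, ← hf, ← hf,
        ← ENNReal.ofReal_mul (by linarith [hN.countRatio_le_one s c']),
        hN.one_sub_countRatio_mul]

/-! ### Coupling the two hierarchies -/

lemma torusDist_le_dist {d : ℕ} (R : ℝ) (x y : EuclideanSpace ℝ (Fin d)) :
    torusDist R x y ≤ dist x y := by
  refine (ciInf_le ⟨0, ?_⟩ (0 : Fin d → ℤ)).trans_eq ?_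
  · rintro _ ⟨k, rfl⟩; exact dist_nonneg
  · congr 1
    ext i
    simp

lemma torusDist_nonneg {d : ℕ} (R : ℝ) (x y : EuclideanSpace ℝ (Fin d)) :
    0 ≤ torusDist R x y :=
  le_ciInf fun _ => dist_nonneg

/-- Transporting each dyadic cell of depth `S` to the corresponding proportionally cut cell. -/
theorem torusWasserstein_rpow_le_sum {d : ℕ} [NeZero d] {R : ℝ} (hR : 0 < R)
    {μ : Measure (EuclideanSpace ℝ (Fin d))} (hμ : μ (torusBox d R) ≠ ∞) (S : ℕ) {p : ℝ}
    (hp : 1 ≤ p) (δ : ℕ → ℝ) (hδ0 : ∀ w, 0 ≤ δ w)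
    (hδ : ∀ w < 2 ^ S, ∀ x ∈ dyadicCell d R S w,
      ∀ y ∈ cell (countRatio (cellCount R μ)) R S w, dist x y ≤ δ w) :
    torusWasserstein R p μ (numberDensity R μ • volume) ^ p ≤
      ENNReal.ofReal (∑ w ∈ Finset.range (2 ^ S), cellCount R μ S w * δ w ^ p) := by
  have hN := isTreeMass_cellCount hR.le hμ
  set T : ℕ → Set (EuclideanSpace ℝ (Fin d)) := cell (countRatio (cellCount R μ)) R S with hT
  set n := numberDensity R μ with hn
  have hfin : ∀ w, μ (dyadicCell d R S w) ≠ ∞ := fun w =>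
    ne_top_of_le_ne_top hμ (measure_mono (dyadicCell_subset hR.le S w))
  have hmass : ∀ w, (n • volume) (T w) = μ (dyadicCell d R S w) := fun w => by
    rw [Measure.smul_apply, smul_eq_mul, numberDensity_mul_volume_cell hR hμ S w]
  have hfinT : ∀ w, (n • volume) (T w) ≠ ∞ := fun w => by rw [hmass]; exact hfin w
  have hmT : ∀ w, MeasurableSet (T w) := fun w => measurableSet_cell _ _ _ _
  have hmS : ∀ w, MeasurableSet (dyadicCell d R S w) := fun w => measurableSet_cell _ _ _ _
  have hFS : ∀ w, IsFiniteMeasure (μ.restrict (dyadicCell d R S w)) := fun w =>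
    isFiniteMeasure_restrict.2 (hfin w)
  have hFT : ∀ w, IsFiniteMeasure ((n • volume).restrict (T w)) := fun w =>
    isFiniteMeasure_restrict.2 (hfinT w)
  -- Normalized product coupling of the two cells of a leaf. If the leaf has no mass, the factor is
  -- `∞` but it multiplies the zero measure.
  let π : ℕ → Measure (EuclideanSpace ℝ (Fin d) × EuclideanSpace ℝ (Fin d)) := fun w =>
    (μ (dyadicCell d R S w))⁻¹ •
      (μ.restrict (dyadicCell d R S w)).prod ((n • volume).restrict (T w))
  have hfst : ∀ w, (π w).map Prod.fst = μ.restrict (dyadicCell d R S w) := by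
    intro w
    rw [Measure.map_smul, Measure.map_fst_prod, Measure.restrict_apply_univ, hmass, smul_smul]
    by_cases h0 : μ (dyadicCell d R S w) = 0
    · rw [Measure.restrict_eq_zero.2 h0, smul_zero]
    · rw [ENNReal.inv_mul_cancel h0 (hfin w), one_smul]
  have hsnd : ∀ w, (π w).map Prod.snd = (n • volume).restrict (T w) := by
    intro w
    rw [Measure.map_smul, Measure.map_snd_prod, Measure.restrict_apply_univ, smul_smul]
    by_cases h0 : μ (dyadicCell d R S w) = 0
    · rw [Measure.restrict_eq_zero.2 ((hmass w).trans h0), smul_zero]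
    · rw [ENNReal.inv_mul_cancel h0 (hfin w), one_smul]
  have hp0 : p ≠ 0 := by linarith
  rw [torusWasserstein, ← ENNReal.rpow_mul, one_div, inv_mul_cancel₀ hp0, ENNReal.rpow_one]
  have hmap : ∀ (s : Finset ℕ) (f : EuclideanSpace ℝ (Fin d) × EuclideanSpace ℝ (Fin d) →
      EuclideanSpace ℝ (Fin d)), Measurable f →
      (∑ w ∈ s, π w).map f = ∑ w ∈ s, (π w).map f := by
    intro s f hf
    rw [← Measure.mapₗ_apply_of_measurable hf, map_sum]
    simp_rw [Measure.mapₗ_apply_of_measurable hf]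
  refine (iInf₂_le (∑ w ∈ Finset.range (2 ^ S), π w) ?_).trans ((iInf_le _ ?_).trans ?_)
  · rw [hmap _ _ measurable_fst, restrict_torusBox_eq_sum_cell (ρ := fun _ _ => 1 / 2)
      (fun _ _ => by norm_num) (fun _ _ => by norm_num) hR.le μ S]
    exact Finset.sum_congr rfl fun w _ => hfst w
  · rw [hmap _ _ measurable_snd, restrict_torusBox_eq_sum_cell hN.countRatio_nonneg
      hN.countRatio_le_one hR.le (n • volume) S]
    exact Finset.sum_congr rfl fun w _ => hsnd w
  rw [lintegral_finsetSum_measure]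
  have hle : ∀ w < 2 ^ S, ∫⁻ z, ENNReal.ofReal (torusDist R z.1 z.2 ^ p) ∂(π w) ≤
      ENNReal.ofReal (cellCount R μ S w * δ w ^ p) := by
    intro w hw
    have hae : ∀ᵐ z ∂(π w), ENNReal.ofReal (torusDist R z.1 z.2 ^ p) ≤
        ENNReal.ofReal (δ w ^ p) := by
      refine Measure.ae_smul_measure ?_ _
      filter_upwards [Measure.quasiMeasurePreserving_fst.ae (ae_restrict_mem (hmS w)),
        Measure.quasiMeasurePreserving_snd.ae (ae_restrict_mem (hmT w))] with z hz1 hz2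
      refine ENNReal.ofReal_le_ofReal (Real.rpow_le_rpow (torusDist_nonneg _ _ _) ?_ (by linarith))
      exact (torusDist_le_dist _ _ _).trans (hδ w hw _ hz1 _ hz2)
    refine (lintegral_mono_ae hae).trans ?_
    have hmassπ : π w Set.univ = μ (dyadicCell d R S w) := by
      rw [← Set.preimage_univ (f := Prod.fst), ← Measure.map_apply measurable_fst .univ, hfst,
        Measure.restrict_apply_univ]
    rw [lintegral_const, hmassπ, ENNReal.ofReal_mul (hN.nonneg _ _), mul_comm, cellCount,
      ENNReal.ofReal_toReal (hfin w)]
  refine (Finset.sum_le_sum fun w hw => hle w (Finset.mem_range.1 hw)).trans ?_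
  rw [ENNReal.ofReal_sum_of_nonneg fun w _ =>
    mul_nonneg (hN.nonneg _ _) (Real.rpow_nonneg (hδ0 w) p)]

/-! ### Displacement of the cells -/

/-- The side length in direction `i` of the dyadic cells of depth `s`. -/
noncomputable def dyadicSide (d : ℕ) [NeZero d] (R : ℝ) (i : Fin d) (s : ℕ) : ℝ :=
  R / 2 ^ Nat.count (fun j => cutDir d j = i) s

lemma cellSide_half {d : ℕ} [NeZero d] (R : ℝ) (s c : ℕ) (i : Fin d) :
    cellSide (fun _ _ => 1 / 2) R s c i = dyadicSide d R i s := by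
  induction s generalizing c with
  | zero => simp [cellSide, dyadicSide]
  | succ s ih =>
    simp only [cellSide, ih, dyadicSide, Nat.count_succ, eq_comm (a := i)]
    split_ifs <;> field_simp <;> ring

lemma dyadicSide_nonneg {d : ℕ} [NeZero d] {R : ℝ} (hR : 0 ≤ R) (i : Fin d) (s : ℕ) :
    0 ≤ dyadicSide d R i s := by
  rw [dyadicSide]; positivity

lemma dyadicSide_le {d : ℕ} [NeZero d] {R : ℝ} (hR : 0 ≤ R) (i : Fin d) (s : ℕ) :
    dyadicSide d R i s ≤ R / 2 ^ (s / d) := by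
  have hd : 0 < d := Nat.pos_of_ne_zero (NeZero.ne d)
  -- Direction `i` is cut at the depths congruent to `i` modulo `d`, hence at least `⌊s / d⌋` times
  -- before depth `s`.
  have h : Nat.count (fun j => cutDir d j = i) s = Nat.count (· ≡ (i : ℕ) [MOD d]) s := by
    simp only [Nat.count_eq_card_filter_range]
    congr 1
    ext j
    simp only [Finset.mem_filter, cutDir, Fin.ext_iff, Fin.val_ofNat, Nat.ModEq,
      Nat.mod_eq_of_lt i.2]
  rw [dyadicSide, h, Nat.count_modEq_card _ hd]
  gcongr
  · norm_num
  · omega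

/-- The displacement of the lower corner and the change of the side length in direction `i`, for
the cells of a hierarchy of boxes relative to the dyadic ones, when cutting a cell `(s, c)` moves
the cut by `G s c`. -/
noncomputable def drift {d : ℕ} [NeZero d] (i : Fin d) (G : ℕ → ℕ → ℝ) : ℕ → ℕ → ℝ × ℝ
  | 0, _ => (0, 0)
  | s + 1, c =>
      if i = cutDir d s then
        if c % 2 = 0 then
          ((drift i G s (c / 2)).1, (drift i G s (c / 2)).2 / 2 + G s (c / 2))
        else
          ((drift i G s (c / 2)).1 + (drift i G s (c / 2)).2 / 2 + G s (c / 2),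
            (drift i G s (c / 2)).2 / 2 - G s (c / 2))
      else drift i G s (c / 2)

/-- With `H` and `L` the two side lengths, `ρ H - L / 2 = (H - L) / 2 + H (ρ - 1 / 2)`: each cut
passes on half of the side error and adds its own shift off the midpoint. -/
lemma cell_sub_dyadicCell_eq_drift {d : ℕ} [NeZero d] (ρ : ℕ → ℕ → ℝ) (R : ℝ) (i : Fin d)
    (s c : ℕ) :
    (cellPos ρ R s c i - cellPos (fun _ _ => 1 / 2) R s c i,
      cellSide ρ R s c i - dyadicSide d R i s) =
      drift i (fun s c => cellSide ρ R s c i * (ρ s c - 1 / 2)) s c := by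
  induction s generalizing c with
  | zero => simp [cellPos, cellSide, dyadicSide, drift]
  | succ s ih =>
    have h := ih (c / 2)
    have h1 := (Prod.ext_iff.1 h).1
    have h2 := (Prod.ext_iff.1 h).2
    have hL : dyadicSide d R i (s + 1) =
        if i = cutDir d s then dyadicSide d R i s / 2 else dyadicSide d R i s := by
      simp only [dyadicSide, Nat.count_succ, eq_comm (a := i)]
      split_ifs
      · rw [pow_succ, div_div]
      · simp
    set G : ℕ → ℕ → ℝ := fun s c => cellSide ρ R s c i * (ρ s c - 1 / 2)
    have hG : G s (c / 2) = cellSide ρ R s (c / 2) i * (ρ s (c / 2) - 1 / 2) := rfl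
    dsimp only at h1 h2
    simp only [drift, cellPos, cellSide_half, cellSide, ← h1, ← h2, hL, hG]
    ext <;> split_ifs <;> first | (exfalso; tauto) | exact h1 | exact h2 | ring1

lemma div_two_pow_succ_sub {s j : ℕ} (hj : j ≤ s) (c : ℕ) :
    c / 2 ^ (s + 1 - j) = c / 2 / 2 ^ (s - j) := by
  rw [Nat.div_div_eq_div_mul, ← pow_succ', Nat.succ_sub hj]

lemma sum_ancestors_succ {M : Type*} [AddCommMonoid M] (f : ℕ → ℕ → M) (s c : ℕ) :
    ∑ j ∈ Finset.range (s + 1), f j (c / 2 ^ (s + 1 - j)) =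
      ∑ j ∈ Finset.range s, f j (c / 2 / 2 ^ (s - j)) + f s (c / 2) := by
  rw [Finset.sum_range_succ]
  congr 1
  · refine Finset.sum_congr rfl fun j hj => ?_
    rw [div_two_pow_succ_sub (Finset.mem_range.1 hj).le]
  · simp

section Drift

variable {d : ℕ} [NeZero d] (i : Fin d)

lemma drift_sum {ι : Type*} (t : Finset ι) (x : ι → ℝ) (G : ι → ℕ → ℕ → ℝ) (s c : ℕ) :
    drift i (fun s c => ∑ v ∈ t, x v * G v s c) s c = ∑ v ∈ t, x v • drift i (G v) s c := by
  induction s generalizing c with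
  | zero => simp [drift]
  | succ s ih =>
    have e1 := congrArg Prod.fst (ih (c / 2))
    have e2 := congrArg Prod.snd (ih (c / 2))
    simp only [Prod.fst_sum, Prod.snd_sum, Prod.smul_fst, Prod.smul_snd, smul_eq_mul] at e1 e2
    ext <;> simp only [drift, Prod.fst_sum, Prod.snd_sum, Prod.smul_fst, Prod.smul_snd,
      smul_eq_mul] <;> split_ifs <;>
      simp only [e1, e2, Finset.sum_div, ← Finset.sum_add_distrib, ← Finset.sum_sub_distrib] <;>
      refine Finset.sum_congr rfl fun v _ => ?_ <;> ring

lemma drift_sub (G G' : ℕ → ℕ → ℝ) (s c : ℕ) :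
    drift i (fun s c => G s c - G' s c) s c = drift i G s c - drift i G' s c := by
  induction s generalizing c with
  | zero => simp [drift]
  | succ s ih =>
    have e1 := congrArg Prod.fst (ih (c / 2))
    have e2 := congrArg Prod.snd (ih (c / 2))
    simp only [Prod.fst_sub, Prod.snd_sub] at e1 e2
    ext <;> simp only [drift, Prod.fst_sub, Prod.snd_sub] <;> split_ifs <;>
      simp only [e1, e2] <;> ring

/-- For the upper child, `(u, e)` becomes `(u + e / 2 + g, e / 2 - g)`: the side error is shared
between the two components. Hence `|u| + |e|` is the right quantity to follow, since only the shifts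
`g` can make it grow. -/
lemma drift_succ_le (G : ℕ → ℕ → ℝ) (s c : ℕ) :
    |(drift i G (s + 1) c).1| + |(drift i G (s + 1) c).2| ≤
      |(drift i G s (c / 2)).1| + |(drift i G s (c / 2)).2| + 2 * |G s (c / 2)| := by
  simp only [drift]
  set u := (drift i G s (c / 2)).1
  set e := (drift i G s (c / 2)).2
  set g := G s (c / 2)
  split_ifs
  · grind
  · grind
  · linarith [abs_nonneg g]

/-- Unlike the position, the side error contracts by a factor two at each cut, so it stays
comparable to a single shift instead of accumulating. -/
lemma drift_snd_succ_le (G : ℕ → ℕ → ℝ) (s c : ℕ) (hi : i = cutDir d s) :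
    |(drift i G (s + 1) c).2| ≤ |(drift i G s (c / 2)).2| / 2 + |G s (c / 2)| := by
  simp only [drift, if_pos hi]
  set e := (drift i G s (c / 2)).2
  set g := G s (c / 2)
  split_ifs <;> grind

lemma drift_le_sum (G : ℕ → ℕ → ℝ) (s c : ℕ) :
    |(drift i G s c).1| + |(drift i G s c).2| ≤
      2 * ∑ j ∈ Finset.range s, |G j (c / 2 ^ (s - j))| := by
  induction s generalizing c with
  | zero => simp [drift]
  | succ s ih =>
    rw [sum_ancestors_succ (fun j c => |G j c|)]
    have := drift_succ_le i G s c
    have := ih (c / 2)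
    linarith

/-- Without shifts, `|u| + |e|` does not increase. This bounds the effect of the coarse cuts on a
leaf by their effect on its ancestor of depth `m`, so that a union bound over `2 ^ m` nodes
suffices. -/
lemma drift_le_of_eq_zero (G : ℕ → ℕ → ℝ) (m j c : ℕ) (hG : ∀ s, m ≤ s → ∀ c, G s c = 0) :
    |(drift i G (m + j) c).1| + |(drift i G (m + j) c).2| ≤
      |(drift i G m (c / 2 ^ j)).1| + |(drift i G m (c / 2 ^ j)).2| := by
  induction j generalizing c with
  | zero => simp
  | succ j ih =>
    have h1 := drift_succ_le i G (m + j) c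
    rw [hG (m + j) (by omega), abs_zero, mul_zero, add_zero] at h1
    have h2 := ih (c / 2)
    rw [Nat.div_div_eq_div_mul, ← pow_succ'] at h2
    exact h1.trans h2

lemma drift_congr {G G' : ℕ → ℕ → ℝ} (s c : ℕ)
    (h : ∀ j < s, G j (c / 2 ^ (s - j)) = G' j (c / 2 ^ (s - j))) :
    drift i G s c = drift i G' s c := by
  induction s generalizing c with
  | zero => simp [drift]
  | succ s ih =>
    have e := ih (c / 2) fun j hj => by
      rw [← div_two_pow_succ_sub hj.le]
      exact h j (by omega)
    have e' := h s (by omega)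
    rw [Nat.add_sub_cancel_left, pow_one] at e'
    simp only [drift, e, e']

end Drift

/-! ### Displacement along paths with small mass fluctuations -/

/-- Along the path from the root to the node `(s, c)`, the masses `N` deviate from their reference
values `lam` by relative errors at most `η`. -/
def PathGood (N : ℕ → ℕ → ℝ) (lam η : ℕ → ℝ) (s c : ℕ) : Prop :=
  ∀ j ≤ s, |N j (c / 2 ^ (s - j)) - lam j| ≤ η j * lam j

lemma PathGood.parent {N : ℕ → ℕ → ℝ} {lam η : ℕ → ℝ} {s c : ℕ}
    (h : PathGood N lam η (s + 1) c) : PathGood N lam η s (c / 2) := by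
  intro j hj
  rw [← div_two_pow_succ_sub hj]
  exact h j (by omega)

/-- The displacement of the cut when cell `(s, c)` is cut proportionally to the masses `N`. -/
noncomputable def cutShift {d : ℕ} [NeZero d] (N : ℕ → ℕ → ℝ) (R : ℝ) (i : Fin d) (s c : ℕ) : ℝ :=
  cellSide (countRatio N) R s c i * (countRatio N s c - 1 / 2)

/-- The linearization of `cutShift` around `N = lam`. -/
noncomputable def linCutShift {d : ℕ} [NeZero d] (N : ℕ → ℕ → ℝ) (lam : ℕ → ℝ) (R : ℝ) (i : Fin d)
    (s c : ℕ) : ℝ :=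
  dyadicSide d R i s * (N (s + 1) (2 * c) - N (s + 1) (2 * c + 1)) / (2 * lam s)

section Path

variable {d : ℕ} [NeZero d] {i : Fin d} {N : ℕ → ℕ → ℝ} {lam η : ℕ → ℝ} {R β : ℝ} {S : ℕ}

/-- Only one child lies on the path; its sibling is controlled as the parent's mass minus that of
the child. So `a - b` is, up to sign, twice the deviation of the child minus that of the parent. -/
lemma abs_children_sub_le (hN : IsTreeMass N) (hlam' : ∀ s, lam (s + 1) = lam s / 2)
    (hlam : ∀ s, 0 < lam s) {s c : ℕ} (hη : η s ≤ η (s + 1))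
    (h : PathGood N lam η (s + 1) c) :
    |N (s + 1) (2 * (c / 2)) - N (s + 1) (2 * (c / 2) + 1)| ≤ 2 * η (s + 1) * lam s := by
  have h0 := h s (by omega)
  have h1 := h (s + 1) le_rfl
  simp only [Nat.add_sub_cancel_left, pow_one, Nat.sub_self, pow_zero, Nat.div_one] at h0 h1
  have ha := hN.add s (c / 2)
  rw [hlam' s] at h1
  have hm : η s * lam s ≤ η (s + 1) * lam s := mul_le_mul_of_nonneg_right hη (hlam s).le
  rw [abs_le] at h0 h1 ⊢
  rcases Nat.mod_two_eq_zero_or_one c with hc | hc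
  · have e : 2 * (c / 2) = c := by omega
    rw [e] at ha ⊢
    constructor <;> linarith
  · have e : 2 * (c / 2) + 1 = c := by omega
    rw [e] at ha ⊢
    constructor <;> linarith

lemma abs_countRatio_sub_half_le (hN : IsTreeMass N) (hlam' : ∀ s, lam (s + 1) = lam s / 2)
    (hlam : ∀ s, 0 < lam s) {s c : ℕ} (hη : η s ≤ η (s + 1)) (hη8 : η s ≤ 1 / 8)
    (h : PathGood N lam η (s + 1) c) :
    |countRatio N s (c / 2) - 1 / 2| ≤ 2 * η (s + 1) := by
  have h0 := h s (by omega)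
  simp only [Nat.add_sub_cancel_left, pow_one] at h0
  have hl := hlam s
  have hNl : 7 / 8 * lam s ≤ N s (c / 2) := by
    have := (abs_le.1 h0).1
    nlinarith
  have hpos : 0 < N s (c / 2) := by linarith
  have hch := abs_children_sub_le hN hlam' hlam hη h
  have e : countRatio N s (c / 2) - 1 / 2 =
      (N (s + 1) (2 * (c / 2)) - N (s + 1) (2 * (c / 2) + 1)) / (2 * N s (c / 2)) := by
    rw [countRatio, div_sub_div _ _ hpos.ne' two_ne_zero, mul_comm (N s (c / 2)) 2]
    congr 1
    linarith [hN.add s (c / 2)]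
  rw [e, abs_div, abs_of_pos (by linarith : 0 < 2 * N s (c / 2)), div_le_iff₀ (by linarith)]
  have hη0 : 0 ≤ η (s + 1) := by
    by_contra hc
    have := (abs_nonneg _).trans hch
    nlinarith
  nlinarith

lemma eta_nonneg (hlam : ∀ s, 0 < lam s) {s c : ℕ} (h : PathGood N lam η s c) : 0 ≤ η s := by
  have := (abs_nonneg _).trans (h s le_rfl)
  exact nonneg_of_mul_nonneg_left this (hlam s)

/-- The induction closes because halving turns `8 β` into `4 β`, and the new shift is at most `(L +
8 β) * 2 η ≤ 2 β + 2 β`, by `L η ≤ β` and `η ≤ 1 / 8`. -/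
lemma abs_drift_snd_le (hN : IsTreeMass N) (hR : 0 ≤ R) (hlam' : ∀ s, lam (s + 1) = lam s / 2)
    (hlam : ∀ s, 0 < lam s) (hη : ∀ s < S, η s ≤ η (s + 1)) (hη8 : ∀ s ≤ S, η s ≤ 1 / 8)
    (hβ0 : 0 ≤ β) (hβ : ∀ s < S, dyadicSide d R i s * η (s + 1) ≤ β) {s c : ℕ} (hs : s ≤ S)
    (h : PathGood N lam η s c) :
    |(drift i (cutShift N R i) s c).2| ≤ 8 * β := by
  induction s generalizing c with
  | zero => simpa [drift] using hβ0
  | succ s ih =>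
    have hi := ih (by omega) h.parent
    by_cases hd : i = cutDir d s
    · refine (drift_snd_succ_le i _ s c hd).trans ?_
      have hside : cellSide (countRatio N) R s (c / 2) i = dyadicSide d R i s +
          (drift i (cutShift N R i) s (c / 2)).2 := by
        have := (Prod.ext_iff.1 (cell_sub_dyadicCell_eq_drift (countRatio N) R i s (c / 2))).2
        simp only at this
        exact sub_eq_iff_eq_add'.1 this
      have hr := abs_countRatio_sub_half_le hN hlam' hlam (hη s (by omega)) (hη8 s (by omega)) h
      have hL := dyadicSide_nonneg hR i s
      have h1 : |cutShift N R i s (c / 2)| ≤ (dyadicSide d R i s + 8 * β) * (2 * η (s + 1)) := by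
        rw [cutShift, abs_mul, hside]
        refine mul_le_mul ((abs_add_le _ _).trans ?_) hr (abs_nonneg _) (by positivity)
        rw [abs_of_nonneg hL]
        linarith
      have h2 := hβ s (by omega)
      have h3 := hη8 (s + 1) hs
      nlinarith
    · simp only [drift, if_neg hd]
      exact hi

lemma abs_cellSide_le (hN : IsTreeMass N) (hR : 0 ≤ R) (hlam' : ∀ s, lam (s + 1) = lam s / 2)
    (hlam : ∀ s, 0 < lam s) (hη : ∀ s < S, η s ≤ η (s + 1)) (hη8 : ∀ s ≤ S, η s ≤ 1 / 8)
    (hβ0 : 0 ≤ β) (hβ : ∀ s < S, dyadicSide d R i s * η (s + 1) ≤ β) {s c : ℕ} (hs : s ≤ S)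
    (h : PathGood N lam η s c) :
    |cellSide (countRatio N) R s c i - dyadicSide d R i s| ≤ 8 * β := by
  have := (Prod.ext_iff.1 (cell_sub_dyadicCell_eq_drift (countRatio N) R i s c)).2
  simp only at this
  rw [this]
  exact abs_drift_snd_le hN hR hlam' hlam hη hη8 hβ0 hβ hs h

lemma abs_cutShift_le (hN : IsTreeMass N) (hR : 0 ≤ R) (hlam' : ∀ s, lam (s + 1) = lam s / 2)
    (hlam : ∀ s, 0 < lam s) (hη : ∀ s < S, η s ≤ η (s + 1)) (hη8 : ∀ s ≤ S, η s ≤ 1 / 8)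
    (hβ0 : 0 ≤ β) (hβ : ∀ s < S, dyadicSide d R i s * η (s + 1) ≤ β) {s c : ℕ} (hs : s < S)
    (h : PathGood N lam η (s + 1) c) :
    |cutShift N R i s (c / 2)| ≤ (dyadicSide d R i s + 8 * β) * (2 * η (s + 1)) := by
  have h1 := abs_cellSide_le hN hR hlam' hlam hη hη8 hβ0 hβ hs.le h.parent
  have hr := abs_countRatio_sub_half_le hN hlam' hlam (hη s (by omega)) (hη8 s (by omega)) h
  have hL := dyadicSide_nonneg hR i s
  rw [cutShift, abs_mul]
  refine mul_le_mul ?_ hr (abs_nonneg _) (by positivity)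
  rw [abs_le] at h1 ⊢
  constructor <;> linarith

/-- With parent mass `n`, reference mass `l` and children `a`, `b`, the difference is `(a - b) ((H -
L) l + L (l - n)) / (2 n l)`, a product of two small factors: the linearization error carries an
extra `η` beyond `β`. -/
lemma abs_cutShift_sub_linCutShift_le (hN : IsTreeMass N) (hR : 0 ≤ R)
    (hlam' : ∀ s, lam (s + 1) = lam s / 2)
    (hlam : ∀ s, 0 < lam s) (hη : ∀ s < S, η s ≤ η (s + 1)) (hη8 : ∀ s ≤ S, η s ≤ 1 / 8)
    (hβ0 : 0 ≤ β) (hβ : ∀ s < S, dyadicSide d R i s * η (s + 1) ≤ β) {s c : ℕ} (hs : s < S)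
    (h : PathGood N lam η (s + 1) c) :
    |cutShift N R i s (c / 2) - linCutShift N lam R i s (c / 2)| ≤ 12 * β * η (s + 1) := by
  have h1 := abs_cellSide_le hN hR hlam' hlam hη hη8 hβ0 hβ hs.le h.parent
  have hL := dyadicSide_nonneg hR i s
  have hη' := hη s hs
  have h8 := hη8 s hs.le
  have hβs := hβ s hs
  have hl := hlam s
  have hη1 := eta_nonneg hlam h
  have h0 := h s (by omega)
  simp only [Nat.add_sub_cancel_left, pow_one] at h0
  have hch := abs_children_sub_le hN hlam' hlam hη' h
  have ha := hN.add s (c / 2)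
  rw [cutShift, linCutShift, countRatio]
  set L := dyadicSide d R i s
  set H := cellSide (countRatio N) R s (c / 2) i
  set n := N s (c / 2)
  set a := N (s + 1) (2 * (c / 2))
  set b := N (s + 1) (2 * (c / 2) + 1)
  set l := lam s
  have hNl : 7 / 8 * l ≤ n := by
    have := (abs_le.1 h0).1
    nlinarith
  have hpos : 0 < n := by linarith
  have e : H * (a / n - 1 / 2) - L * (a - b) / (2 * l) =
      (a - b) * ((H - L) * l + L * (l - n)) / (2 * n * l) := by
    rw [show b = n - a by linarith]
    field_simp
    ring
  rw [e, abs_div, abs_mul, abs_of_pos (by positivity : 0 < 2 * n * l), div_le_iff₀ (by positivity)]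
  have hLn : |L * (l - n)| ≤ β * l := by
    rw [abs_mul, abs_of_nonneg hL, abs_sub_comm]
    calc L * |n - l| ≤ L * (η (s + 1) * l) := by gcongr; exact h0.trans (by gcongr)
      _ = (L * η (s + 1)) * l := by ring
      _ ≤ β * l := by gcongr
  have hsum : |(H - L) * l + L * (l - n)| ≤ 9 * β * l := by
    refine (abs_add_le _ _).trans ?_
    rw [abs_mul, abs_of_pos hl]
    nlinarith
  calc |a - b| * |(H - L) * l + L * (l - n)| ≤ (2 * η (s + 1) * l) * (9 * β * l) := by gcongr
    _ = 18 * (β * η (s + 1) * l) * l := by ring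
    _ ≤ 24 * (β * η (s + 1) * l) * n := by
      have : 0 ≤ β * η (s + 1) * l := by positivity
      nlinarith
    _ = 12 * β * η (s + 1) * (2 * n * l) := by ring

/-- The estimates for the cut of a cell of depth `j` involve the masses of depth `j + 1`, hence the
good path to a child `c'` of the ancestor instead of to the ancestor itself. -/
lemma PathGood.ancestor {s c : ℕ} (h : PathGood N lam η s c) {j : ℕ} (hj : j < s) :
    ∃ c', c' / 2 = c / 2 ^ (s - j) ∧ PathGood N lam η (j + 1) c' := by
  refine ⟨c / 2 ^ (s - (j + 1)), ?_, ?_⟩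
  · rw [Nat.div_div_eq_div_mul, ← pow_succ]
    congr 2; omega
  · intro l hl
    rw [Nat.div_div_eq_div_mul, ← pow_add]
    have := h l (by omega)
    rwa [show s - (j + 1) + (j + 1 - l) = s - l by omega]

/-- Along good paths the cells that are cut proportionally to the masses are close to the dyadic
ones. -/
theorem abs_drift_le_sum (hN : IsTreeMass N) (hR : 0 ≤ R) (hlam' : ∀ s, lam (s + 1) = lam s / 2)
    (hlam : ∀ s, 0 < lam s) (hη : ∀ s < S, η s ≤ η (s + 1)) (hη8 : ∀ s ≤ S, η s ≤ 1 / 8)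
    (hβ0 : 0 ≤ β) (hβ : ∀ s < S, dyadicSide d R i s * η (s + 1) ≤ β) {s c : ℕ} (hs : s ≤ S)
    (h : PathGood N lam η s c) :
    |(drift i (cutShift N R i) s c).1| + |(drift i (cutShift N R i) s c).2| ≤
      4 * ∑ j ∈ Finset.range s, (dyadicSide d R i j + 8 * β) * η (j + 1) := by
  refine (drift_le_sum i _ s c).trans ?_
  have : ∑ j ∈ Finset.range s, |cutShift N R i j (c / 2 ^ (s - j))| ≤
      ∑ j ∈ Finset.range s, 2 * ((dyadicSide d R i j + 8 * β) * η (j + 1)) := by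
    refine Finset.sum_le_sum fun j hj => ?_
    rw [Finset.mem_range] at hj
    obtain ⟨c', h1, h2⟩ := h.ancestor hj
    have := abs_cutShift_le hN hR hlam' hlam hη hη8 hβ0 hβ (by omega) h2
    rw [h1] at this
    linarith
  rw [← Finset.mul_sum] at this
  linarith

/-- Along good paths the displacement is close to its linearization. -/
theorem abs_drift_sub_drift_le_sum (hN : IsTreeMass N) (hR : 0 ≤ R)
    (hlam' : ∀ s, lam (s + 1) = lam s / 2)
    (hlam : ∀ s, 0 < lam s) (hη : ∀ s < S, η s ≤ η (s + 1)) (hη8 : ∀ s ≤ S, η s ≤ 1 / 8)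
    (hβ0 : 0 ≤ β) (hβ : ∀ s < S, dyadicSide d R i s * η (s + 1) ≤ β) {s c : ℕ} (hs : s ≤ S)
    (h : PathGood N lam η s c) :
    |(drift i (cutShift N R i) s c).1 - (drift i (linCutShift N lam R i) s c).1| ≤
      24 * β * ∑ j ∈ Finset.range s, η (j + 1) := by
  have h1 := drift_le_sum i (fun s c => cutShift N R i s c - linCutShift N lam R i s c) s c
  rw [drift_sub, Prod.fst_sub] at h1
  refine (le_add_of_nonneg_right (abs_nonneg _)).trans (h1.trans ?_)
  have : ∑ j ∈ Finset.range s,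
      |cutShift N R i j (c / 2 ^ (s - j)) - linCutShift N lam R i j (c / 2 ^ (s - j))| ≤
      ∑ j ∈ Finset.range s, 12 * β * η (j + 1) := by
    refine Finset.sum_le_sum fun j hj => ?_
    rw [Finset.mem_range] at hj
    obtain ⟨c', h1, h2⟩ := h.ancestor hj
    have := abs_cutShift_sub_linCutShift_le hN hR hlam' hlam hη hη8 hβ0 hβ (by omega) h2
    rwa [h1] at this
  rw [← Finset.mul_sum] at this
  linarith

end Path

/-- The distance of a point in a dyadic cell to a point in the corresponding cell cut
proportionally to the masses. -/
theorem dist_le_of_drift_le {d : ℕ} [NeZero d] {N : ℕ → ℕ → ℝ} {R : ℝ} {s c : ℕ}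
    {b : Fin d → ℝ} (hb : ∀ i, |(drift i (cutShift N R i) s c).1| +
      |(drift i (cutShift N R i) s c).2| + 2 * dyadicSide d R i s ≤ b i)
    {x y : EuclideanSpace ℝ (Fin d)} (hx : x ∈ dyadicCell d R s c)
    (hy : y ∈ cell (countRatio N) R s c) : dist x y ≤ ∑ i, b i := by
  have hi : ∀ i, |x i - y i| ≤ b i := by
    intro i
    have h := cell_sub_dyadicCell_eq_drift (countRatio N) R i s c
    have h1 := (Prod.ext_iff.1 h).1
    have h2 := (Prod.ext_iff.1 h).2
    simp only at h1 h2
    change _ = (drift i (cutShift N R i) s c).1 at h1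
    change _ = (drift i (cutShift N R i) s c).2 at h2
    have hx' := hx i
    have hy' := hy i
    rw [cellSide_half] at hx'
    have hb' := hb i
    rw [← h1, ← h2] at hb'
    rw [Set.mem_Ico] at hx' hy'
    have a1 := abs_le.1 (le_refl |cellPos (countRatio N) R s c i -
      cellPos (fun _ _ => 1 / 2) R s c i|)
    have a2 := abs_le.1 (le_refl |cellSide (countRatio N) R s c i - dyadicSide d R i s|)
    rw [abs_le]
    constructor <;> linarith
  rw [EuclideanSpace.dist_eq]
  have hb0 : ∀ i ∈ Finset.univ, 0 ≤ b i := fun i _ => (abs_nonneg _).trans (hi i)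
  rw [Real.sqrt_le_left (Finset.sum_nonneg hb0)]
  calc ∑ i, dist (x i) (y i) ^ 2 ≤ ∑ i, b i ^ 2 := by
        refine Finset.sum_le_sum fun i _ => ?_
        rw [Real.dist_eq]
        exact pow_le_pow_left₀ (abs_nonneg _) (hi i) 2
    _ ≤ (∑ i, b i) ^ 2 := Finset.sum_sq_le_sq_sum_of_nonneg hb0

/-! ### Exponential moments and concentration for Poisson counts -/

lemma measurableSet_dyadicCell (d : ℕ) [NeZero d] (R : ℝ) (s c : ℕ) :
    MeasurableSet (dyadicCell d R s c) :=
  measurableSet_cell _ _ _ _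

lemma lintegral_exp_poissonMeasure (r : ℝ≥0) (a : ℝ) :
    ∫⁻ n, ENNReal.ofReal (Real.exp (a * ((n : ℝ) - r))) ∂(poissonMeasure r) =
      ENNReal.ofReal (Real.exp (r * (Real.exp a - 1 - a))) := by
  rw [poissonMeasure, lintegral_sum_measure]
  simp only [lintegral_smul_measure, lintegral_dirac, smul_eq_mul]
  have h : HasSum (fun n : ℕ => Real.exp (-r - a * r) * ((r * Real.exp a) ^ n / n.factorial))
      (Real.exp (-r - a * r) * Real.exp (r * Real.exp a)) := by
    have := (NormedSpace.expSeries_div_hasSum_exp (r * Real.exp a : ℝ)).mul_left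
      (Real.exp (-r - a * r))
    rwa [← Real.exp_eq_exp_ℝ] at this
  have e : ∀ n : ℕ, ENNReal.ofReal (Real.exp (-r) * (r : ℝ) ^ n / n.factorial) *
      ENNReal.ofReal (Real.exp (a * ((n : ℝ) - r))) =
      ENNReal.ofReal (Real.exp (-r - a * r) * ((r * Real.exp a) ^ n / n.factorial)) := by
    intro n
    rw [← ENNReal.ofReal_mul (by positivity)]
    congr 1
    rw [mul_pow, ← Real.exp_nat_mul, show -(r : ℝ) - a * r = -r + -(a * r) by ring, Real.exp_add,
      show a * ((n : ℝ) - r) = n * a + -(a * r) by ring, Real.exp_add]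
    ring
  simp_rw [e]
  rw [← ENNReal.ofReal_tsum_of_nonneg (fun n => by positivity) h.summable, h.tsum_eq,
    ← Real.exp_add]
  congr 2
  ring

/-- A family of independent random variables whose exponential moments are dominated by those of
a sum of squares, as is the case for Poisson variables of parameter `lam`. -/
structure IsSubPoissonFamily {Ω ι : Type*} [MeasurableSpace Ω] (P : Measure Ω) (X : ι → Ω → ℝ)
    (lam : ℝ) : Prop where
  measurable : ∀ v, Measurable (X v)
  indep : iIndepFun X P
  lintegral_exp_le : ∀ v a, |a| ≤ 1 →
    ∫⁻ ω, ENNReal.ofReal (Real.exp (a * (X v ω - lam))) ∂P ≤ ENNReal.ofReal (Real.exp (lam * a ^ 2))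

/-- The centred Poisson log-moment generating function is `lam (e ^ a - 1 - a)`, which is at most
`lam a ^ 2` for `|a| ≤ 1`. Independence comes from disjointness of the dyadic leaves. -/
lemma IsPoissonProcess.isSubPoissonFamily {Ω : Type*} [MeasurableSpace Ω] {P : Measure Ω}
    {d : ℕ} [NeZero d] {R : ℝ} (hR : 0 ≤ R) {μ : Ω → Measure (EuclideanSpace ℝ (Fin d))}
    (hμ : IsPoissonProcess P μ (volume.restrict (torusBox d R))) (S : ℕ) :
    IsSubPoissonFamily P (fun (v : Fin (2 ^ S)) ω => cellCount R (μ ω) S v) (R ^ d / 2 ^ S) := by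
  have hm : ∀ v : ℕ, Measurable fun ω => μ ω (dyadicCell d R S v) := fun v =>
    (Measure.measurable_coe (measurableSet_cell _ _ _ _)).comp hμ.measurable
  refine ⟨fun v => (hm v).ennreal_toReal, ?_, ?_⟩
  · refine (hμ.indep_count (2 ^ S) (fun v => dyadicCell d R S v)
      (fun v => measurableSet_cell _ _ _ _) ?_).comp (fun _ => ENNReal.toReal)
      (fun _ => ENNReal.measurable_toReal)
    intro v v' hv
    refine disjoint_cell (fun _ _ => by norm_num) (fun _ _ => by norm_num) hR S ?_
      fun h => hv (Fin.ext h)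
    rw [Nat.div_eq_of_lt v.2, Nat.div_eq_of_lt v'.2]
  · intro v a ha
    have hvol : (volume.restrict (torusBox d R)) (dyadicCell d R S v) =
        ENNReal.ofReal (R ^ d / 2 ^ S) := by
      rw [Measure.restrict_apply (measurableSet_dyadicCell _ _ _ _),
        Set.inter_eq_left.2 (dyadicCell_subset hR S v), volume_dyadicCell hR]
    have hlaw := hμ.law_count (dyadicCell d R S v) (measurableSet_cell _ _ _ _)
      (by rw [hvol]; exact ENNReal.ofReal_ne_top)
    rw [hvol] at hlaw
    set r : ℝ≥0 := (ENNReal.ofReal (R ^ d / 2 ^ S)).toNNReal with hr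
    have hr' : (r : ℝ) = R ^ d / 2 ^ S := by
      rw [hr]
      change (ENNReal.ofReal (R ^ d / 2 ^ S)).toReal = _
      exact ENNReal.toReal_ofReal (by positivity)
    have hmeas : Measurable fun x : ℝ≥0∞ =>
        ENNReal.ofReal (Real.exp (a * (x.toReal - R ^ d / 2 ^ S))) := by fun_prop
    have h1 := lintegral_map (μ := P) hmeas (hm v)
    rw [hlaw, lintegral_map hmeas .of_discrete] at h1
    calc ∫⁻ ω, ENNReal.ofReal (Real.exp (a * (cellCount R (μ ω) S v - R ^ d / 2 ^ S))) ∂P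
        = ∫⁻ n, ENNReal.ofReal (Real.exp (a * ((n : ℝ) - r))) ∂(poissonMeasure r) := by
          rw [hr']
          simpa [cellCount] using h1.symm
      _ ≤ ENNReal.ofReal (Real.exp (R ^ d / 2 ^ S * a ^ 2)) := by
          rw [lintegral_exp_poissonMeasure, hr']
          have := (abs_le.1 (Real.abs_exp_sub_one_sub_id_le ha)).2
          gcongr

lemma IsPoissonProcess.ae_ne_top {Ω X : Type*} [MeasurableSpace Ω] [MeasurableSpace X]
    {P : Measure Ω} {μ : Ω → Measure X} {Λ : Measure X} (hμ : IsPoissonProcess P μ Λ) {A : Set X}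
    (hA : MeasurableSet A) (hΛ : Λ A ≠ ∞) : ∀ᵐ ω ∂P, μ ω A ≠ ∞ := by
  have hm : Measurable fun ω => μ ω A := (Measure.measurable_coe hA).comp hμ.measurable
  have h := congrArg (fun ν : Measure ℝ≥0∞ => ν {∞}) (hμ.law_count A hA hΛ)
  rw [Measure.map_apply hm (measurableSet_singleton _),
    Measure.map_apply .of_discrete (measurableSet_singleton _)] at h
  have he : (fun n : ℕ => (n : ℝ≥0∞)) ⁻¹' {∞} = ∅ := by
    ext n; simp
  rw [he, measure_empty] at h
  rw [ae_iff]
  convert h using 2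
  ext ω; simp

lemma measure_ge_le_of_lintegral_exp_le {Ω : Type*} [MeasurableSpace Ω] {P : Measure Ω}
    {Y : Ω → ℝ} (hY : Measurable Y) {B : ℝ}
    (h : ∫⁻ ω, ENNReal.ofReal (Real.exp (Y ω)) ∂P ≤ ENNReal.ofReal (Real.exp B)) (t : ℝ) :
    P {ω | t ≤ Y ω} ≤ ENNReal.ofReal (Real.exp (B - t)) := by
  have h1 := mul_meas_ge_le_lintegral (μ := P)
    (f := fun ω => ENNReal.ofReal (Real.exp (Y ω))) (by fun_prop) (ENNReal.ofReal (Real.exp t))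
  have e : {ω | ENNReal.ofReal (Real.exp t) ≤ ENNReal.ofReal (Real.exp (Y ω))} =
      {ω | t ≤ Y ω} := by
    ext ω
    simp [ENNReal.ofReal_le_ofReal_iff (Real.exp_pos _).le]
  rw [e] at h1
  have h2 := h1.trans h
  rw [Real.exp_sub, ENNReal.ofReal_div_of_pos (Real.exp_pos _),
    ENNReal.le_div_iff_mul_le (by simp [Real.exp_pos]) (by simp), mul_comm]
  exact h2

namespace IsSubPoissonFamily

variable {Ω ι : Type*} [MeasurableSpace Ω] {P : Measure Ω} {X : ι → Ω → ℝ} {lam : ℝ}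

lemma lintegral_exp_sum_le [Fintype ι] (h : IsSubPoissonFamily P X lam) (c : ι → ℝ)
    (hc : ∀ v, |c v| ≤ 1) :
    ∫⁻ ω, ENNReal.ofReal (Real.exp (∑ v, c v * (X v ω - lam))) ∂P ≤
      ENNReal.ofReal (Real.exp (lam * ∑ v, c v ^ 2)) := by
  have hind : iIndepFun (fun v ω => ENNReal.ofReal (Real.exp (c v * (X v ω - lam)))) P :=
    h.indep.comp (fun v x => ENNReal.ofReal (Real.exp (c v * (x - lam)))) fun v => by fun_prop
  have hm := h.measurable
  have h1 := lintegral_prod_eq_prod_lintegral_of_indepFun Finset.univ _ hind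
    fun v => by have := hm v; fun_prop
  simp_rw [Real.exp_sum, ENNReal.ofReal_prod_of_nonneg fun _ _ => (Real.exp_pos _).le]
  rw [h1, Finset.mul_sum, Real.exp_sum,
    ENNReal.ofReal_prod_of_nonneg fun _ _ => (Real.exp_pos _).le]
  exact Finset.prod_le_prod' fun v _ => h.lintegral_exp_le v (c v) (hc v)

/-- Chernoff's bound with parameter `± η / 2`, which optimizes the quadratic exponent and is
admissible since `η ≤ 1`. -/
lemma measure_abs_sum_sub_ge_le [Fintype ι] [DecidableEq ι] (h : IsSubPoissonFamily P X lam)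
    (A : Finset ι) {η : ℝ} (hη0 : 0 ≤ η) (hη : η ≤ 1) :
    P {ω | η * (A.card * lam) ≤ |∑ v ∈ A, X v ω - A.card * lam|} ≤
      ENNReal.ofReal (2 * Real.exp (-(A.card * lam * η ^ 2 / 4))) := by
  have hm := h.measurable
  have key : ∀ a : ℝ, |a| = η / 2 →
      P {ω | η / 2 * (η * (A.card * lam)) ≤ a * (∑ v ∈ A, X v ω - A.card * lam)} ≤
        ENNReal.ofReal (Real.exp (-(A.card * lam * η ^ 2 / 4))) := by
    intro a ha
    have h1 := h.lintegral_exp_sum_le (fun v => if v ∈ A then a else 0) fun v => by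
      split_ifs
      · rw [ha]; linarith
      · simp
    have e1 : ∀ ω, ∑ v, (if v ∈ A then a else 0) * (X v ω - lam) =
        a * (∑ v ∈ A, X v ω - A.card * lam) := by
      intro ω
      simp only [ite_mul, zero_mul, Finset.sum_ite_mem, Finset.univ_inter]
      rw [← Finset.mul_sum, Finset.sum_sub_distrib]
      simp
    have e2 : ∑ v, (if v ∈ A then a else 0) ^ 2 = A.card * (η / 2) ^ 2 := by
      have : a ^ 2 = (η / 2) ^ 2 := by rw [← ha, sq_abs]
      simp [ite_pow, this]
    simp_rw [e1] at h1
    rw [e2] at h1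
    refine (measure_ge_le_of_lintegral_exp_le (by fun_prop) h1 _).trans_eq ?_
    congr 2
    ring
  rw [two_mul, ENNReal.ofReal_add (Real.exp_pos _).le (Real.exp_pos _).le]
  refine (measure_mono ?_).trans ((measure_union_le _ _).trans
    (add_le_add (key (η / 2) (abs_of_nonneg (by linarith)))
      (key (-(η / 2)) (by rw [abs_neg, abs_of_nonneg (by linarith)]))))
  intro ω hω
  rcases le_abs.1 (Set.mem_ofPred_eq.mp hω) with hω | hω
  · left
    exact mul_le_mul_of_nonneg_left hω (by linarith)
  · right
    rw [Set.mem_ofPred_eq, neg_mul, ← mul_neg]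
    exact mul_le_mul_of_nonneg_left hω (by linarith)

lemma indepFun_of_disjoint (h : IsSubPoissonFamily P X lam) {A B : Finset ι} (hAB : Disjoint A B)
    {f : (A → ℝ) → ℝ} {g : (B → ℝ) → ℝ} (hf : Measurable f) (hg : Measurable g) :
    IndepFun (fun ω => f fun v => X v ω) (fun ω => g fun v => X v ω) P :=
  (h.indep.indepFun_finset A B hAB h.measurable).comp hf hg

end IsSubPoissonFamily

/-- A quantitative weak law of large numbers for pairwise independent nonnegative variables. -/
lemma measure_sum_ge_le_of_pairwise_indepFun {Ω : Type*} [MeasurableSpace Ω] {P : Measure Ω}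
    [IsProbabilityMeasure P] {M : ℕ} (hM : 0 < M) {Y : ℕ → Ω → ℝ} (hY : ∀ c, Measurable (Y c))
    (hY0 : ∀ c ω, 0 ≤ Y c ω) {e V δ : ℝ} (he0 : 0 ≤ e) (hV0 : 0 ≤ V) (hδ : 0 < δ)
    (he : ∀ c < M, ∫⁻ ω, ENNReal.ofReal (Y c ω) ∂P ≤ ENNReal.ofReal e)
    (hV : ∀ c < M, ∫⁻ ω, ENNReal.ofReal (Y c ω ^ 2) ∂P ≤ ENNReal.ofReal V)
    (hind : ∀ c < M, ∀ c' < M, c ≠ c' → IndepFun (Y c) (Y c') P) :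
    P {ω | M * (e + δ) ≤ ∑ c ∈ Finset.range M, Y c ω} ≤ ENNReal.ofReal (V / (M * δ ^ 2)) := by
  have hM' : (0 : ℝ) < M := by exact_mod_cast hM
  have hL : ∀ c ∈ Finset.range M, MemLp (Y c) 2 P := by
    intro c hc
    rw [memLp_two_iff_integrable_sq (hY c).aestronglyMeasurable]
    refine ⟨((hY c).pow_const 2).aestronglyMeasurable, ?_⟩
    rw [hasFiniteIntegral_iff_ofReal (.of_forall fun ω => sq_nonneg _)]
    exact (hV c (Finset.mem_range.1 hc)).trans_lt ENNReal.ofReal_lt_top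
  have hI : ∀ c ∈ Finset.range M, P[Y c] ≤ e := by
    intro c hc
    rw [integral_eq_lintegral_of_nonneg_ae (.of_forall (hY0 c)) (hY c).aestronglyMeasurable]
    exact ENNReal.toReal_le_of_le_ofReal he0 (he c (Finset.mem_range.1 hc))
  have hvar : ∀ c ∈ Finset.range M, variance (Y c) P ≤ V := by
    intro c hc
    refine (variance_le_expectation_sq (hY c).aestronglyMeasurable).trans ?_
    simp only [Pi.pow_apply]
    rw [integral_eq_lintegral_of_nonneg_ae (.of_forall fun ω => sq_nonneg _)
      ((hY c).pow_const 2).aestronglyMeasurable]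
    exact ENNReal.toReal_le_of_le_ofReal hV0 (hV c (Finset.mem_range.1 hc))
  have hvs : variance (∑ c ∈ Finset.range M, Y c) P ≤ M * V := by
    rw [IndepFun.variance_sum hL fun c hc c' hc' hcc => hind c (by simpa using hc) c'
      (by simpa using hc') hcc]
    exact (Finset.sum_le_sum hvar).trans_eq (by simp)
  have hIs : P[∑ c ∈ Finset.range M, Y c] ≤ M * e := by
    simp only [Finset.sum_apply]
    rw [integral_finsetSum _ fun c hc => (hL c hc).integrable (by norm_num)]
    exact (Finset.sum_le_sum hI).trans_eq (by simp)
  have hch := meas_ge_le_variance_div_sq (memLp_finsetSum' _ hL) (mul_pos hM' hδ)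
  refine (measure_mono ?_).trans (hch.trans (ENNReal.ofReal_le_ofReal ?_))
  · intro ω hω
    rw [Set.mem_ofPred_eq] at hω ⊢
    rw [Finset.sum_apply]
    refine le_trans ?_ (le_abs_self _)
    rw [mul_add] at hω
    linarith
  · calc variance (∑ c ∈ Finset.range M, Y c) P / (M * δ) ^ 2 ≤ M * V / (M * δ) ^ 2 := by gcongr
      _ = V / (M * δ ^ 2) := by field_simp

/-! ### The linearized displacement as a sum over leaves -/

/-- The leaves of depth `S` below the node `(s, c)` of the binary tree. -/
def leavesBelow (S s c : ℕ) : Finset (Fin (2 ^ S)) :=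
  Finset.univ.filter fun v => (v : ℕ) / 2 ^ (S - s) = c

lemma mem_leavesBelow {S s c : ℕ} {v : Fin (2 ^ S)} :
    v ∈ leavesBelow S s c ↔ (v : ℕ) / 2 ^ (S - s) = c := by
  simp [leavesBelow]

lemma disjoint_leavesBelow {S s c c' : ℕ} (h : c ≠ c') :
    Disjoint (leavesBelow S s c) (leavesBelow S s c') := by
  rw [Finset.disjoint_left]
  intro v hv hv'
  rw [mem_leavesBelow] at hv hv'
  exact h (hv.symm.trans hv')

lemma leavesBelow_eq_union {S s : ℕ} (hs : s < S) (c : ℕ) :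
    leavesBelow S s c = leavesBelow S (s + 1) (2 * c) ∪ leavesBelow S (s + 1) (2 * c + 1) := by
  ext v
  rw [Finset.mem_union, mem_leavesBelow, mem_leavesBelow, mem_leavesBelow,
    show S - s = S - (s + 1) + 1 by omega, pow_succ, ← Nat.div_div_eq_div_mul]
  omega

lemma sum_leavesBelow {N : ℕ → ℕ → ℝ}
    (hN : ∀ s c, N s c = N (s + 1) (2 * c) + N (s + 1) (2 * c + 1))
    {S s c : ℕ} (hs : s ≤ S) (hc : c < 2 ^ s) : ∑ v ∈ leavesBelow S s c, N S v = N s c := by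
  induction hs using Nat.decreasingInduction generalizing c with
  | self =>
    have : leavesBelow S S c = {⟨c, hc⟩} := by
      ext v
      simp [mem_leavesBelow, Fin.ext_iff]
    simp [this]
  | of_succ s hs ih =>
    rw [leavesBelow_eq_union hs, Finset.sum_union (disjoint_leavesBelow (by omega)),
      ih (by rw [pow_succ']; omega), ih (by rw [pow_succ']; omega), ← hN]

lemma card_leavesBelow {S s c : ℕ} (hs : s ≤ S) (hc : c < 2 ^ s) :
    (leavesBelow S s c).card = 2 ^ (S - s) := by
  have h := sum_leavesBelow (N := fun s _ => (2 : ℝ) ^ S / 2 ^ s)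
    (fun s c => by rw [pow_succ]; field_simp; norm_num) hs hc
  have h2 : (2 : ℝ) ^ S / 2 ^ S = 1 := div_self (by positivity)
  simp only [h2, Finset.sum_const, nsmul_eq_mul, mul_one] at h
  rw [div_eq_mul_inv, ← pow_sub₀ _ two_ne_zero hs] at h
  exact_mod_cast h

/-- The unit mass at the leaf `v` of depth `S`, as a function on the nodes of the binary tree. -/
noncomputable def unitMass (S v s c : ℕ) : ℝ := if v / 2 ^ (S - s) = c then 1 else 0

/-- The function `G` restricted to nodes of depth at least `lo`. -/
noncomputable def fromDepth (lo : ℕ) (G : ℕ → ℕ → ℝ) (s c : ℕ) : ℝ := if lo ≤ s then G s c else 0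

section Coefficients

variable {d : ℕ} [NeZero d]

/-- The constant `l` cancels because two siblings have equally many leaves below them. Choosing it
as the mean leaf mass writes the shift as a combination of centred independent variables. -/
lemma linCutShift_eq_sum {N : ℕ → ℕ → ℝ}
    (hN : ∀ s c, N s c = N (s + 1) (2 * c) + N (s + 1) (2 * c + 1)) (lam : ℕ → ℝ) (R : ℝ)
    (i : Fin d) {S s c : ℕ} (hs : s < S) (hc : c < 2 ^ s) (l : ℝ) :
    linCutShift N lam R i s c =
      ∑ v : Fin (2 ^ S), (N S v - l) * linCutShift (unitMass S v) lam R i s c := by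
  have key : ∀ c < 2 ^ (s + 1), ∑ v : Fin (2 ^ S), (N S v - l) * unitMass S v (s + 1) c =
      N (s + 1) c - 2 ^ (S - (s + 1)) * l := by
    intro c hc
    rw [← sum_leavesBelow hN (show s + 1 ≤ S from hs) hc]
    simp only [unitMass, mul_ite, mul_one, mul_zero]
    rw [← Finset.sum_filter]
    change ∑ v ∈ leavesBelow S (s + 1) c, (N S v - l) = _
    rw [Finset.sum_sub_distrib, Finset.sum_const, card_leavesBelow hs hc]
    simp
  have h1 := key (2 * c) (by rw [pow_succ']; omega)
  have h2 := key (2 * c + 1) (by rw [pow_succ']; omega)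
  simp only [linCutShift]
  have e : N (s + 1) (2 * c) - N (s + 1) (2 * c + 1) =
      ∑ v : Fin (2 ^ S), (N S v - l) * unitMass S v (s + 1) (2 * c) -
      ∑ v : Fin (2 ^ S), (N S v - l) * unitMass S v (s + 1) (2 * c + 1) := by
    rw [h1, h2]; ring
  rw [e, ← Finset.sum_sub_distrib, Finset.mul_sum, Finset.sum_div]
  refine Finset.sum_congr rfl fun v _ => ?_
  ring

/-- A leaf influences only the cuts of its own ancestors. -/
lemma abs_linCutShift_unitMass_le {lam : ℕ → ℝ} (hlam : ∀ s, 0 < lam s) {R : ℝ} (hR : 0 ≤ R)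
    (i : Fin d) {S s : ℕ} (hs : s < S) (v c : ℕ) :
    |linCutShift (unitMass S v) lam R i s c| ≤
      if v / 2 ^ (S - s) = c then dyadicSide d R i s / (2 * lam s) else 0 := by
  have hl := hlam s
  have hL := dyadicSide_nonneg hR i s
  have e : v / 2 ^ (S - s) = v / 2 ^ (S - (s + 1)) / 2 := by
    rw [Nat.div_div_eq_div_mul, ← pow_succ]
    congr 2; omega
  rw [linCutShift, mul_div_right_comm, abs_mul, abs_of_nonneg (by positivity), e]
  simp only [unitMass]
  generalize v / 2 ^ (S - (s + 1)) = q
  have h0 : 0 ≤ dyadicSide d R i s / (2 * lam s) := by positivity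
  by_cases h1 : q = 2 * c
  · simp [h1]
  · by_cases h2 : q = 2 * c + 1
    · simp [h2, odd_div_two]
    · simp only [h1, h2, if_false, sub_self, abs_zero, mul_zero]
      split_ifs <;> simp [h0]

/-- The coefficient of the mass of the leaf `v` in the linearized displacement of the node
`(s, c)` caused by the cuts of the cells of depth at least `lo`. -/
noncomputable def driftCoeff (lam : ℕ → ℝ) (R : ℝ) (i : Fin d) (S lo s c v : ℕ) : ℝ × ℝ :=
  drift i (fromDepth lo (linCutShift (unitMass S v) lam R i)) s c

lemma drift_fromDepth_eq_sum {N : ℕ → ℕ → ℝ}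
    (hN : ∀ s c, N s c = N (s + 1) (2 * c) + N (s + 1) (2 * c + 1)) (lam : ℕ → ℝ) (R : ℝ)
    (i : Fin d) (S lo : ℕ) {s c : ℕ} (hs : s ≤ S) (hc : c < 2 ^ s) (l : ℝ) :
    drift i (fromDepth lo (linCutShift N lam R i)) s c =
      ∑ v : Fin (2 ^ S), (N S v - l) • driftCoeff lam R i S lo s c v := by
  simp only [driftCoeff]
  rw [← drift_sum]
  refine drift_congr i s c fun j hj => ?_
  have hc' : c / 2 ^ (s - j) < 2 ^ j := by
    rw [Nat.div_lt_iff_lt_mul (by positivity), ← pow_add]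
    rwa [show j + (s - j) = s by omega]
  simp only [fromDepth]
  split_ifs
  · exact linCutShift_eq_sum hN lam R i (by omega) hc' l
  · simp

lemma abs_driftCoeff_le {lam : ℕ → ℝ} (hlam : ∀ s, 0 < lam s) {R : ℝ} (hR : 0 ≤ R)
    (i : Fin d) {S lo s c : ℕ} (hs : s ≤ S) (v : ℕ) :
    |(driftCoeff lam R i S lo s c v).1| + |(driftCoeff lam R i S lo s c v).2| ≤
      ∑ j ∈ Finset.range s, if lo ≤ j ∧ v / 2 ^ (S - j) = c / 2 ^ (s - j) then
        dyadicSide d R i j / lam j else 0 := by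
  refine (drift_le_sum i _ s c).trans ?_
  rw [Finset.mul_sum]
  refine Finset.sum_le_sum fun j hj => ?_
  rw [Finset.mem_range] at hj
  have h := abs_linCutShift_unitMass_le hlam hR i (show j < S by omega) v (c / 2 ^ (s - j))
  simp only [fromDepth]
  have hl := hlam j
  by_cases h1 : lo ≤ j
  · simp only [h1, if_true, true_and]
    split_ifs at h ⊢
    · calc _ ≤ 2 * (dyadicSide d R i j / (2 * lam j)) := by gcongr
        _ = _ := by field_simp
    · linarith
  · simp [h1]

/-- If two nodes have different ancestors of depth `lo`, they share no ancestor of depth at least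
`lo`. This is the source of the independence of the blocks in dimension two. -/
lemma driftCoeff_eq_zero {lam : ℕ → ℝ} (hlam : ∀ s, 0 < lam s) {R : ℝ} (hR : 0 ≤ R)
    (i : Fin d) {S lo s c : ℕ} (hs : s ≤ S) {v : ℕ}
    (hv : v / 2 ^ (S - lo) ≠ c / 2 ^ (s - lo)) :
    driftCoeff lam R i S lo s c v = 0 := by
  have h := abs_driftCoeff_le hlam hR i (lo := lo) (c := c) hs v
  rw [Finset.sum_eq_zero fun j hj => if_neg ?_] at h
  · have h1 := abs_nonneg (driftCoeff lam R i S lo s c v).1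
    have h2 := abs_nonneg (driftCoeff lam R i S lo s c v).2
    ext
    · exact abs_eq_zero.1 (by linarith)
    · exact abs_eq_zero.1 (by linarith)
  · rintro ⟨h1, h2⟩
    rw [Finset.mem_range] at hj
    refine hv ?_
    have := congrArg (· / 2 ^ (j - lo)) h2
    simp only [Nat.div_div_eq_div_mul, ← pow_add] at this
    rwa [show S - j + (j - lo) = S - lo by omega, show s - j + (j - lo) = s - lo by omega] at this

end Coefficients

/-! ### Dimension two: size of the coefficients -/

lemma sqrt_two_bounds : (1.414 : ℝ) < √2 ∧ √2 < (1.415 : ℝ) :=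
  ⟨Real.lt_sqrt_of_sq_lt (by norm_num), (Real.sqrt_lt' (by norm_num)).2 (by norm_num)⟩

lemma sqrt_two_pow_sq (j : ℕ) : (√2 ^ j) ^ 2 = 2 ^ j := by
  rw [← pow_mul, mul_comm, pow_mul, Real.sq_sqrt (by norm_num)]

lemma sum_sqrt_two_pow_le (ε : ℕ → Prop) [DecidablePred ε] (n : ℕ) :
    ∑ j ∈ Finset.range n, (if ε j then √2 ^ j else 0) ≤ 2.5 * √2 ^ n := by
  induction n with
  | zero => norm_num
  | succ n ih =>
    rw [Finset.sum_range_succ, pow_succ]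
    have h := sqrt_two_bounds.1
    have h2 : 0 < √2 ^ n := by positivity
    split_ifs <;> nlinarith

/-- A geometric sum is dominated by its last term, so the square of the sum is comparable to the sum
of the squares: with `A ≤ 2.5 √2 ^ n`, the cross term and the new square add at most `5 * 2 ^ n + 2
^ n`. Different scales thus contribute additively to the variance. -/
lemma sq_sum_sqrt_two_pow_le (ε : ℕ → Prop) [DecidablePred ε] (n : ℕ) :
    (∑ j ∈ Finset.range n, if ε j then √2 ^ j else 0) ^ 2 ≤
      6 * ∑ j ∈ Finset.range n, if ε j then (2 : ℝ) ^ j else 0 := by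
  induction n with
  | zero => simp
  | succ n ih =>
    rw [Finset.sum_range_succ, Finset.sum_range_succ]
    have h1 := sum_sqrt_two_pow_le ε n
    have h2 : 0 < √2 ^ n := by positivity
    have h3 := sqrt_two_pow_sq n
    split_ifs
    · nlinarith
    · simpa using ih

lemma dyadicSide_two_le (k : ℕ) (i : Fin 2) (j : ℕ) :
    dyadicSide 2 (2 ^ k) i j ≤ √2 * 2 ^ k / √2 ^ j := by
  refine (dyadicSide_le (by positivity) i j).trans ?_
  have h : √2 ^ j ≤ √2 * 2 ^ (j / 2) := by
    have h1 : √2 ^ (j / 2 * 2) = (2 : ℝ) ^ (j / 2) := by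
      rw [pow_mul, sqrt_two_pow_sq]
    have h2 : (1 : ℝ) ≤ √2 := by linarith [sqrt_two_bounds.1]
    calc √2 ^ j ≤ √2 ^ (j / 2 * 2 + 1) := pow_le_pow_right₀ h2 (by omega)
      _ = _ := by rw [pow_succ, h1]; ring
  rw [div_le_div_iff₀ (by positivity) (by positivity)]
  calc (2 : ℝ) ^ k * √2 ^ j ≤ 2 ^ k * (√2 * 2 ^ (j / 2)) := by gcongr
    _ = _ := by ring

/-- The area of the dyadic cells of depth `s` of a square of side `2 ^ k`. -/
noncomputable def cellArea (k s : ℕ) : ℝ := (2 ^ k) ^ 2 / 2 ^ s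

lemma cellArea_pos (k s : ℕ) : 0 < cellArea k s := by rw [cellArea]; positivity

lemma cellArea_succ (k s : ℕ) : cellArea k (s + 1) = cellArea k s / 2 := by
  rw [cellArea, cellArea, pow_succ (2 : ℝ) s, div_div]

lemma dyadicSide_two_div_cellArea_le (k : ℕ) (i : Fin 2) (j : ℕ) :
    dyadicSide 2 (2 ^ k) i j / cellArea k j ≤ √2 / 2 ^ k * √2 ^ j := by
  rw [div_le_iff₀ (cellArea_pos k j), cellArea]
  refine (dyadicSide_two_le k i j).trans_eq ?_
  rw [← sqrt_two_pow_sq j]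
  field_simp

/-- The coefficients of the linearized displacement in dimension two are small. -/
lemma abs_driftCoeff_two_le {k S : ℕ} (hS : 1024 * 2 ^ S ≤ ((2 : ℝ) ^ k) ^ 2) (i : Fin 2)
    {lo s c : ℕ} (hs : s ≤ S) (v : ℕ) :
    |(driftCoeff (cellArea k) (2 ^ k) i S lo s c v).1| +
      |(driftCoeff (cellArea k) (2 ^ k) i S lo s c v).2| ≤ 1 / 8 := by
  refine (abs_driftCoeff_le (cellArea_pos k) (by positivity) i hs v).trans ?_
  calc _ ≤ ∑ j ∈ Finset.range s, √2 / 2 ^ k *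
        (if lo ≤ j ∧ v / 2 ^ (S - j) = c / 2 ^ (s - j) then √2 ^ j else 0) := by
        refine Finset.sum_le_sum fun j _ => ?_
        split_ifs
        · exact dyadicSide_two_div_cellArea_le k i j
        · simp
    _ ≤ √2 / 2 ^ k * (2.5 * √2 ^ s) := by
        rw [← Finset.mul_sum]
        gcongr
        exact sum_sqrt_two_pow_le _ s
    _ ≤ √2 / 2 ^ k * (2.5 * (2 ^ k / 32)) := by
        gcongr
        have h2 : (1 : ℝ) ≤ √2 := by linarith [sqrt_two_bounds.1]
        refine (pow_le_pow_right₀ h2 hs).trans ?_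
        refine le_of_sq_le_sq ?_ (by positivity)
        rw [sqrt_two_pow_sq, div_pow]
        linarith
    _ = √2 * 2.5 / 32 := by field_simp
    _ ≤ 1 / 8 := by linarith [sqrt_two_bounds.2]

/-- The variance of the linearized displacement in dimension two grows linearly in the number of
scales. -/
lemma sum_sq_driftCoeff_two_le {k S : ℕ} (i : Fin 2) {lo s c : ℕ} (hlo : lo ≤ s) (hs : s ≤ S)
    (hc : c < 2 ^ s) :
    cellArea k S * ∑ v : Fin (2 ^ S),
      (|(driftCoeff (cellArea k) (2 ^ k) i S lo s c v).1| +
        |(driftCoeff (cellArea k) (2 ^ k) i S lo s c v).2|) ^ 2 ≤ 12 * (s - lo) := by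
  have hv : ∀ v : Fin (2 ^ S), (|(driftCoeff (cellArea k) (2 ^ k) i S lo s c v).1| +
        |(driftCoeff (cellArea k) (2 ^ k) i S lo s c v).2|) ^ 2 ≤
      12 / (2 ^ k) ^ 2 * ∑ j ∈ Finset.range s,
        if lo ≤ j ∧ (v : ℕ) / 2 ^ (S - j) = c / 2 ^ (s - j) then (2 : ℝ) ^ j else 0 := by
    intro v
    calc _ ≤ (∑ j ∈ Finset.range s, √2 / 2 ^ k *
        (if lo ≤ j ∧ (v : ℕ) / 2 ^ (S - j) = c / 2 ^ (s - j) then √2 ^ j else 0)) ^ 2 := by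
          gcongr
          refine (abs_driftCoeff_le (cellArea_pos k) (by positivity) i hs v).trans ?_
          refine Finset.sum_le_sum fun j _ => ?_
          split_ifs
          · exact dyadicSide_two_div_cellArea_le k i j
          · simp
      _ ≤ (√2 / 2 ^ k) ^ 2 * (6 * ∑ j ∈ Finset.range s,
          if lo ≤ j ∧ (v : ℕ) / 2 ^ (S - j) = c / 2 ^ (s - j) then (2 : ℝ) ^ j else 0) := by
          rw [← Finset.mul_sum, mul_pow]
          gcongr
          exact sq_sum_sqrt_two_pow_le _ s
      _ = _ := by
          rw [div_pow, Real.sq_sqrt (by norm_num)]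
          ring
  -- An ancestor of depth `j` has `2 ^ (S - j)` leaves, each weighted by `2 ^ j`: every scale
  -- contributes the same amount. This is where the logarithm of dimension two arises.
  have hj : ∀ j ∈ Finset.range s, ∑ v : Fin (2 ^ S),
      (if lo ≤ j ∧ (v : ℕ) / 2 ^ (S - j) = c / 2 ^ (s - j) then (2 : ℝ) ^ j else 0) =
      if lo ≤ j then (2 : ℝ) ^ S else 0 := by
    intro j hj
    rw [Finset.mem_range] at hj
    have hc' : c / 2 ^ (s - j) < 2 ^ j := by
      rw [Nat.div_lt_iff_lt_mul (by positivity), ← pow_add]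
      rwa [show j + (s - j) = s by omega]
    split_ifs with h
    · simp only [h, true_and]
      rw [← Finset.sum_filter]
      change ∑ v ∈ leavesBelow S j (c / 2 ^ (s - j)), _ = _
      rw [Finset.sum_const, card_leavesBelow (by omega) hc', nsmul_eq_mul]
      push_cast
      rw [← pow_add]
      congr 1; omega
    · simp [h]
  calc _ ≤ cellArea k S * ∑ v : Fin (2 ^ S), 12 / (2 ^ k) ^ 2 * ∑ j ∈ Finset.range s,
        (if lo ≤ j ∧ (v : ℕ) / 2 ^ (S - j) = c / 2 ^ (s - j) then (2 : ℝ) ^ j else 0) := by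
        have := (cellArea_pos k S).le
        gcongr with v
        exact hv v
    _ = cellArea k S * (12 / (2 ^ k) ^ 2 *
          ∑ j ∈ Finset.range s, if lo ≤ j then (2 : ℝ) ^ S else 0) := by
        rw [← Finset.mul_sum, Finset.sum_comm, Finset.sum_congr rfl hj]
    _ = 12 * (s - lo) := by
        have e : ∑ j ∈ Finset.range s, (if lo ≤ j then (2 : ℝ) ^ S else 0) =
            (s - lo) * 2 ^ S := by
          rw [← Finset.sum_filter, Finset.sum_const, nsmul_eq_mul]
          congr 1
          have : (Finset.range s).filter (fun j => lo ≤ j) = Finset.Ico lo s := by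
            ext j; simp [and_comm]
          rw [this, Nat.card_Ico, Nat.cast_sub hlo]
        rw [e, cellArea]
        field_simp

/-- The linearized displacement in dimension two as a function of the masses of the leaves. -/
noncomputable def planarDrift (k : ℕ) (i : Fin 2) (S lo s c : ℕ) (x : Fin (2 ^ S) → ℝ) : ℝ × ℝ :=
  ∑ v : Fin (2 ^ S), (x v - cellArea k S) • driftCoeff (cellArea k) (2 ^ k) i S lo s c v

lemma planarDrift_fst (k : ℕ) (i : Fin 2) (S lo s c : ℕ) (x : Fin (2 ^ S) → ℝ) :
    (planarDrift k i S lo s c x).1 = ∑ v : Fin (2 ^ S),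
      (driftCoeff (cellArea k) (2 ^ k) i S lo s c v).1 * (x v - cellArea k S) := by
  simp [planarDrift, Prod.fst_sum, mul_comm]

lemma planarDrift_snd (k : ℕ) (i : Fin 2) (S lo s c : ℕ) (x : Fin (2 ^ S) → ℝ) :
    (planarDrift k i S lo s c x).2 = ∑ v : Fin (2 ^ S),
      (driftCoeff (cellArea k) (2 ^ k) i S lo s c v).2 * (x v - cellArea k S) := by
  simp [planarDrift, Prod.snd_sum, mul_comm]

/-- The event on which the optimal bound for the transportation cost holds in dimension two: small
relative fluctuations of all masses, and control of the linearized displacement. -/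
structure PlanarGood (k S m : ℕ) (x : Fin (2 ^ S) → ℝ) : Prop where
  fluctuation : ∀ s ≤ S, ∀ c < 2 ^ s, |∑ v ∈ leavesBelow S s c, x v - cellArea k s| ≤
    4 * √k * √2 ^ s / 2 ^ k * cellArea k s
  coarse : ∀ i, ∀ c < 2 ^ m, |(planarDrift k i S 0 m c x).1| + |(planarDrift k i S 0 m c x).2| ≤
    28 * √k
  fine : ∑ w ∈ Finset.range (2 ^ S), ∑ i, (Real.exp (2 / √k * (planarDrift k i S m S w x).1) +
    Real.exp (-(2 / √k) * (planarDrift k i S m S w x).1)) ≤ (4 * Real.exp 96 + 1) * 2 ^ S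

/-! ### Dimension two: probability of the good event -/

section Probability

variable {Ω : Type*} [MeasurableSpace Ω] {P : Measure Ω} {k S : ℕ} {X : Fin (2 ^ S) → Ω → ℝ}

lemma lintegral_exp_linear_le (hX : IsSubPoissonFamily P X (cellArea k S))
    (hS : 1024 * 2 ^ S ≤ ((2 : ℝ) ^ k) ^ 2) (i : Fin 2) {lo s c : ℕ} (hlo : lo ≤ s) (hs : s ≤ S)
    (hc : c < 2 ^ s) {a : Fin (2 ^ S) → ℝ}
    (ha : ∀ v, |a v| ≤ |(driftCoeff (cellArea k) (2 ^ k) i S lo s c v).1| +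
      |(driftCoeff (cellArea k) (2 ^ k) i S lo s c v).2|) {θ : ℝ} (hθ : |θ| ≤ 8) :
    ∫⁻ ω, ENNReal.ofReal (Real.exp (θ * ∑ v, a v * (X v ω - cellArea k S))) ∂P ≤
      ENNReal.ofReal (Real.exp (12 * θ ^ 2 * (s - lo))) := by
  -- The sub-Poisson bound needs coefficients of modulus at most one; the coefficients are at most
  -- `1 / 8` and `|θ| ≤ 8`.
  have h1 := hX.lintegral_exp_sum_le (fun v => θ * a v) fun v => by
    have := (ha v).trans (abs_driftCoeff_two_le hS i hs v)
    rw [abs_mul]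
    calc |θ| * |a v| ≤ 8 * (1 / 8) := by gcongr
      _ = 1 := by norm_num
  have e : ∀ ω, ∑ v, θ * a v * (X v ω - cellArea k S) =
      θ * ∑ v, a v * (X v ω - cellArea k S) := by
    intro ω
    rw [Finset.mul_sum]
    exact Finset.sum_congr rfl fun v _ => by ring
  simp_rw [e] at h1
  refine h1.trans (ENNReal.ofReal_le_ofReal (Real.exp_le_exp.2 ?_))
  have h2 := sum_sq_driftCoeff_two_le (k := k) i hlo hs hc
  have h3 : ∑ v, (θ * a v) ^ 2 ≤ θ ^ 2 * ∑ v : Fin (2 ^ S),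
      (|(driftCoeff (cellArea k) (2 ^ k) i S lo s c v).1| +
        |(driftCoeff (cellArea k) (2 ^ k) i S lo s c v).2|) ^ 2 := by
    rw [Finset.mul_sum]
    refine Finset.sum_le_sum fun v _ => ?_
    rw [mul_pow, ← sq_abs (a v)]
    gcongr
    exact ha v
  have h4 := (cellArea_pos k S).le
  refine (mul_le_mul_of_nonneg_left h3 h4).trans ?_
  rw [mul_left_comm]
  refine (mul_le_mul_of_nonneg_left h2 (sq_nonneg θ)).trans_eq ?_
  ring

/-- The admitted fluctuation is `4 √k` standard deviations, so one cell fails with probability at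
most `2 exp (-4 k)`. The union runs over fewer than `2 * 2 ^ S` nodes. -/
lemma measure_fluctuation_le (hX : IsSubPoissonFamily P X (cellArea k S))
    (hS : 1024 * k * 2 ^ S ≤ ((2 : ℝ) ^ k) ^ 2) :
    P {ω | ¬ ∀ s ≤ S, ∀ c < 2 ^ s, |∑ v ∈ leavesBelow S s c, X v ω - cellArea k s| ≤
      4 * √k * √2 ^ s / 2 ^ k * cellArea k s} ≤
      ENNReal.ofReal (4 * 2 ^ S * Real.exp (-(4 * k))) := by
  have hη : ∀ s ≤ S, 4 * √k * √2 ^ s / 2 ^ k ≤ 1 := by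
    intro s hs
    rw [div_le_one (by positivity)]
    refine le_of_sq_le_sq ?_ (by positivity)
    rw [mul_pow, mul_pow, sqrt_two_pow_sq, Real.sq_sqrt (by positivity)]
    have h2 : (2 : ℝ) ^ s ≤ 2 ^ S := pow_le_pow_right₀ (by norm_num) hs
    have h3 : (k : ℝ) * 2 ^ s ≤ k * 2 ^ S := by gcongr
    have h4 : (0 : ℝ) ≤ k * 2 ^ S := by positivity
    linarith
  have h1 : ∀ s ≤ S, ∀ c < 2 ^ s, P {ω | 4 * √k * √2 ^ s / 2 ^ k * cellArea k s ≤
      |∑ v ∈ leavesBelow S s c, X v ω - cellArea k s|} ≤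
      ENNReal.ofReal (2 * Real.exp (-(4 * k))) := by
    intro s hs c hc
    have h := hX.measure_abs_sum_sub_ge_le (leavesBelow S s c) (η := 4 * √k * √2 ^ s / 2 ^ k)
      (by positivity) (hη s hs)
    have e : ((leavesBelow S s c).card : ℝ) * cellArea k S = cellArea k s := by
      rw [card_leavesBelow hs hc, cellArea, cellArea]
      push_cast
      rw [pow_sub₀ _ two_ne_zero hs]
      field_simp
    rw [e] at h
    refine h.trans_eq ?_
    congr 4
    rw [div_pow, mul_pow, mul_pow, sqrt_two_pow_sq, Real.sq_sqrt (by positivity), cellArea]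
    field_simp
  have h2 : {ω | ¬ ∀ s ≤ S, ∀ c < 2 ^ s, |∑ v ∈ leavesBelow S s c, X v ω - cellArea k s| ≤
      4 * √k * √2 ^ s / 2 ^ k * cellArea k s} ⊆
      ⋃ s ∈ Finset.range (S + 1), ⋃ c ∈ Finset.range (2 ^ s),
        {ω | 4 * √k * √2 ^ s / 2 ^ k * cellArea k s ≤
          |∑ v ∈ leavesBelow S s c, X v ω - cellArea k s|} := by
    intro ω hω
    rw [Set.mem_ofPred_eq] at hω
    push Not at hω
    obtain ⟨s, hs, c, hc, h⟩ := hω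
    simp only [Set.mem_iUnion, Finset.mem_range]
    exact ⟨s, by omega, c, hc, h.le⟩
  refine (measure_mono h2).trans ((measure_biUnion_finset_le _ _).trans ?_)
  calc ∑ s ∈ Finset.range (S + 1), P (⋃ c ∈ Finset.range (2 ^ s),
        {ω | 4 * √k * √2 ^ s / 2 ^ k * cellArea k s ≤
          |∑ v ∈ leavesBelow S s c, X v ω - cellArea k s|})
      ≤ ∑ s ∈ Finset.range (S + 1), ENNReal.ofReal (2 ^ s * (2 * Real.exp (-(4 * k)))) := by
        refine Finset.sum_le_sum fun s hs => (measure_biUnion_finset_le _ _).trans ?_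
        refine (Finset.sum_le_sum fun c hc => h1 s (by simpa [Nat.lt_succ_iff] using hs) c
          (Finset.mem_range.1 hc)).trans_eq ?_
        rw [Finset.sum_const, Finset.card_range, nsmul_eq_mul,
          ENNReal.ofReal_mul (by positivity : (0 : ℝ) ≤ 2 ^ s), ENNReal.ofReal_pow (by norm_num)]
        simp
    _ = ENNReal.ofReal (∑ s ∈ Finset.range (S + 1), 2 ^ s * (2 * Real.exp (-(4 * k)))) := by
        rw [ENNReal.ofReal_sum_of_nonneg fun _ _ => by positivity]
    _ ≤ _ := by
        refine ENNReal.ofReal_le_ofReal ?_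
        rw [← Finset.sum_mul, geom_sum_eq (by norm_num), pow_succ]
        have := Real.exp_pos (-(4 * k : ℝ))
        nlinarith

/-- Exponential Markov inequality with parameter `± 1` and variance bound `12 m`. The factor `8`
counts two directions, two components and two signs; `2 ^ m` counts the nodes. -/
lemma measure_coarse_le (hX : IsSubPoissonFamily P X (cellArea k S))
    (hS : 1024 * 2 ^ S ≤ ((2 : ℝ) ^ k) ^ 2) {m : ℕ} (hm : m ≤ S) :
    P {ω | ¬ ∀ i, ∀ c < 2 ^ m, |(planarDrift k i S 0 m c fun v => X v ω).1| +
      |(planarDrift k i S 0 m c fun v => X v ω).2| ≤ 28 * √k} ≤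
      ENNReal.ofReal (8 * 2 ^ m * Real.exp (12 * m - 14 * √k)) := by
  have hXm := hX.measurable
  have key : ∀ (i : Fin 2), ∀ c < 2 ^ m, ∀ θ : ℝ, |θ| = 1 → ∀ a : Fin (2 ^ S) → ℝ,
      (∀ v, |a v| ≤ |(driftCoeff (cellArea k) (2 ^ k) i S 0 m c v).1| +
        |(driftCoeff (cellArea k) (2 ^ k) i S 0 m c v).2|) →
      P {ω | 14 * √k ≤ θ * ∑ v, a v * (X v ω - cellArea k S)} ≤
        ENNReal.ofReal (Real.exp (12 * m - 14 * √k)) := by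
    intro i c hc θ hθ a ha
    refine (measure_ge_le_of_lintegral_exp_le (by fun_prop)
      (lintegral_exp_linear_le hX hS i (Nat.zero_le m) hm hc ha (by rw [hθ]; norm_num))
      _).trans_eq ?_
    rw [← sq_abs, hθ]
    norm_num
  have h1 : ∀ (i : Fin 2), ∀ c < 2 ^ m, P {ω | 28 * √k <
      |(planarDrift k i S 0 m c fun v => X v ω).1| +
      |(planarDrift k i S 0 m c fun v => X v ω).2|} ≤
      ENNReal.ofReal (4 * Real.exp (12 * m - 14 * √k)) := by
    intro i c hc
    have ha : ∀ v : Fin (2 ^ S), |(driftCoeff (cellArea k) (2 ^ k) i S 0 m c v).1| ≤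
        |(driftCoeff (cellArea k) (2 ^ k) i S 0 m c v).1| +
        |(driftCoeff (cellArea k) (2 ^ k) i S 0 m c v).2| :=
      fun v => le_add_of_nonneg_right (abs_nonneg _)
    have hb : ∀ v : Fin (2 ^ S), |(driftCoeff (cellArea k) (2 ^ k) i S 0 m c v).2| ≤
        |(driftCoeff (cellArea k) (2 ^ k) i S 0 m c v).1| +
        |(driftCoeff (cellArea k) (2 ^ k) i S 0 m c v).2| :=
      fun v => le_add_of_nonneg_left (abs_nonneg _)
    have a1 := key i c hc 1 (by simp) _ ha
    have a2 := key i c hc (-1) (by simp) _ ha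
    have b1 := key i c hc 1 (by simp) _ hb
    have b2 := key i c hc (-1) (by simp) _ hb
    simp_rw [← planarDrift_fst k i S 0 m c (fun v => X v _)] at a1 a2
    simp_rw [← planarDrift_snd k i S 0 m c (fun v => X v _)] at b1 b2
    have h4 : ENNReal.ofReal (4 * Real.exp (12 * m - 14 * √k)) =
        (ENNReal.ofReal (Real.exp (12 * m - 14 * √k)) +
          ENNReal.ofReal (Real.exp (12 * m - 14 * √k))) +
        (ENNReal.ofReal (Real.exp (12 * m - 14 * √k)) +
          ENNReal.ofReal (Real.exp (12 * m - 14 * √k))) := by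
      rw [← ENNReal.ofReal_add (by positivity) (by positivity),
        ← ENNReal.ofReal_add (by positivity) (by positivity)]
      congr 1; ring
    rw [h4]
    refine le_trans (measure_mono ?_) ((measure_union_le _ _).trans (add_le_add
      ((measure_union_le _ _).trans (add_le_add a1 a2))
      ((measure_union_le _ _).trans (add_le_add b1 b2))))
    intro ω hω
    simp only [Set.mem_union, Set.mem_ofPred_eq] at hω ⊢
    by_contra hcon
    push Not at hcon
    obtain ⟨⟨c1, c2⟩, c3, c4⟩ := hcon
    have d1 : |(planarDrift k i S 0 m c fun v => X v ω).1| < 14 * √k :=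
      abs_lt.2 ⟨by linarith, by linarith⟩
    have d2 : |(planarDrift k i S 0 m c fun v => X v ω).2| < 14 * √k :=
      abs_lt.2 ⟨by linarith, by linarith⟩
    linarith
  have h2 : {ω | ¬ ∀ i, ∀ c < 2 ^ m, |(planarDrift k i S 0 m c fun v => X v ω).1| +
      |(planarDrift k i S 0 m c fun v => X v ω).2| ≤ 28 * √k} ⊆
      ⋃ i ∈ (Finset.univ : Finset (Fin 2)), ⋃ c ∈ Finset.range (2 ^ m), {ω | 28 * √k <
      |(planarDrift k i S 0 m c fun v => X v ω).1| +
      |(planarDrift k i S 0 m c fun v => X v ω).2|} := by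
    intro ω hω
    rw [Set.mem_ofPred_eq] at hω
    push Not at hω
    obtain ⟨i, c, hc, h⟩ := hω
    simp only [Set.mem_iUnion, Finset.mem_range]
    exact ⟨i, Finset.mem_univ i, c, hc, h⟩
  refine (measure_mono h2).trans ((measure_biUnion_finset_le _ _).trans ?_)
  calc _ ≤ ∑ i : Fin 2, ∑ c ∈ Finset.range (2 ^ m),
        ENNReal.ofReal (4 * Real.exp (12 * m - 14 * √k)) := by
        refine Finset.sum_le_sum fun i _ => (measure_biUnion_finset_le _ _).trans ?_
        exact Finset.sum_le_sum fun c hc => h1 i c (Finset.mem_range.1 hc)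
    _ = ENNReal.ofReal (∑ i : Fin 2, ∑ c ∈ Finset.range (2 ^ m),
        4 * Real.exp (12 * m - 14 * √k)) := by
        rw [ENNReal.ofReal_sum_of_nonneg fun _ _ => by positivity]
        simp_rw [ENNReal.ofReal_sum_of_nonneg fun _ _ =>
          (by positivity : 0 ≤ 4 * Real.exp (12 * (m : ℝ) - 14 * √k))]
    _ = _ := by
        congr 1
        simp
        ring

lemma lintegral_ofReal_sum_le {ι : Type*} (t : Finset ι) {f : ι → Ω → ℝ}
    (hf : ∀ j ∈ t, Measurable (f j)) (hf0 : ∀ j ∈ t, ∀ ω, 0 ≤ f j ω) {b : ℝ}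
    (h : ∀ j ∈ t, ∫⁻ ω, ENNReal.ofReal (f j ω) ∂P ≤ ENNReal.ofReal b) :
    ∫⁻ ω, ENNReal.ofReal (∑ j ∈ t, f j ω) ∂P ≤ ENNReal.ofReal (t.card * b) := by
  have e : ∀ ω, ENNReal.ofReal (∑ j ∈ t, f j ω) = ∑ j ∈ t, ENNReal.ofReal (f j ω) := fun ω =>
    ENNReal.ofReal_sum_of_nonneg fun j hj => hf0 j hj ω
  simp_rw [e]
  rw [lintegral_finsetSum _ fun j hj => (hf j hj).ennreal_ofReal]
  refine (Finset.sum_le_sum h).trans_eq ?_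
  rw [Finset.sum_const, nsmul_eq_mul, ENNReal.ofReal_mul (by positivity), ENNReal.ofReal_natCast]

/-- The exponential functional of the displacement caused by the fine scales. -/
noncomputable def fineWeight (k S m : ℕ) (θ : ℝ) (w : ℕ) (x : Fin (2 ^ S) → ℝ) : ℝ :=
  ∑ i, (Real.exp (θ * (planarDrift k i S m S w x).1) +
    Real.exp (-θ * (planarDrift k i S m S w x).1))

lemma fineWeight_nonneg (k S m : ℕ) (θ : ℝ) (w : ℕ) (x : Fin (2 ^ S) → ℝ) :
    0 ≤ fineWeight k S m θ w x := by
  unfold fineWeight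
  positivity

lemma measurable_fineWeight (hX : IsSubPoissonFamily P X (cellArea k S)) (m : ℕ) (θ : ℝ) (w : ℕ) :
    Measurable fun ω => fineWeight k S m θ w fun v => X v ω := by
  have := hX.measurable
  simp only [fineWeight, planarDrift_fst]
  fun_prop

/-- Cauchy–Schwarz on the four exponentials reduces second moments to first moments at the doubled
parameter. -/
lemma sq_fineWeight_le (k S m : ℕ) (θ : ℝ) (w : ℕ) (x : Fin (2 ^ S) → ℝ) :
    fineWeight k S m θ w x ^ 2 ≤ 4 * fineWeight k S m (2 * θ) w x := by
  have e : ∀ t : ℝ, Real.exp (2 * θ * t) = Real.exp (θ * t) ^ 2 := fun t => by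
    rw [← Real.exp_nat_mul]; congr 1; push_cast; ring
  have e' : ∀ t : ℝ, Real.exp (-(2 * θ) * t) = Real.exp (-θ * t) ^ 2 := fun t => by
    rw [← Real.exp_nat_mul]; congr 1; push_cast; ring
  simp only [fineWeight, Fin.sum_univ_two, e, e']
  generalize Real.exp (θ * (planarDrift k 0 S m S w x).1) = a
  generalize Real.exp (-θ * (planarDrift k 0 S m S w x).1) = b
  generalize Real.exp (θ * (planarDrift k 1 S m S w x).1) = a'
  generalize Real.exp (-θ * (planarDrift k 1 S m S w x).1) = b'
  nlinarith [sq_nonneg (a - b), sq_nonneg (a - a'), sq_nonneg (a - b'), sq_nonneg (b - a'),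
    sq_nonneg (b - b'), sq_nonneg (a' - b')]

lemma lintegral_fineWeight_le (hX : IsSubPoissonFamily P X (cellArea k S))
    (hS : 1024 * 2 ^ S ≤ ((2 : ℝ) ^ k) ^ 2) {m : ℕ} (hm : m ≤ S) {θ : ℝ} (hθ : |θ| ≤ 8)
    {w : ℕ} (hw : w < 2 ^ S) {B : ℝ} (hB : 12 * θ ^ 2 * S ≤ B) :
    ∫⁻ ω, ENNReal.ofReal (fineWeight k S m θ w fun v => X v ω) ∂P ≤
      ENNReal.ofReal (4 * Real.exp B) := by
  have hXm := hX.measurable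
  have h1 : ∀ i : Fin 2, ∀ θ' : ℝ, |θ'| = |θ| →
      ∫⁻ ω, ENNReal.ofReal (Real.exp (θ' * (planarDrift k i S m S w fun v => X v ω).1)) ∂P ≤
      ENNReal.ofReal (Real.exp B) := by
    intro i θ' hθ'
    simp_rw [planarDrift_fst]
    refine (lintegral_exp_linear_le hX hS i hm le_rfl hw
      (fun v => le_add_of_nonneg_right (abs_nonneg _)) (hθ'.trans_le hθ)).trans
      (ENNReal.ofReal_le_ofReal (Real.exp_le_exp.2 (le_trans ?_ hB)))
    rw [← sq_abs θ', hθ', sq_abs]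
    gcongr
    have : (0 : ℝ) ≤ m := by positivity
    linarith
  have hmeas : ∀ i : Fin 2, Measurable fun ω => (planarDrift k i S m S w fun v => X v ω).1 := by
    intro i
    simp only [planarDrift_fst]
    fun_prop
  have h2 : ∀ i ∈ (Finset.univ : Finset (Fin 2)), ∫⁻ ω, ENNReal.ofReal
      (Real.exp (θ * (planarDrift k i S m S w fun v => X v ω).1) +
        Real.exp (-θ * (planarDrift k i S m S w fun v => X v ω).1)) ∂P ≤
      ENNReal.ofReal (2 * Real.exp B) := by
    intro i _
    have := hmeas i
    simp_rw [ENNReal.ofReal_add (Real.exp_pos _).le (Real.exp_pos _).le]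
    rw [lintegral_add_left (by fun_prop), two_mul,
      ENNReal.ofReal_add (Real.exp_pos _).le (Real.exp_pos _).le]
    exact add_le_add (h1 i θ rfl) (h1 i (-θ) (abs_neg θ))
  refine (lintegral_ofReal_sum_le Finset.univ (fun i _ => ?_) (fun i _ ω => by positivity)
    h2).trans_eq ?_
  · have := hmeas i
    fun_prop
  · congr 1
    simp
    ring

/-- The average of `fineWeight` over the leaves below the node `(m, c)`. -/
noncomputable def blockWeight (k S m : ℕ) (θ : ℝ) (c : ℕ) (x : Fin (2 ^ S) → ℝ) : ℝ :=
  (∑ w ∈ leavesBelow S m c, fineWeight k S m θ w x) / 2 ^ (S - m)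

lemma sum_blockWeight (k : ℕ) {S m : ℕ} (hm : m ≤ S) (θ : ℝ) (x : Fin (2 ^ S) → ℝ) :
    ∑ c ∈ Finset.range (2 ^ m), blockWeight k S m θ c x =
      (∑ w ∈ Finset.range (2 ^ S), fineWeight k S m θ w x) / 2 ^ (S - m) := by
  simp only [blockWeight]
  rw [← Finset.sum_div, ← Fin.sum_univ_eq_sum_range (fun w => fineWeight k S m θ w x) (2 ^ S)]
  congr 1
  refine Finset.sum_fiberwise_of_maps_to (g := fun w : Fin (2 ^ S) => (w : ℕ) / 2 ^ (S - m))
    (fun w _ => ?_) _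
  rw [Finset.mem_range, Nat.div_lt_iff_lt_mul (by positivity), ← pow_add]
  rw [show m + (S - m) = S by omega]
  exact w.2

/-- The cuts of depth at least `m` below a node of depth `m` depend only on the leaves below that
node. -/
lemma indepFun_blockWeight (hX : IsSubPoissonFamily P X (cellArea k S)) (m : ℕ) (θ : ℝ)
    {c c' : ℕ} (hc : c ≠ c') :
    IndepFun (fun ω => blockWeight k S m θ c fun v => X v ω)
      (fun ω => blockWeight k S m θ c' fun v => X v ω) P := by
  let F : (c : ℕ) → (leavesBelow S m c → ℝ) → ℝ := fun c y =>
    (∑ w ∈ leavesBelow S m c, ∑ i : Fin 2,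
      (Real.exp (θ * ∑ v : leavesBelow S m c,
        (driftCoeff (cellArea k) (2 ^ k) i S m S w v).1 * (y v - cellArea k S)) +
      Real.exp (-θ * ∑ v : leavesBelow S m c,
        (driftCoeff (cellArea k) (2 ^ k) i S m S w v).1 * (y v - cellArea k S)))) / 2 ^ (S - m)
  have hF : ∀ c, Measurable (F c) := fun c => by fun_prop
  have e : ∀ c, (fun ω => blockWeight k S m θ c fun v => X v ω) =
      fun ω => F c fun v => X v ω := by
    intro c
    funext ω
    simp only [blockWeight, F, fineWeight]
    congr 1
    refine Finset.sum_congr rfl fun w hw => Finset.sum_congr rfl fun i _ => ?_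
    rw [planarDrift_fst]
    have : ∑ v : Fin (2 ^ S), (driftCoeff (cellArea k) (2 ^ k) i S m S w v).1 *
        (X v ω - cellArea k S) = ∑ v : leavesBelow S m c,
        (driftCoeff (cellArea k) (2 ^ k) i S m S w v).1 * (X v ω - cellArea k S) := by
      rw [Finset.sum_coe_sort (leavesBelow S m c) (fun v => (driftCoeff (cellArea k) (2 ^ k) i S m
        S w v).1 * (X v ω - cellArea k S))]
      refine (Finset.sum_subset (Finset.subset_univ _) fun v _ hv => ?_).symm
      rw [mem_leavesBelow] at hv hw
      rw [driftCoeff_eq_zero (cellArea_pos k) (by positivity) i le_rfl (by rwa [hw])]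
      simp
    rw [this]
  rw [e, e]
  exact hX.indepFun_of_disjoint (disjoint_leavesBelow hc) (hF c) (hF c')

/-- The spatial average of the exponential weight is an average of `2 ^ m` independent block
averages with bounded first and second moments, so Chebyshev's inequality gives a failure
probability of order `2 ^ (-m)`. -/
lemma measure_fine_le [IsProbabilityMeasure P] (hX : IsSubPoissonFamily P X (cellArea k S))
    (hk : 1 ≤ k) (hS : 1024 * 2 ^ S ≤ ((2 : ℝ) ^ k) ^ 2) (hSk : S ≤ 2 * k) {m : ℕ} (hm : m ≤ S) :
    P {ω | ¬ ∑ w ∈ Finset.range (2 ^ S), fineWeight k S m (2 / √k) w (fun v => X v ω) ≤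
      (4 * Real.exp 96 + 1) * 2 ^ S} ≤ ENNReal.ofReal (16 * Real.exp 384 / 2 ^ m) := by
  have hk' : (1 : ℝ) ≤ k := by exact_mod_cast hk
  have hsk : 1 ≤ √(k : ℝ) := Real.one_le_sqrt.2 hk'
  have hSk' : (S : ℝ) ≤ 2 * k := by exact_mod_cast hSk
  have hθ2 : (2 / √(k : ℝ)) ^ 2 = 4 / k := by
    rw [div_pow, Real.sq_sqrt (by positivity)]; norm_num
  have hθ0 : 0 < 2 / √(k : ℝ) := by positivity
  have hθ1 : 2 / √(k : ℝ) ≤ 2 := div_le_self (by norm_num) hsk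
  set θ := 2 / √(k : ℝ) with hθ
  have hθb : |θ| ≤ 8 := by rw [abs_of_pos hθ0]; linarith
  have hθb' : |2 * θ| ≤ 8 := by rw [abs_of_pos (by linarith)]; linarith
  -- The variance is at most of order `S ≤ 2 k` while `θ ^ 2 = 4 / k`, so the exponential moments
  -- are bounded uniformly in `k`; this gives `96`, and `384` for `2 θ`.
  have hB : 12 * θ ^ 2 * S ≤ 96 := by
    rw [hθ2, mul_div_assoc', div_mul_eq_mul_div, div_le_iff₀ (by positivity)]
    nlinarith
  have hB' : 12 * (2 * θ) ^ 2 * S ≤ 384 := by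
    rw [mul_pow]; linarith
  have hmW := measurable_fineWeight hX m
  have hmY : ∀ c, Measurable fun ω => blockWeight k S m θ c fun v => X v ω := by
    intro c
    have := hmW θ
    unfold blockWeight
    fun_prop
  have h2 : (0 : ℝ) < 2 ^ (S - m) := by positivity
  have hcard : ∀ c < 2 ^ m, ((leavesBelow S m c).card : ℝ) = 2 ^ (S - m) := fun c hc => by
    rw [card_leavesBelow hm hc]; push_cast; rfl
  have hch := measure_sum_ge_le_of_pairwise_indepFun (P := P) (M := 2 ^ m) (by positivity) hmY
    (fun c ω => div_nonneg (Finset.sum_nonneg fun w _ => fineWeight_nonneg _ _ _ _ _ _) h2.le)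
    (e := 4 * Real.exp 96) (V := 16 * Real.exp 384) (δ := 1) (by positivity) (by positivity)
    one_pos ?_ ?_ fun c _ c' _ hcc => indepFun_blockWeight hX m θ hcc
  · refine le_trans (measure_mono ?_) (hch.trans_eq ?_)
    · intro ω hω
      rw [Set.mem_ofPred_eq] at hω ⊢
      rw [sum_blockWeight k hm, le_div_iff₀ h2]
      push Not at hω
      refine le_trans (le_of_eq ?_) hω.le
      push_cast
      rw [mul_right_comm, ← pow_add, show m + (S - m) = S by omega]
      ring
    · congr 1
      push_cast
      ring
  · intro c hc
    have h1 := lintegral_ofReal_sum_le (P := P) (leavesBelow S m c) (fun w _ => hmW θ w)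
      (fun w _ ω => fineWeight_nonneg _ _ _ _ _ _)
      (fun w _ => lintegral_fineWeight_le hX hS hm hθb w.2 hB)
    simp only [blockWeight, div_eq_inv_mul]
    simp_rw [ENNReal.ofReal_mul (inv_nonneg.2 h2.le)]
    rw [lintegral_const_mul' _ _ ENNReal.ofReal_ne_top]
    refine (mul_le_mul_right h1 _).trans_eq ?_
    rw [hcard c hc, ← ENNReal.ofReal_mul (by positivity), inv_mul_cancel_left₀ h2.ne']
  · intro c hc
    have h1 := lintegral_ofReal_sum_le (P := P) (leavesBelow S m c) (fun w _ => hmW (2 * θ) w)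
      (fun w _ ω => fineWeight_nonneg _ _ _ _ _ _)
      (fun w _ => lintegral_fineWeight_le hX hS hm hθb' w.2 hB')
    have hle : ∀ ω, ENNReal.ofReal ((blockWeight k S m θ c fun v => X v ω) ^ 2) ≤
        ENNReal.ofReal (4 / 2 ^ (S - m)) * ENNReal.ofReal
          (∑ w ∈ leavesBelow S m c, fineWeight k S m (2 * θ) w fun v => X v ω) := by
      intro ω
      rw [← ENNReal.ofReal_mul (by positivity)]
      refine ENNReal.ofReal_le_ofReal ?_
      rw [blockWeight, div_pow, div_mul_eq_mul_div, div_le_div_iff₀ (by positivity) h2]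
      have h3 := sq_sum_le_card_mul_sum_sq (s := leavesBelow S m c)
        (f := fun w : Fin (2 ^ S) => fineWeight k S m θ w fun v => X v ω)
      rw [hcard c hc] at h3
      have h4 : ∑ w ∈ leavesBelow S m c, (fineWeight k S m θ w fun v => X v ω) ^ 2 ≤
          4 * ∑ w ∈ leavesBelow S m c, fineWeight k S m (2 * θ) w fun v => X v ω := by
        rw [Finset.mul_sum]
        exact Finset.sum_le_sum fun w _ => sq_fineWeight_le _ _ _ _ _ _
      calc _ ≤ (2 ^ (S - m) * (4 * ∑ w ∈ leavesBelow S m c,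
            fineWeight k S m (2 * θ) w fun v => X v ω)) * 2 ^ (S - m) := by
            refine mul_le_mul_of_nonneg_right (h3.trans ?_) h2.le
            exact mul_le_mul_of_nonneg_left h4 h2.le
        _ = _ := by ring
    refine (lintegral_mono hle).trans ?_
    rw [lintegral_const_mul' _ _ ENNReal.ofReal_ne_top]
    refine (mul_le_mul_right h1 _).trans_eq ?_
    rw [hcard c hc, ← ENNReal.ofReal_mul (by positivity)]
    congr 1
    field_simp
    ring

/-- In dimension two, the good event has overwhelming probability. -/
theorem measure_not_planarGood_le [IsProbabilityMeasure P]
    (hX : IsSubPoissonFamily P X (cellArea k S)) (hk : 1 ≤ k)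
    (hS : 1024 * k * 2 ^ S ≤ ((2 : ℝ) ^ k) ^ 2) (hSk : S ≤ 2 * k) {m : ℕ} (hm : m ≤ S) :
    P {ω | ¬ PlanarGood k S m fun v => X v ω} ≤
      ENNReal.ofReal (4 * 2 ^ S * Real.exp (-(4 * k)) +
        8 * 2 ^ m * Real.exp (12 * m - 14 * √k) + 16 * Real.exp 384 / 2 ^ m) := by
  have hk' : (1 : ℝ) ≤ k := by exact_mod_cast hk
  have hS' : 1024 * 2 ^ S ≤ ((2 : ℝ) ^ k) ^ 2 := by
    refine le_trans ?_ hS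
    gcongr
    linarith
  rw [ENNReal.ofReal_add (by positivity) (by positivity),
    ENNReal.ofReal_add (by positivity) (by positivity)]
  refine le_trans (measure_mono ?_) ((measure_union_le _ _).trans (add_le_add
    ((measure_union_le _ _).trans (add_le_add (measure_fluctuation_le hX hS)
    (measure_coarse_le hX hS' hm))) (measure_fine_le hX hk hS' hSk hm)))
  intro ω hω
  simp only [Set.mem_union, Set.mem_ofPred_eq] at hω ⊢
  by_contra hcon
  push Not at hcon
  exact hω ⟨hcon.1.1, hcon.1.2, hcon.2⟩

end Probability

/-! ### Dimension two: transport cost on the good event -/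

/-- Lets the single exponential moment in the good event control all powers `p` at once. -/
lemma rpow_le_factorial_mul_exp {y p : ℝ} (hy : 1 ≤ y) :
    y ^ p ≤ (⌈p⌉₊.factorial : ℝ) * Real.exp y := by
  calc y ^ p ≤ y ^ (⌈p⌉₊ : ℝ) := Real.rpow_le_rpow_of_exponent_le hy (Nat.le_ceil p)
    _ = y ^ ⌈p⌉₊ := Real.rpow_natCast _ _
    _ ≤ _ := by
      have h := Real.pow_div_factorial_le_exp y (by linarith) ⌈p⌉₊
      rw [div_le_iff₀ (by positivity)] at h
      linarith

section Planar

variable {k S m : ℕ} {N : ℕ → ℕ → ℝ}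

lemma sqrt_mul_sqrt_two_pow_le (hS : 1024 * k * 2 ^ S ≤ ((2 : ℝ) ^ k) ^ 2) :
    √k * √2 ^ S ≤ 2 ^ k / 32 := by
  refine le_of_sq_le_sq ?_ (by positivity)
  rw [mul_pow, sqrt_two_pow_sq, Real.sq_sqrt (by positivity), div_pow]
  linarith

lemma PlanarGood.pathGood (hN : IsTreeMass N) (h : PlanarGood k S m fun v => N S v) {w : ℕ}
    (hw : w < 2 ^ S) : PathGood N (cellArea k) (fun s => 4 * √k * √2 ^ s / 2 ^ k) S w := by
  intro j hj
  have hc : w / 2 ^ (S - j) < 2 ^ j := by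
    rw [Nat.div_lt_iff_lt_mul (by positivity), ← pow_add]
    rwa [show j + (S - j) = S by omega]
  have := h.fluctuation j hj _ hc
  rwa [sum_leavesBelow hN.add hj hc] at this

/-- On the good event the displacements are, up to an error of order `√k`, the linearized
displacements caused by the fine scales. -/
lemma PlanarGood.abs_drift_le (hN : IsTreeMass N) (h : PlanarGood k S m fun v => N S v)
    (hS : 1024 * k * 2 ^ S ≤ ((2 : ℝ) ^ k) ^ 2) (hm : m ≤ S) (i : Fin 2) {w : ℕ}
    (hw : w < 2 ^ S) :
    |(drift i (cutShift N (2 ^ k) i) S w).1| + |(drift i (cutShift N (2 ^ k) i) S w).2| ≤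
      |(planarDrift k i S m S w fun v => N S v).1| + 188 * √k := by
  have hsq := sqrt_two_bounds
  have hkey := sqrt_mul_sqrt_two_pow_le hS
  have h1s : (1 : ℝ) ≤ √2 := by linarith
  set η : ℕ → ℝ := fun s => 4 * √k * √2 ^ s / 2 ^ k with hηdef
  have hpath := h.pathGood hN hw
  have hη : ∀ s < S, η s ≤ η (s + 1) := by
    intro s _
    simp only [hηdef]
    gcongr
    omega
  have hη8 : ∀ s ≤ S, η s ≤ 1 / 8 := by
    intro s hs
    have : √2 ^ s ≤ √2 ^ S := pow_le_pow_right₀ h1s hs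
    simp only [hηdef]
    rw [div_le_iff₀ (by positivity)]
    have : √k * √2 ^ s ≤ √k * √2 ^ S := by gcongr
    linarith
  -- In dimension two, side times admitted relative fluctuation is of order `√k` at every depth.
  have hβ : ∀ s < S, dyadicSide 2 (2 ^ k) i s * η (s + 1) ≤ 8 * √k := by
    intro s _
    refine (mul_le_mul_of_nonneg_right (dyadicSide_two_le k i s) (by positivity)).trans_eq ?_
    simp only [hηdef]
    rw [pow_succ]
    field_simp
    rw [Real.sq_sqrt (by norm_num)]
    ring
  -- The relative fluctuations grow geometrically with depth, and at the leaves they are small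
  -- because the leaf area is at least `1024 k`. The linearization error is therefore `24 * (8 √k) *
  -- (1 / 2) = 96 √k`.
  have hsum : ∑ j ∈ Finset.range S, η (j + 1) ≤ 1 / 2 := by
    have h1 := sum_sqrt_two_pow_le (fun _ => True) S
    simp only [if_true] at h1
    calc ∑ j ∈ Finset.range S, η (j + 1) = 4 * √k * √2 / 2 ^ k *
          ∑ j ∈ Finset.range S, √2 ^ j := by
          rw [Finset.mul_sum]
          refine Finset.sum_congr rfl fun j _ => ?_
          simp only [hηdef, pow_succ]
          ring
      _ ≤ 4 * √k * √2 / 2 ^ k * (2.5 * √2 ^ S) := by gcongr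
      _ = 10 * √2 / 2 ^ k * (√k * √2 ^ S) := by ring
      _ ≤ 10 * √2 / 2 ^ k * (2 ^ k / 32) := by gcongr
      _ = 10 * √2 / 32 := by field_simp
      _ ≤ 1 / 2 := by linarith
  have hk0 := Real.sqrt_nonneg (k : ℝ)
  have hsnd := abs_drift_snd_le hN (by positivity) (cellArea_succ k) (cellArea_pos k) hη hη8
    (by positivity) hβ le_rfl hpath
  have hfst := abs_drift_sub_drift_le_sum hN (by positivity) (cellArea_succ k) (cellArea_pos k)
    hη hη8 (by positivity) hβ le_rfl hpath
  have hfst' : |(drift i (cutShift N (2 ^ k) i) S w).1 -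
      (drift i (linCutShift N (cellArea k) (2 ^ k) i) S w).1| ≤ 96 * √k := by
    refine hfst.trans ?_
    nlinarith
  set G := linCutShift N (cellArea k) (2 ^ k) i with hG
  have hfine : drift i (fromDepth m G) S w = planarDrift k i S m S w fun v => N S v :=
    drift_fromDepth_eq_sum hN.add _ _ i S m le_rfl hw _
  have hc : w / 2 ^ (S - m) < 2 ^ m := by
    rw [Nat.div_lt_iff_lt_mul (by positivity), ← pow_add]
    rwa [show m + (S - m) = S by omega]
  have hcoarse := h.coarse i _ hc
  rw [planarDrift, ← drift_fromDepth_eq_sum hN.add (cellArea k) (2 ^ k) i S 0 hm hc] at hcoarse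
  -- Removing the fine cuts leaves the full linearized displacement at depth `m`, controlled by
  -- `hcoarse`; below depth `m` this part no longer grows.
  have h0 : drift i (fun s c => G s c - fromDepth m G s c) m (w / 2 ^ (S - m)) =
      drift i (fromDepth 0 G) m (w / 2 ^ (S - m)) :=
    drift_congr i m _ fun j hj => by simp [fromDepth, Nat.not_le.2 hj]
  have hle := drift_le_of_eq_zero i (fun s c => G s c - fromDepth m G s c) m (S - m) w
    fun s hs c => by simp [fromDepth, hs]
  rw [show m + (S - m) = S by omega, h0, drift_sub, Prod.fst_sub, hfine] at hle
  have hle' := (le_add_of_nonneg_right (abs_nonneg _)).trans (hle.trans hcoarse)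
  have t1 := abs_sub_abs_le_abs_sub (drift i (cutShift N (2 ^ k) i) S w).1 (drift i G S w).1
  have t2 := abs_sub_abs_le_abs_sub (drift i G S w).1 (planarDrift k i S m S w fun v => N S v).1
  -- `188 = 96 + 28 + 64`: linearization error, coarse scales, and side error `8 * (8 √k)`.
  linarith

/-- On the good event the transportation cost is of the optimal order. -/
theorem PlanarGood.torusWasserstein_le {μ : Measure (EuclideanSpace ℝ (Fin 2))}
    (hμ : μ (torusBox 2 (2 ^ k)) ≠ ∞) (hk : 1 ≤ k)
    (h : PlanarGood k S m fun v => cellCount (2 ^ k) μ S v)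
    (hS : 1024 * k * 2 ^ S ≤ ((2 : ℝ) ^ k) ^ 2) (hS' : ((2 : ℝ) ^ k) ^ 2 ≤ 2048 * k * 2 ^ S)
    (hm : m ≤ S) {p : ℝ} (hp : 1 ≤ p) :
    torusWasserstein (2 ^ k) p μ (numberDensity (2 ^ k) μ • volume) ^ p ≤
      ENNReal.ofReal (⌈p⌉₊.factorial * Real.exp 632 * (4 * Real.exp 96 + 1) * (2 ^ k) ^ 2 *
        √k ^ p) := by
  have hR : (0 : ℝ) < 2 ^ k := by positivity
  have hk' : (1 : ℝ) ≤ k := by exact_mod_cast hk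
  have hsk : 0 < √(k : ℝ) := by positivity
  have hN := isTreeMass_cellCount hR.le hμ
  set N := cellCount (2 ^ k) μ with hNdef
  set U : Fin 2 → ℕ → ℝ := fun i w => (planarDrift k i S m S w fun v => N S v).1 with hU
  have hLS : ∀ i : Fin 2, dyadicSide 2 (2 ^ k) i S ≤ 64 * √k := by
    intro i
    refine (dyadicSide_two_le k i S).trans ?_
    rw [div_le_iff₀ (by positivity)]
    refine le_of_sq_le_sq ?_ (by positivity)
    rw [mul_pow, mul_pow, mul_pow, sqrt_two_pow_sq, Real.sq_sqrt (by norm_num),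
      Real.sq_sqrt (by positivity)]
    linarith
  -- `316 = 188 + 2 * 64`, the last term being twice the side of a leaf; the sum over both
  -- directions gives `632`.
  refine (torusWasserstein_rpow_le_sum hR hμ S hp
    (fun w => ∑ i, (|U i w| + 316 * √k)) (fun w => by positivity) ?_).trans ?_
  · intro w hw x hx y hy
    refine dist_le_of_drift_le (fun i => ?_) hx hy
    have h1 := h.abs_drift_le hN hS hm i hw
    have h2 := hLS i
    simp only [hU]
    linarith
  refine ENNReal.ofReal_le_ofReal ?_
  have hNw : ∀ w < 2 ^ S, N S w ≤ 2 * cellArea k S := by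
    intro w hw
    have h1 := h.pathGood hN hw S le_rfl
    simp only [Nat.sub_self, pow_zero, Nat.div_one] at h1
    have h2 := (abs_le.1 h1).2
    have h3 : 4 * √k * √2 ^ S / 2 ^ k ≤ 1 := by
      have := sqrt_mul_sqrt_two_pow_le hS
      rw [div_le_one hR]
      linarith
    have h4 := cellArea_pos k S
    nlinarith
  have hδ : ∀ w, (∑ i, (|U i w| + 316 * √k)) ^ p ≤ √k ^ p * (⌈p⌉₊.factorial * Real.exp 632 *
      ((∑ i, (Real.exp (2 / √k * U i w) + Real.exp (-(2 / √k) * U i w))) / 2)) := by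
    intro w
    have e : ∑ i, (|U i w| + 316 * √k) = √k * ((|U 0 w| + |U 1 w|) / √k + 632) := by
      rw [Fin.sum_univ_two]
      field_simp
      ring
    rw [e, Real.mul_rpow hsk.le (by positivity)]
    refine mul_le_mul_of_nonneg_left ?_ (by positivity)
    have h1 : 1 ≤ (|U 0 w| + |U 1 w|) / √k + 632 := by
      have : 0 ≤ (|U 0 w| + |U 1 w|) / √k := by positivity
      linarith
    refine (rpow_le_factorial_mul_exp h1).trans ?_
    rw [mul_assoc]
    refine mul_le_mul_of_nonneg_left ?_ (by positivity)
    rw [Real.exp_add, mul_comm (Real.exp _)]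
    refine mul_le_mul_of_nonneg_left ?_ (by positivity)
    -- The product of the exponentials for the two directions is at most half the sum of their
    -- squares, hence the parameter `2 / √k` in the good event.
    have h2 : ∀ i, Real.exp (|U i w| / √k) ^ 2 ≤
        Real.exp (2 / √k * U i w) + Real.exp (-(2 / √k) * U i w) := by
      intro i
      rw [← Real.exp_nat_mul]
      rcases abs_cases (U i w) with ⟨ha, _⟩ | ⟨ha, _⟩
      · rw [ha, show ((2 : ℕ) : ℝ) * (U i w / √k) = 2 / √k * U i w by push_cast; ring]
        linarith [Real.exp_pos (-(2 / √k) * U i w)]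
      · rw [ha, show ((2 : ℕ) : ℝ) * (-U i w / √k) = -(2 / √k) * U i w by push_cast; ring]
        linarith [Real.exp_pos (2 / √k * U i w)]
    rw [Fin.sum_univ_two, add_div, Real.exp_add]
    have := h2 0
    have := h2 1
    nlinarith [sq_nonneg (Real.exp (|U 0 w| / √k) - Real.exp (|U 1 w| / √k))]
  have hfine := h.fine
  have hcA : cellArea k S * 2 ^ S = (2 ^ k) ^ 2 := by
    rw [cellArea]; field_simp
  set W : ℕ → ℝ := fun w => ∑ i, (Real.exp (2 / √k * U i w) + Real.exp (-(2 / √k) * U i w))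
  set K : ℝ := √k ^ p * (⌈p⌉₊.factorial * Real.exp 632)
  have hA := cellArea_pos k S
  calc ∑ w ∈ Finset.range (2 ^ S), N S w * (∑ i, (|U i w| + 316 * √k)) ^ p
      ≤ ∑ w ∈ Finset.range (2 ^ S), 2 * cellArea k S * (K * (W w / 2)) := by
        refine Finset.sum_le_sum fun w hw => ?_
        refine mul_le_mul (hNw w (Finset.mem_range.1 hw)) ((hδ w).trans_eq ?_) (by positivity)
          (by positivity)
        ring
    _ = cellArea k S * K * ∑ w ∈ Finset.range (2 ^ S), W w := by
        rw [Finset.mul_sum]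
        exact Finset.sum_congr rfl fun w _ => by ring
    _ ≤ cellArea k S * K * ((4 * Real.exp 96 + 1) * 2 ^ S) := by gcongr
    _ = (cellArea k S * 2 ^ S) * K * (4 * Real.exp 96 + 1) := by ring
    _ = _ := by rw [hcA]; ring

end Planar

/-! ### Dimension at least three: scales and probability of the good event -/

/-- The twelfth root of two: the scales of the hierarchy and the admissible relative fluctuations
in dimension at least three are integer powers of it. -/
noncomputable def twelfthRootTwo : ℝ := (2 : ℝ) ^ ((1 : ℝ) / 12)

local notation "ϱ" => twelfthRootTwo

lemma twelfthRootTwo_pow : ϱ ^ 12 = 2 := by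
  rw [twelfthRootTwo, ← Real.rpow_natCast, ← Real.rpow_mul (by norm_num)]
  norm_num

lemma one_lt_twelfthRootTwo : 1 < ϱ := Real.one_lt_rpow (by norm_num) (by norm_num)

lemma twelfthRootTwo_pos : 0 < ϱ := by linarith [one_lt_twelfthRootTwo]

lemma twelfthRootTwo_pow_le_two {n : ℕ} (hn : n ≤ 12) : ϱ ^ n ≤ 2 := by
  rw [← twelfthRootTwo_pow]
  exact pow_le_pow_right₀ one_lt_twelfthRootTwo.le hn

lemma two_pow_eq (t : ℕ) : (2 : ℝ) ^ t = ϱ ^ (12 * t) := by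
  rw [pow_mul, twelfthRootTwo_pow]

/-- The volume of the cells of depth `s` of a box of volume `2 ^ D`. -/
noncomputable def cellVol (D s : ℕ) : ℝ := 2 ^ D / 2 ^ s

lemma cellVol_pos (D s : ℕ) : 0 < cellVol D s := by rw [cellVol]; positivity

lemma cellVol_succ (D s : ℕ) : cellVol D (s + 1) = cellVol D s / 2 := by
  rw [cellVol, cellVol, pow_succ, div_div]

lemma cellVol_eq {D s : ℕ} (hs : s ≤ D) : cellVol D s = 2 ^ (D - s) := by
  rw [cellVol, pow_sub₀ _ two_ne_zero hs]; rfl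

/-- The admissible relative fluctuation of the mass of a cell of depth `s`. -/
noncomputable def fluct (D s : ℕ) : ℝ := (ϱ ^ (5 * (D - s)))⁻¹

lemma fluct_pos (D s : ℕ) : 0 < fluct D s := by
  have := twelfthRootTwo_pos
  rw [fluct]; positivity

/-- A bound for the square root of the probability that a cell of volume `2 ^ t` has a mass that
fluctuates more than admissible. -/
noncomputable def fluctProb (t : ℕ) : ℝ := Real.exp (-(ϱ ^ (2 * t) / 8))

/-- The decay beats every power of the volume `2 ^ t`. The exponent `6` serves the probability
estimate, and one growing with `p` serves the cost. -/
lemma fluctProb_le (t n : ℕ) : fluctProb t ≤ n.factorial * 8 ^ n / ϱ ^ (2 * t * n) := by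
  have h0 := twelfthRootTwo_pos
  have h := Real.pow_div_factorial_le_exp (ϱ ^ (2 * t) / 8) (by positivity) n
  rw [fluctProb, Real.exp_neg, inv_le_comm₀ (Real.exp_pos _) (by positivity)]
  refine le_trans (le_of_eq ?_) h
  rw [div_pow, ← pow_mul]
  field_simp

lemma fluctProb_le_one (t : ℕ) : fluctProb t ≤ 1 := by
  have h0 := twelfthRootTwo_pos
  rw [fluctProb, Real.exp_le_one_iff, neg_nonpos]
  positivity

/-- The event on which the optimal bound for the transportation cost holds in dimension at least
three: at every scale, only few cells have a mass that fluctuates more than admissible. -/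
def SpatialGood (D S : ℕ) (x : Fin (2 ^ S) → ℝ) : Prop :=
  ∀ s ≤ S, ∑ c ∈ Finset.range (2 ^ s),
    (if fluct D s * cellVol D s < |∑ v ∈ leavesBelow S s c, x v - cellVol D s| then (1 : ℝ) else 0)
      ≤ 2 ^ s * (4 * fluctProb (D - s))

section Probability

variable {Ω : Type*} [MeasurableSpace Ω] {P : Measure Ω} {D S : ℕ} {X : Fin (2 ^ S) → Ω → ℝ}

/-- For volume `2 ^ t = ϱ ^ (12 t)` and relative fluctuation `ϱ ^ (-5 t)`, the Chernoff exponent is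
`ϱ ^ (2 t) / 4`, twice the exponent of `fluctProb`. -/
lemma measure_fluct_le (hX : IsSubPoissonFamily P X (cellVol D S)) (hS : S ≤ D) {s c : ℕ}
    (hs : s ≤ S) (hc : c < 2 ^ s) :
    P {ω | fluct D s * cellVol D s ≤ |∑ v ∈ leavesBelow S s c, X v ω - cellVol D s|} ≤
      ENNReal.ofReal (2 * fluctProb (D - s) ^ 2) := by
  have h0 := twelfthRootTwo_pos
  have hη : fluct D s ≤ 1 := inv_le_one_of_one_le₀ (one_le_pow₀ one_lt_twelfthRootTwo.le)
  have h := hX.measure_abs_sum_sub_ge_le (leavesBelow S s c) (fluct_pos D s).le hη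
  have e : ((leavesBelow S s c).card : ℝ) * cellVol D S = cellVol D s := by
    rw [card_leavesBelow hs hc, cellVol, cellVol]
    push_cast
    rw [pow_sub₀ _ two_ne_zero hs]
    field_simp
  rw [e] at h
  refine h.trans_eq ?_
  congr 2
  rw [fluctProb, ← Real.exp_nat_mul]
  congr 1
  have e2 : cellVol D s * fluct D s ^ 2 = ϱ ^ (2 * (D - s)) := by
    rw [cellVol_eq (hs.trans hS), two_pow_eq, fluct, inv_pow, ← pow_mul, ← div_eq_mul_inv,
      div_eq_iff (by positivity), ← pow_add]
    congr 1; ring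
  rw [e2]
  push_cast
  ring

/-- With `Q` the value of `fluctProb`, the mean proportion of bad cells is at most `2 Q ^ 2`, well
below the threshold `4 Q`. Chebyshev's inequality bounds the probability by `1 / 2 ^ s`, Markov's by
`Q`, which is small for large cells. As `2 ^ s * 2 ^ (D - s) = 2 ^ D`, one of the two is always good
enough. -/
lemma measure_many_fluct_le [IsProbabilityMeasure P] (hX : IsSubPoissonFamily P X (cellVol D S))
    (hS : S ≤ D) {s : ℕ} (hs : s ≤ S) :
    P {ω | 2 ^ s * (4 * fluctProb (D - s)) ≤ ∑ c ∈ Finset.range (2 ^ s),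
      (if fluct D s * cellVol D s < |∑ v ∈ leavesBelow S s c, X v ω - cellVol D s| then (1 : ℝ)
        else 0)} ≤ ENNReal.ofReal (2 ^ 28 / √2 ^ D) := by
  have hXm := hX.measurable
  have hQ0 : 0 < fluctProb (D - s) := Real.exp_pos _
  have hQ1 := fluctProb_le_one (D - s)
  set Q := fluctProb (D - s) with hQ
  set Y : ℕ → Ω → ℝ := fun c ω =>
    if fluct D s * cellVol D s < |∑ v ∈ leavesBelow S s c, X v ω - cellVol D s| then (1 : ℝ) else 0
    with hY
  have hYm : ∀ c, Measurable (Y c) := fun c =>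
    Measurable.ite (measurableSet_lt measurable_const (by fun_prop)) measurable_const
      measurable_const
  have hY0 : ∀ c ω, 0 ≤ Y c ω := fun c ω => by
    simp only [hY]; split_ifs <;> norm_num
  have hYsq : ∀ c ω, Y c ω ^ 2 = Y c ω := fun c ω => by
    simp only [hY]; split_ifs <;> norm_num
  have hYint : ∀ c < 2 ^ s, ∫⁻ ω, ENNReal.ofReal (Y c ω) ∂P ≤ ENNReal.ofReal (2 * Q ^ 2) := by
    intro c hc
    refine le_trans ?_ (measure_fluct_le hX hS hs hc)
    have hms : MeasurableSet {ω | fluct D s * cellVol D s ≤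
        |∑ v ∈ leavesBelow S s c, X v ω - cellVol D s|} :=
      measurableSet_le measurable_const (by fun_prop)
    rw [← lintegral_indicator_one hms]
    refine lintegral_mono fun ω => ?_
    simp only [hY, Set.indicator, Set.mem_ofPred_eq, Pi.one_apply]
    split_ifs with h1 h2
    · simp
    · exact absurd h1.le h2
    · simp
    · simp
  have hind : ∀ c < 2 ^ s, ∀ c' < 2 ^ s, c ≠ c' → IndepFun (Y c) (Y c') P := by
    intro c _ c' _ hcc
    let F : (c : ℕ) → (leavesBelow S s c → ℝ) → ℝ := fun c y =>
      if fluct D s * cellVol D s < |∑ v, y v - cellVol D s| then (1 : ℝ) else 0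
    have hF : ∀ c, Measurable (F c) := fun c =>
      Measurable.ite (measurableSet_lt measurable_const (by fun_prop)) measurable_const
        measurable_const
    have e : ∀ c, Y c = fun ω => F c fun v => X v ω := fun c => by
      funext ω
      simp only [hY, F]
      rw [Finset.sum_coe_sort (leavesBelow S s c) (fun v => X v ω)]
    rw [e, e]
    exact hX.indepFun_of_disjoint (disjoint_leavesBelow hcc) (hF c) (hF c')
  have hpow : (0 : ℝ) < 2 ^ s := by positivity
  have hcheb : P {ω | 2 ^ s * (4 * Q) ≤ ∑ c ∈ Finset.range (2 ^ s), Y c ω} ≤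
      ENNReal.ofReal (1 / 2 ^ s) := by
    have h := measure_sum_ge_le_of_pairwise_indepFun (P := P) (M := 2 ^ s) (by positivity) hYm hY0
      (e := 2 * Q ^ 2) (V := 2 * Q ^ 2) (δ := 2 * Q) (by positivity) (by positivity)
      (by positivity) hYint (fun c hc => by simp_rw [hYsq]; exact hYint c hc) hind
    refine (measure_mono ?_).trans (h.trans (ENNReal.ofReal_le_ofReal ?_))
    · intro ω hω
      rw [Set.mem_ofPred_eq] at hω ⊢
      refine le_trans ?_ hω
      push_cast
      gcongr
      nlinarith
    · push_cast
      rw [div_le_div_iff₀ (by positivity) hpow]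
      have : (0 : ℝ) ≤ 2 ^ s * Q ^ 2 := by positivity
      nlinarith
  have hmark : P {ω | 2 ^ s * (4 * Q) ≤ ∑ c ∈ Finset.range (2 ^ s), Y c ω} ≤
      ENNReal.ofReal Q := by
    have h := lintegral_ofReal_sum_le (P := P) (Finset.range (2 ^ s)) (fun c _ => hYm c)
      (fun c _ => hY0 c) fun c hc => hYint c (Finset.mem_range.1 hc)
    have h1 := mul_meas_ge_le_lintegral (μ := P)
      (f := fun ω => ENNReal.ofReal (∑ c ∈ Finset.range (2 ^ s), Y c ω)) (by fun_prop)
      (ENNReal.ofReal (2 ^ s * (4 * Q)))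
    have h2 := h1.trans h
    rw [Finset.card_range, mul_comm, ← ENNReal.le_div_iff_mul_le
      (Or.inl (by simpa using by positivity)) (Or.inl ENNReal.ofReal_ne_top),
      ← ENNReal.ofReal_div_of_pos (by positivity)] at h2
    refine (measure_mono ?_).trans (h2.trans (ENNReal.ofReal_le_ofReal ?_))
    · intro ω hω
      rw [Set.mem_ofPred_eq] at hω ⊢
      exact ENNReal.ofReal_le_ofReal hω
    · push_cast
      rw [div_le_iff₀ (by positivity)]
      nlinarith [mul_pos hpow (pow_pos hQ0 2)]
  have hQle : Q ≤ 2 ^ 28 / 2 ^ (D - s) := by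
    refine (fluctProb_le (D - s) 6).trans ?_
    rw [two_pow_eq (D - s), show 2 * (D - s) * 6 = 12 * (D - s) by ring]
    have h0 := twelfthRootTwo_pos
    gcongr
    norm_num [Nat.factorial]
  have hD : (√2 ^ D) ^ 2 = 2 ^ s * 2 ^ (D - s) := by
    rw [sqrt_two_pow_sq, ← pow_add]
    congr 1; omega
  by_cases hcase : √2 ^ D ≤ 2 ^ s
  · refine hcheb.trans (ENNReal.ofReal_le_ofReal ?_)
    rw [div_le_div_iff₀ hpow (by positivity)]
    nlinarith
  · refine hmark.trans (ENNReal.ofReal_le_ofReal (hQle.trans ?_))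
    push Not at hcase
    have hp : (0 : ℝ) < √2 ^ D := by positivity
    have hp2 : (0 : ℝ) < 2 ^ (D - s) := by positivity
    have h3 : √2 ^ D ≤ 2 ^ (D - s) := by
      by_contra hcon
      push Not at hcon
      nlinarith
    gcongr

/-- In dimension at least three, the good event has overwhelming probability. -/
theorem measure_not_spatialGood_le [IsProbabilityMeasure P]
    (hX : IsSubPoissonFamily P X (cellVol D S)) (hS : S ≤ D) :
    P {ω | ¬ SpatialGood D S fun v => X v ω} ≤ ENNReal.ofReal ((D + 1) * (2 ^ 28 / √2 ^ D)) := by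
  have h2 : {ω | ¬ SpatialGood D S fun v => X v ω} ⊆ ⋃ s ∈ Finset.range (S + 1),
      {ω | 2 ^ s * (4 * fluctProb (D - s)) ≤ ∑ c ∈ Finset.range (2 ^ s),
        (if fluct D s * cellVol D s < |∑ v ∈ leavesBelow S s c, X v ω - cellVol D s| then (1 : ℝ)
          else 0)} := by
    intro ω hω
    rw [Set.mem_ofPred_eq, SpatialGood] at hω
    push Not at hω
    obtain ⟨s, hs, h⟩ := hω
    simp only [Set.mem_iUnion, Finset.mem_range]
    exact ⟨s, by omega, h.le⟩
  refine (measure_mono h2).trans ((measure_biUnion_finset_le _ _).trans ?_)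
  refine (Finset.sum_le_sum fun s hs => measure_many_fluct_le hX hS
    (by simpa [Nat.lt_succ_iff] using hs)).trans ?_
  rw [Finset.sum_const, Finset.card_range, nsmul_eq_mul, ← ENNReal.ofReal_natCast,
    ← ENNReal.ofReal_mul (by positivity)]
  refine ENNReal.ofReal_le_ofReal ?_
  push_cast
  gcongr

end Probability

/-! ### Dimension at least three: transport cost on the good event -/

section Deterministic

/-- A cell of volume `2 ^ t` has side about `2 ^ (t / d) ≤ 2 ^ (t / 3) = ϱ ^ (4 t)`. Rounding `t /
3` up costs at most `ϱ ^ 8 ≤ 2`. -/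
lemma dyadicSide_spatial_le {d k D : ℕ} [NeZero d] (hd : 3 ≤ d) (hD : D = k * d) (i : Fin d)
    {s : ℕ} (hs : s ≤ D) : dyadicSide d (2 ^ k) i s ≤ 2 * ϱ ^ (4 * (D - s)) := by
  refine (dyadicSide_le (by positivity) i s).trans ?_
  set t := D - s with ht
  set j := (t + 2) / 3 with hj
  have h3 : t ≤ 3 * j := by omega
  have hdj : t ≤ d * j := h3.trans (Nat.mul_le_mul_right j hd)
  have hk : k ≤ s / d + j := by
    have h1 : k * d ≤ s + j * d := by
      rw [mul_comm j d]; omega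
    have h2 : (s + j * d) / d = s / d + j := Nat.add_mul_div_right _ _ (by omega)
    rw [← h2, Nat.le_div_iff_mul_le (by omega)]
    exact h1
  have h0 := twelfthRootTwo_pos
  rw [div_le_iff₀ (by positivity)]
  calc (2 : ℝ) ^ k ≤ 2 ^ (s / d + j) := pow_le_pow_right₀ (by norm_num) hk
    _ = ϱ ^ (12 * j) * 2 ^ (s / d) := by rw [pow_add, two_pow_eq j]; ring
    _ ≤ ϱ ^ (8 + 4 * t) * 2 ^ (s / d) := by
      gcongr
      · exact one_lt_twelfthRootTwo.le
      · omega
    _ ≤ 2 * ϱ ^ (4 * t) * 2 ^ (s / d) := by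
      rw [pow_add]
      gcongr
      exact twelfthRootTwo_pow_le_two (by norm_num)

lemma fluct_succ_le {D s : ℕ} (hs : s < D) : fluct D (s + 1) ≤ 2 * (ϱ ^ (5 * (D - s)))⁻¹ := by
  have h0 := twelfthRootTwo_pos
  have e : ϱ ^ (5 * (D - s)) = ϱ ^ 5 * ϱ ^ (5 * (D - (s + 1))) := by
    rw [← pow_add]; congr 1; omega
  rw [fluct, e, mul_inv]
  have h5 := twelfthRootTwo_pow_le_two (show 5 ≤ 12 by norm_num)
  have h1 : 1 ≤ 2 * (ϱ ^ 5)⁻¹ := by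
    rw [← div_eq_mul_inv, one_le_div (by positivity)]; exact h5
  calc (ϱ ^ (5 * (D - (s + 1))))⁻¹ = 1 * (ϱ ^ (5 * (D - (s + 1))))⁻¹ := (one_mul _).symm
    _ ≤ 2 * (ϱ ^ 5)⁻¹ * (ϱ ^ (5 * (D - (s + 1))))⁻¹ := by gcongr
    _ = _ := by ring

lemma fluct_mono {D s : ℕ} : fluct D s ≤ fluct D (s + 1) := by
  have h0 := twelfthRootTwo_pos
  rw [fluct, fluct]
  gcongr
  · exact one_lt_twelfthRootTwo.le
  · omega

/-- The path estimates need fluctuations at most `1 / 8`; this is why the hierarchy stops twelve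
levels before unit volume. -/
lemma fluct_le_eighth {D s : ℕ} (hs : s + 12 ≤ D) : fluct D s ≤ 1 / 8 := by
  have h0 := twelfthRootTwo_pos
  rw [fluct, one_div]
  gcongr
  calc (8 : ℝ) ≤ (ϱ ^ 12) ^ 5 := by rw [twelfthRootTwo_pow]; norm_num
    _ = ϱ ^ 60 := by rw [← pow_mul]
    _ ≤ _ := pow_le_pow_right₀ one_lt_twelfthRootTwo.le (by omega)

lemma sum_inv_pow_le {D s : ℕ} (hs : s ≤ D) :
    ∑ j ∈ Finset.range s, (ϱ ^ (D - j))⁻¹ ≤ (ϱ - 1)⁻¹ * (ϱ ^ (D - s))⁻¹ := by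
  have h0 := twelfthRootTwo_pos
  have h1 := sub_pos.2 one_lt_twelfthRootTwo
  induction s with
  | zero => simp; positivity
  | succ s ih =>
    rw [Finset.sum_range_succ]
    have e : ϱ ^ (D - s) = ϱ * ϱ ^ (D - (s + 1)) := by
      rw [← pow_succ']; congr 1; omega
    have := ih (by omega)
    rw [e] at this ⊢
    refine (add_le_add_left this _).trans (le_of_eq ?_)
    have : ϱ - 1 ≠ 0 := h1.ne'
    field_simp
    ring

/-- Here `ϱ ^ (4 t) * ϱ ^ (-5 t) = ϱ ^ (-t)`. The exponent `5` lies strictly between `4`, from the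
side when `d ≥ 3`, and `6`, from the Poisson standard deviation: the shifts are summable and
violations remain rare. -/
lemma dyadicSide_mul_fluct_le {d k D : ℕ} [NeZero d] (hd : 3 ≤ d) (hD : D = k * d) (i : Fin d)
    {s : ℕ} (hs : s < D) :
    dyadicSide d (2 ^ k) i s * fluct D (s + 1) ≤ 4 * (ϱ ^ (D - s))⁻¹ := by
  have h0 := twelfthRootTwo_pos
  calc _ ≤ (2 * ϱ ^ (4 * (D - s))) * (2 * (ϱ ^ (5 * (D - s)))⁻¹) :=
        mul_le_mul (dyadicSide_spatial_le hd hD i hs.le) (fluct_succ_le hs) (fluct_pos _ _).le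
          (by positivity)
    _ = _ := by
      rw [show 5 * (D - s) = 4 * (D - s) + (D - s) by ring, pow_add ϱ]
      field_simp
      norm_num

/-- A bound for the displacement of a cell all of whose ancestors have a mass with admissible
fluctuations. -/
noncomputable def spatialDriftBound : ℝ := 272 * (ϱ - 1)⁻¹

lemma spatialDriftBound_nonneg : 0 ≤ spatialDriftBound := by
  have h1 := sub_pos.2 one_lt_twelfthRootTwo
  rw [spatialDriftBound]; positivity

lemma PathGood.abs_drift_spatial_le {d k D : ℕ} [NeZero d] (hd : 3 ≤ d) (hD : D = k * d)
    {N : ℕ → ℕ → ℝ} (hN : IsTreeMass N) (i : Fin d) {s c : ℕ} (hs : s + 12 ≤ D)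
    (h : PathGood N (cellVol D) (fluct D) s c) :
    |(drift i (cutShift N (2 ^ k) i) s c).1| + |(drift i (cutShift N (2 ^ k) i) s c).2| ≤
      spatialDriftBound := by
  have h0 := twelfthRootTwo_pos
  have hp1 : ∀ n : ℕ, (ϱ ^ n)⁻¹ ≤ 1 := fun n =>
    inv_le_one_of_one_le₀ (one_le_pow₀ one_lt_twelfthRootTwo.le)
  have hβ : ∀ j < s, dyadicSide d (2 ^ k) i j * fluct D (j + 1) ≤ 4 := fun j hj =>
    (dyadicSide_mul_fluct_le hd hD i (by omega)).trans (by linarith [hp1 (D - j)])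
  have h8 : ∀ j ≤ s, fluct D j ≤ 1 / 8 := fun j hj => fluct_le_eighth (by omega)
  refine (abs_drift_le_sum (η := fluct D) (S := s) (β := 4) hN (by positivity) (cellVol_succ D)
    (cellVol_pos D) (fun _ _ => fluct_mono) h8 (by norm_num) hβ le_rfl h).trans ?_
  -- `68 = 4 + 32 * 2`; the factor `4` of `abs_drift_le_sum` then gives `272`.
  have hsum : ∑ j ∈ Finset.range s, (dyadicSide d (2 ^ k) i j + 8 * 4) * fluct D (j + 1) ≤
      ∑ j ∈ Finset.range s, 68 * (ϱ ^ (D - j))⁻¹ := by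
    refine Finset.sum_le_sum fun j hj => ?_
    rw [Finset.mem_range] at hj
    have a1 := dyadicSide_mul_fluct_le hd hD i (show j < D by omega)
    have a2 := fluct_succ_le (show j < D by omega)
    have a3 : (ϱ ^ (5 * (D - j)))⁻¹ ≤ (ϱ ^ (D - j))⁻¹ := by
      gcongr
      · exact one_lt_twelfthRootTwo.le
      · omega
    rw [add_mul]
    linarith
  rw [← Finset.mul_sum] at hsum
  have h2 := sum_inv_pow_le (show s ≤ D by omega)
  have h1 := sub_pos.2 one_lt_twelfthRootTwo
  have h3 : (ϱ - 1)⁻¹ * (ϱ ^ (D - s))⁻¹ ≤ (ϱ - 1)⁻¹ :=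
    mul_le_of_le_one_right (by positivity) (hp1 _)
  rw [spatialDriftBound]
  linarith

/-- The ratio of the displacement of a cell to its diameter. -/
noncomputable def spatialRatio (d : ℕ) : ℝ := d * (spatialDriftBound + 4)

lemma PathGood.dist_le_spatial {d k D : ℕ} [NeZero d] (hd : 3 ≤ d) (hD : D = k * d)
    {N : ℕ → ℕ → ℝ} (hN : IsTreeMass N) {s c : ℕ} (hs : s + 12 ≤ D)
    (h : PathGood N (cellVol D) (fluct D) s c) {x y : EuclideanSpace ℝ (Fin d)}
    (hx : x ∈ dyadicCell d (2 ^ k) s c) (hy : y ∈ cell (countRatio N) (2 ^ k) s c) :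
    dist x y ≤ spatialRatio d * ϱ ^ (4 * (D - s)) := by
  have h1 : 1 ≤ ϱ ^ (4 * (D - s)) := one_le_pow₀ one_lt_twelfthRootTwo.le
  refine (dist_le_of_drift_le (b := fun _ => (spatialDriftBound + 4) * ϱ ^ (4 * (D - s)))
    (fun i => ?_) hx hy).trans_eq ?_
  · have a1 := h.abs_drift_spatial_le hd hD hN i hs
    have a2 := dyadicSide_spatial_le hd hD i (show s ≤ D by omega)
    have a3 := spatialDriftBound_nonneg
    nlinarith
  · simp [spatialRatio]
    ring

lemma IsTreeMass.le_ancestor {N : ℕ → ℕ → ℝ} (hN : IsTreeMass N) (s j c : ℕ) :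
    N (s + j) c ≤ N s (c / 2 ^ j) := by
  induction j generalizing c with
  | zero => simp
  | succ j ih =>
    have h1 : N (s + j + 1) c ≤ N (s + j) (c / 2) := by
      have ha := hN.add (s + j) (c / 2)
      have h1 := hN.nonneg (s + j + 1) (2 * (c / 2))
      have h2 := hN.nonneg (s + j + 1) (2 * (c / 2) + 1)
      rcases Nat.mod_two_eq_zero_or_one c with hc | hc
      · rw [show 2 * (c / 2) = c by omega] at ha h1 h2
        linarith
      · rw [show 2 * (c / 2) + 1 = c by omega] at ha h2
        linarith
    refine h1.trans ((ih (c / 2)).trans_eq ?_)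
    rw [Nat.div_div_eq_div_mul, ← pow_succ']

end Deterministic

lemma sum_range_div_two_pow {S m : ℕ} (hm : m ≤ S) (g : ℕ → ℝ) :
    ∑ w ∈ Finset.range (2 ^ S), g (w / 2 ^ (S - m)) =
      2 ^ (S - m) * ∑ c ∈ Finset.range (2 ^ m), g c := by
  have hmaps : ∀ w ∈ (Finset.univ : Finset (Fin (2 ^ S))),
      (w : ℕ) / 2 ^ (S - m) ∈ Finset.range (2 ^ m) := by
    intro w _
    rw [Finset.mem_range, Nat.div_lt_iff_lt_mul (by positivity), ← pow_add,
      show m + (S - m) = S by omega]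
    exact w.2
  rw [← Fin.sum_univ_eq_sum_range (fun w => g (w / 2 ^ (S - m))) (2 ^ S),
    ← Finset.sum_fiberwise_of_maps_to hmaps, Finset.mul_sum]
  refine Finset.sum_congr rfl fun c hc => ?_
  change ∑ w ∈ leavesBelow S m c, _ = _
  rw [Finset.sum_congr rfl fun w hw => by rw [mem_leavesBelow.1 hw], Finset.sum_const,
    card_leavesBelow hm (Finset.mem_range.1 hc), nsmul_eq_mul]
  push_cast
  rfl

lemma one_le_spatialRatio {d : ℕ} (hd : 3 ≤ d) : 1 ≤ spatialRatio d := by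
  have h1 := spatialDriftBound_nonneg
  have h2 : (3 : ℝ) ≤ d := by exact_mod_cast hd
  rw [spatialRatio]
  nlinarith

/-- A bound for the cost of transporting the mass of a cell of volume `2 ^ t`. -/
noncomputable def cellCost (d n t : ℕ) : ℝ :=
  2 * 2 ^ t * (spatialRatio d ^ n * ϱ ^ (4 * t * n))

lemma cellCost_nonneg {d : ℕ} (hd : 3 ≤ d) (n t : ℕ) : 0 ≤ cellCost d n t := by
  have h0 := twelfthRootTwo_pos
  have h1 := one_le_spatialRatio hd
  rw [cellCost]; positivity

/-- The cost of a cell is polynomial in its volume. The exponent `M` is chosen so that `fluctProb`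
gains `ϱ ^ (4 t n) * 4 ^ t`, leaving a geometric series of ratio `1 / 2`. -/
lemma summable_cellCost_mul_fluctProb {d : ℕ} (hd : 3 ≤ d) (n : ℕ) :
    Summable fun t => cellCost d n (t + 1) * (4 * fluctProb t) := by
  have h0 := twelfthRootTwo_pos
  have h1 := one_le_spatialRatio hd
  set M := 2 * n + 12 with hM
  refine Summable.of_nonneg_of_le
    (fun t => mul_nonneg (cellCost_nonneg hd n _) (mul_nonneg (by norm_num) (Real.exp_pos _).le))
    (fun t => ?_) ((summable_geometric_of_lt_one (r := 1 / 2) (by norm_num) (by norm_num)).mul_left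
      (16 * spatialRatio d ^ n * ϱ ^ (4 * n) * (M.factorial * 8 ^ M)))
  have h2 := fluctProb_le t M
  have h3 := cellCost_nonneg hd n (t + 1)
  calc cellCost d n (t + 1) * (4 * fluctProb t)
      ≤ cellCost d n (t + 1) * (4 * (M.factorial * 8 ^ M / ϱ ^ (2 * t * M))) := by gcongr
    _ = _ := by
      have e : ϱ ^ (2 * t * M) = ϱ ^ (4 * t * n) * (2 ^ t * 2 ^ t) := by
        rw [two_pow_eq, ← pow_add, ← pow_add, hM]
        congr 1; ring
      rw [cellCost, e, show 4 * (t + 1) * n = 4 * t * n + 4 * n by ring, pow_add ϱ, pow_succ,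
        one_div, inv_pow]
      field_simp
      ring

/-- The constant in the bound for the transportation cost in dimension at least three. -/
noncomputable def spatialConst (d n : ℕ) : ℝ :=
  cellCost d n 12 + ∑' t, cellCost d n (t + 1) * (4 * fluctProb t)

lemma spatialConst_nonneg {d : ℕ} (hd : 3 ≤ d) (n : ℕ) : 0 ≤ spatialConst d n :=
  add_nonneg (cellCost_nonneg hd n _) (tsum_nonneg fun t =>
    mul_nonneg (cellCost_nonneg hd n _) (mul_nonneg (by norm_num) (Real.exp_pos _).le))

lemma fluctProb_lt_fourth {t : ℕ} (ht : 24 ≤ t) : 4 * fluctProb t < 1 := by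
  have h : (16 : ℝ) ≤ ϱ ^ (2 * t) := by
    calc (16 : ℝ) = (ϱ ^ 12) ^ 4 := by rw [twelfthRootTwo_pow]; norm_num
      _ = ϱ ^ 48 := by rw [← pow_mul]
      _ ≤ _ := pow_le_pow_right₀ one_lt_twelfthRootTwo.le (by omega)
  have h1 : (4 : ℝ) < Real.exp 2 := by
    have := Real.quadratic_le_exp_of_nonneg (show (0 : ℝ) ≤ 2 by norm_num)
    norm_num at this
    linarith
  have h2 : fluctProb t ≤ (Real.exp 2)⁻¹ := by
    rw [fluctProb, ← Real.exp_neg, Real.exp_le_exp]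
    linarith
  have h3 : (Real.exp 2)⁻¹ < 4⁻¹ := by gcongr
  linarith

/-- On the good event the transportation cost is of the optimal order. -/
theorem SpatialGood.torusWasserstein_le {d k D S : ℕ} [NeZero d] (hd : 3 ≤ d) (hD : D = k * d)
    (hS : S + 12 = D) (hD24 : 24 ≤ D) {μ : Measure (EuclideanSpace ℝ (Fin d))}
    (hμ : μ (torusBox d (2 ^ k)) ≠ ∞) (h : SpatialGood D S fun v => cellCount (2 ^ k) μ S v)
    {p : ℝ} (hp : 1 ≤ p) :
    torusWasserstein (2 ^ k) p μ (numberDensity (2 ^ k) μ • volume) ^ p ≤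
      ENNReal.ofReal (spatialConst d ⌈p⌉₊ * (2 ^ k) ^ d) := by
  classical
  have h0 := twelfthRootTwo_pos
  have hA := one_le_spatialRatio hd
  have hR : (0 : ℝ) < 2 ^ k := by positivity
  have hN := isTreeMass_cellCount hR.le hμ
  set N := cellCount (2 ^ k) μ with hNdef
  set n := ⌈p⌉₊ with hn
  set bad : ℕ → ℕ → ℝ := fun s c =>
    if fluct D s * cellVol D s < |N s c - cellVol D s| then 1 else 0 with hbad
  have hbad0 : ∀ s c, 0 ≤ bad s c := fun s c => by
    simp only [hbad]; split_ifs <;> norm_num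
  have hgood : ∀ s ≤ S, ∑ c ∈ Finset.range (2 ^ s), bad s c ≤ 2 ^ s * (4 * fluctProb (D - s)) := by
    intro s hs
    refine le_trans (le_of_eq (Finset.sum_congr rfl fun c hc => ?_)) (h s hs)
    simp only [hbad]
    rw [sum_leavesBelow hN.add hs (Finset.mem_range.1 hc)]
  -- At depth `0` the number of bad cells is `0` or `1`, and the good event bounds it by a number
  -- below one.
  have hroot : |N 0 0 - cellVol D 0| ≤ fluct D 0 * cellVol D 0 := by
    by_contra hcon
    push Not at hcon
    have h1 := hgood 0 (Nat.zero_le _)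
    simp only [pow_zero, Finset.sum_range_one, hbad, if_pos hcon, one_mul, Nat.sub_zero] at h1
    linarith [fluctProb_lt_fourth hD24]
  -- The last depth to which the path towards the leaf `w` is good; depth `0` always qualifies by
  -- `hroot`.
  set σ : ℕ → ℕ := fun w =>
    Nat.findGreatest (fun s => PathGood N (cellVol D) (fluct D) s (w / 2 ^ (S - s))) S with hσ
  have hσS : ∀ w, σ w ≤ S := fun w => Nat.findGreatest_le S
  have hσg : ∀ w < 2 ^ S, PathGood N (cellVol D) (fluct D) (σ w) (w / 2 ^ (S - σ w)) := by
    intro w hw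
    refine Nat.findGreatest_spec (P := fun s => PathGood N (cellVol D) (fluct D) s
      (w / 2 ^ (S - s))) (Nat.zero_le S) ?_
    intro j hj
    obtain rfl : j = 0 := by omega
    simpa [Nat.div_eq_of_lt hw] using hroot
  have hσb : ∀ w < 2 ^ S, σ w < S → bad (σ w + 1) (w / 2 ^ (S - (σ w + 1))) = 1 := by
    intro w hw hlt
    simp only [hbad]
    rw [if_pos]
    by_contra hcon
    push Not at hcon
    refine Nat.findGreatest_is_greatest (P := fun s => PathGood N (cellVol D) (fluct D) s
      (w / 2 ^ (S - s))) (Nat.lt_succ_self (σ w)) hlt ?_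
    intro j hj
    rcases Nat.lt_or_eq_of_le hj with hj | rfl
    · have := hσg w hw j (by omega)
      rw [Nat.div_div_eq_div_mul, ← pow_add] at this ⊢
      rwa [show S - (σ w).succ + ((σ w).succ - j) = S - σ w + (σ w - j) by omega]
    · simpa using hcon
  refine (torusWasserstein_rpow_le_sum hR hμ S hp
    (fun w => spatialRatio d * ϱ ^ (4 * (D - σ w))) (fun w => by positivity) ?_).trans ?_
  · intro w hw x hx y hy
    refine (hσg w hw).dist_le_spatial hd hD hN (by have := hσS w; omega) ?_ ?_
    · have := cell_subset_ancestor (d := d) (ρ := fun _ _ => 1 / 2) (fun _ _ => by norm_num)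
        (fun _ _ => by norm_num) hR.le (σ w) (S - σ w) w
      rw [Nat.add_sub_cancel' (hσS w)] at this
      exact this hx
    · have := cell_subset_ancestor (d := d) hN.countRatio_nonneg hN.countRatio_le_one hR.le
        (σ w) (S - σ w) w
      rw [Nat.add_sub_cancel' (hσS w)] at this
      exact this hy
  refine ENNReal.ofReal_le_ofReal ?_
  have hcost : ∀ w < 2 ^ S, N S w * (spatialRatio d * ϱ ^ (4 * (D - σ w))) ^ p ≤
      cellCost d n (D - σ w) := by
    intro w hw
    -- The mass of the leaf is crudely replaced by that of its stopping cell. The lost factor is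
    -- polynomial in the volume, which the decay of `fluctProb` absorbs.
    have hNw : N S w ≤ 2 * 2 ^ (D - σ w) := by
      have h1 := hN.le_ancestor (σ w) (S - σ w) w
      rw [Nat.add_sub_cancel' (hσS w)] at h1
      have h2 := hσg w hw (σ w) le_rfl
      simp only [Nat.sub_self, pow_zero, Nat.div_one] at h2
      have h3 := fluct_le_eighth (D := D) (s := σ w) (by have := hσS w; omega)
      have h4 := cellVol_pos D (σ w)
      have h5 := cellVol_eq (D := D) (s := σ w) (by have := hσS w; omega)
      have h6 := (abs_le.1 h2).2
      rw [← h5]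
      nlinarith
    have h1 : 1 ≤ spatialRatio d * ϱ ^ (4 * (D - σ w)) :=
      one_le_mul_of_one_le_of_one_le hA (one_le_pow₀ one_lt_twelfthRootTwo.le)
    have hpow : (spatialRatio d * ϱ ^ (4 * (D - σ w))) ^ p ≤
        spatialRatio d ^ n * ϱ ^ (4 * (D - σ w) * n) := by
      calc _ ≤ (spatialRatio d * ϱ ^ (4 * (D - σ w))) ^ (n : ℝ) :=
            Real.rpow_le_rpow_of_exponent_le h1 (Nat.le_ceil p)
        _ = _ := by rw [Real.rpow_natCast, mul_pow, ← pow_mul]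
    rw [cellCost]
    exact mul_le_mul hNw hpow (by positivity) (by positivity)
  -- A path that stops early at depth `s` is charged to its bad cell of depth `s + 1`; this shift by
  -- one is the `t + 1` in `spatialConst`.
  have hcost' : ∀ w < 2 ^ S, cellCost d n (D - σ w) ≤ cellCost d n 12 +
      ∑ s ∈ Finset.range S, cellCost d n (D - s) * bad (s + 1) (w / 2 ^ (S - (s + 1))) := by
    intro w hw
    have hnn : ∀ s ∈ Finset.range S,
        0 ≤ cellCost d n (D - s) * bad (s + 1) (w / 2 ^ (S - (s + 1))) := fun s _ =>
      mul_nonneg (cellCost_nonneg hd n _) (hbad0 _ _)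
    rcases Nat.lt_or_eq_of_le (hσS w) with hlt | heq
    · have h1 := Finset.single_le_sum hnn (Finset.mem_range.2 hlt)
      rw [hσb w hw hlt, mul_one] at h1
      linarith [cellCost_nonneg hd n 12]
    · rw [heq, show D - S = 12 by omega]
      linarith [Finset.sum_nonneg hnn]
  have hsumm := summable_cellCost_mul_fluctProb hd n
  have hrow : ∀ s ∈ Finset.range S, ∑ w ∈ Finset.range (2 ^ S),
      cellCost d n (D - s) * bad (s + 1) (w / 2 ^ (S - (s + 1))) ≤
      2 ^ S * (cellCost d n (D - s - 1 + 1) * (4 * fluctProb (D - s - 1))) := by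
    intro s hs
    rw [Finset.mem_range] at hs
    rw [← Finset.mul_sum, sum_range_div_two_pow (show s + 1 ≤ S from hs),
      show D - s - 1 + 1 = D - s by omega, show D - s - 1 = D - (s + 1) by omega]
    have h1 := hgood (s + 1) hs
    have h2 := cellCost_nonneg hd n (D - s)
    have e : (2 : ℝ) ^ S = 2 ^ (S - (s + 1)) * 2 ^ (s + 1) := by
      rw [← pow_add]; congr 1; omega
    calc _ ≤ cellCost d n (D - s) * (2 ^ (S - (s + 1)) *
          (2 ^ (s + 1) * (4 * fluctProb (D - (s + 1))))) := by gcongr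
      _ = _ := by rw [e]; ring
  have htsum : ∑ s ∈ Finset.range S, cellCost d n (D - s - 1 + 1) * (4 * fluctProb (D - s - 1)) ≤
      ∑' t, cellCost d n (t + 1) * (4 * fluctProb t) := by
    have hinj : Set.InjOn (fun s => D - s - 1) (Finset.range S : Set ℕ) := by
      intro a ha b hb hab
      simp only [Finset.coe_range, Set.mem_Iio] at ha hb hab
      omega
    rw [← Finset.sum_image (f := fun t => cellCost d n (t + 1) * (4 * fluctProb t)) hinj]
    exact hsumm.sum_le_tsum _ fun t _ =>
      mul_nonneg (cellCost_nonneg hd n _) (mul_nonneg (by norm_num) (Real.exp_pos _).le)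
  have h2S : (2 : ℝ) ^ S ≤ (2 ^ k) ^ d := by
    rw [← pow_mul, ← hD]
    exact pow_le_pow_right₀ (by norm_num) (by omega)
  calc ∑ w ∈ Finset.range (2 ^ S), N S w * (spatialRatio d * ϱ ^ (4 * (D - σ w))) ^ p
      ≤ ∑ w ∈ Finset.range (2 ^ S), (cellCost d n 12 + ∑ s ∈ Finset.range S,
          cellCost d n (D - s) * bad (s + 1) (w / 2 ^ (S - (s + 1)))) :=
        Finset.sum_le_sum fun w hw => (hcost w (Finset.mem_range.1 hw)).trans
          (hcost' w (Finset.mem_range.1 hw))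
    _ = 2 ^ S * cellCost d n 12 + ∑ s ∈ Finset.range S, ∑ w ∈ Finset.range (2 ^ S),
          cellCost d n (D - s) * bad (s + 1) (w / 2 ^ (S - (s + 1))) := by
        rw [Finset.sum_add_distrib, Finset.sum_comm]
        simp
    _ ≤ 2 ^ S * cellCost d n 12 + ∑ s ∈ Finset.range S,
          2 ^ S * (cellCost d n (D - s - 1 + 1) * (4 * fluctProb (D - s - 1))) := by
        gcongr with s hs
        exact hrow s hs
    _ ≤ 2 ^ S * spatialConst d n := by
        rw [← Finset.mul_sum, ← mul_add, spatialConst]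
        gcongr
    _ ≤ (2 ^ k) ^ d * spatialConst d n := by
        have := spatialConst_nonneg hd n
        gcongr
    _ = _ := mul_comm _ _

/-! ### Borel–Cantelli and conclusion -/

/-- A Borel–Cantelli argument: if for each `k` a property fails with summable probabilities, then
it holds for all `k` with `2 ^ k` above a random threshold. -/
theorem exists_measurable_threshold {Ω : Type*} [MeasurableSpace Ω] {P : Measure Ω}
    (E : ℕ → Set Ω) {b : ℕ → ℝ} (hb : Summable b) (k₀ : ℕ)
    (hE : ∀ k, k₀ ≤ k → P (E k) ≤ ENNReal.ofReal (b k)) :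
    ∃ r : Ω → ℝ, Measurable r ∧ (∀ ω, 2 ^ k₀ ≤ r ω) ∧
      ∀ᵐ ω ∂P, ∀ k : ℕ, k₀ ≤ k → r ω ≤ 2 ^ k → ω ∉ E k := by
  -- Measurable hulls make the threshold measurable although the bad events need not be.
  set F : ℕ → Set Ω := fun k => if k₀ ≤ k then toMeasurable P (E k) else ∅ with hF
  have hFm : ∀ k, MeasurableSet (F k) := fun k => by
    simp only [hF]
    split_ifs
    · exact measurableSet_toMeasurable _ _
    · exact MeasurableSet.empty
  -- The weight `2 ^ (k + 1)` pushes the threshold above `2 ^ k` whenever the `k`-th event occurs;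
  -- almost surely the sum is finite.
  set g : Ω → ℝ≥0∞ := fun ω => ∑' k, (F k).indicator (fun _ => (2 : ℝ≥0∞) ^ (k + 1)) ω with hg
  have hgm : Measurable g :=
    Measurable.tsum fun k => measurable_const.indicator (hFm k)
  refine ⟨fun ω => 2 ^ k₀ + (g ω).toReal, measurable_const.add hgm.ennreal_toReal,
    fun ω => le_add_of_nonneg_right ENNReal.toReal_nonneg, ?_⟩
  have hsum : ∑' k, P (F k) ≠ ∞ := by
    have hle : ∀ k, P (F k) ≤ ENNReal.ofReal |b k| := by
      intro k
      simp only [hF]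
      split_ifs with h
      · rw [measure_toMeasurable]
        exact (hE k h).trans (ENNReal.ofReal_le_ofReal (le_abs_self _))
      · simp
    refine ne_top_of_le_ne_top ?_ (ENNReal.tsum_le_tsum hle)
    exact hb.abs.tsum_ofReal_ne_top
  filter_upwards [ae_eventually_notMem hsum] with ω hω k hk hr hmem
  obtain ⟨K, hK⟩ := Filter.eventually_atTop.1 hω
  have hfin : g ω ≠ ∞ := by
    have : g ω = ∑ k ∈ Finset.range K, (F k).indicator (fun _ => (2 : ℝ≥0∞) ^ (k + 1)) ω := by
      refine tsum_eq_sum fun k hk => ?_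
      rw [Finset.mem_range, not_lt] at hk
      exact Set.indicator_of_notMem (hK k hk) _
    rw [this]
    refine ENNReal.sum_ne_top.2 fun k _ => ?_
    by_cases h : ω ∈ F k
    · rw [Set.indicator_of_mem h]
      exact ENNReal.pow_ne_top (by norm_num)
    · rw [Set.indicator_of_notMem h]
      exact ENNReal.zero_ne_top
  have hmemF : ω ∈ F k := by
    simp only [hF, if_pos hk]
    exact subset_toMeasurable _ _ hmem
  have hge : (2 : ℝ≥0∞) ^ (k + 1) ≤ g ω := by
    refine le_trans (le_of_eq ?_) (ENNReal.le_tsum k)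
    rw [Set.indicator_of_mem hmemF]
  have hge' : (2 : ℝ) ^ (k + 1) ≤ (g ω).toReal := by
    have := ENNReal.toReal_mono hfin hge
    simpa using this
  have h2 : (2 : ℝ) ^ (k + 1) = 2 * 2 ^ k := pow_succ' _ _
  have h3 : (0 : ℝ) < 2 ^ k := by positivity
  have h4 : (0 : ℝ) < 2 ^ k₀ := by positivity
  linarith

lemma exp_neg_sqrt_le {k : ℕ} (hk : 1 ≤ k) : Real.exp (-√k) ≤ 24 * (1 / (k : ℝ) ^ 2) := by
  have hk' : (0 : ℝ) < k := by exact_mod_cast hk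
  have h := Real.pow_div_factorial_le_exp (√k) (Real.sqrt_nonneg _) 4
  have e : √(k : ℝ) ^ 4 = (k : ℝ) ^ 2 := by
    rw [show 4 = 2 * 2 by norm_num, pow_mul, Real.sq_sqrt hk'.le]
  rw [e] at h
  rw [Real.exp_neg, ← div_eq_mul_one_div, inv_le_comm₀ (Real.exp_pos _) (by positivity), inv_div]
  simpa [Nat.factorial] using h

/-- The depth at which the cells of a square of side `2 ^ k` have area comparable to `k`. -/
def planarDepth (k : ℕ) : ℕ := 2 * k - (Nat.clog 2 k + 10)

lemma clog_add_le {k : ℕ} (hk : 20 ≤ k) : Nat.clog 2 k + 10 + k ≤ 2 * k := by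
  have : Nat.clog 2 k ≤ k - 10 := by
    rw [Nat.clog_le_iff_le_pow (by norm_num)]
    have h : ∀ j, j + 20 ≤ 2 ^ (j + 10) := by
      intro j
      induction j with
      | zero => norm_num
      | succ j ih => rw [show j + 1 + 10 = j + 10 + 1 by ring, pow_succ]; omega
    have := h (k - 20)
    rwa [show k - 20 + 20 = k by omega, show k - 20 + 10 = k - 10 by omega] at this
  omega

lemma planarDepth_bounds {k : ℕ} (hk : 20 ≤ k) :
    1024 * k * 2 ^ planarDepth k ≤ ((2 : ℝ) ^ k) ^ 2 ∧
      ((2 : ℝ) ^ k) ^ 2 ≤ 2048 * k * 2 ^ planarDepth k := by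
  have h1 := clog_add_le hk
  have e : ((2 : ℝ) ^ k) ^ 2 = 1024 * 2 ^ Nat.clog 2 k * 2 ^ planarDepth k := by
    rw [show (1024 : ℝ) = 2 ^ 10 by norm_num, ← pow_add, ← pow_add, ← pow_mul, planarDepth]
    congr 1; omega
  have h2 : (k : ℝ) ≤ 2 ^ Nat.clog 2 k := by exact_mod_cast Nat.le_pow_clog (by norm_num) k
  have h3 : (2 : ℝ) ^ Nat.clog 2 k ≤ 2 * k := by
    have h := Nat.pow_pred_clog_lt_self (b := 2) (by norm_num) (show 1 < k by omega)
    have hpos : 0 < Nat.clog 2 k := Nat.clog_pos (by norm_num) (by omega)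
    have h4 : 2 ^ Nat.clog 2 k = 2 * 2 ^ (Nat.clog 2 k).pred := by
      rw [← pow_succ', ← Nat.succ_eq_add_one, Nat.succ_pred_eq_of_pos hpos]
    have : 2 ^ Nat.clog 2 k ≤ 2 * k := by omega
    exact_mod_cast this
  rw [e]
  constructor
  · gcongr
  · have : (0 : ℝ) < 2 ^ planarDepth k := by positivity
    nlinarith

/-- The splitting depth `m = ⌊√k⌋` is a compromise: the coarse variance `12 m` must stay below the
threshold `14 √k`, while `2 ^ (-m)` must be summable in `k`. -/
lemma planar_probability_le {k : ℕ} (hk : 20 ≤ k) :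
    4 * 2 ^ planarDepth k * Real.exp (-(4 * k)) +
      8 * 2 ^ Nat.sqrt k * Real.exp (12 * Nat.sqrt k - 14 * √k) +
      16 * Real.exp 384 / 2 ^ Nat.sqrt k ≤
      (96 + 192 + 16 * Real.exp 384 * 384 * 16) * (1 / (k : ℝ) ^ 2) := by
  have hk1 : (1 : ℝ) ≤ k := by exact_mod_cast (by omega : 1 ≤ k)
  have hexp := exp_neg_sqrt_le (show 1 ≤ k by omega)
  have hs : √(k : ℝ) ≤ k := by
    rw [Real.sqrt_le_left (by linarith)]
    nlinarith
  have hm : (Nat.sqrt k : ℝ) ≤ √k := Real.nat_sqrt_le_real_sqrt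
  have he2 : (2 : ℝ) ≤ Real.exp 1 := by linarith [Real.add_one_le_exp (1 : ℝ)]
  have hpow : ∀ n : ℕ, (2 : ℝ) ^ n ≤ Real.exp n := by
    intro n
    rw [← Real.exp_one_pow]
    gcongr
  have h1 : 4 * 2 ^ planarDepth k * Real.exp (-(4 * k)) ≤ 96 * (1 / (k : ℝ) ^ 2) := by
    calc 4 * 2 ^ planarDepth k * Real.exp (-(4 * k))
        ≤ 4 * Real.exp (planarDepth k) * Real.exp (-(4 * k)) := by gcongr; exact hpow _
      _ = 4 * Real.exp (planarDepth k - 4 * k) := by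
        rw [mul_assoc, ← Real.exp_add, ← sub_eq_add_neg]
      _ ≤ 4 * Real.exp (-√k) := by
        have : (planarDepth k : ℝ) ≤ 2 * k := by
          exact_mod_cast (by rw [planarDepth]; omega : planarDepth k ≤ 2 * k)
        gcongr
        linarith
      _ ≤ _ := by linarith
  have h2 : 8 * 2 ^ Nat.sqrt k * Real.exp (12 * Nat.sqrt k - 14 * √k) ≤
      192 * (1 / (k : ℝ) ^ 2) := by
    calc _ ≤ 8 * Real.exp (Nat.sqrt k) * Real.exp (12 * Nat.sqrt k - 14 * √k) := by
          gcongr; exact hpow _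
      _ = 8 * Real.exp (Nat.sqrt k + (12 * Nat.sqrt k - 14 * √k)) := by
        rw [mul_assoc, ← Real.exp_add]
      -- Since `2 ^ m ≤ exp m`, the exponent is at most `13 m - 14 √k ≤ -√k`, which dictates the
      -- constant `14`.
      _ ≤ 8 * Real.exp (-√k) := by gcongr; linarith
      _ ≤ _ := by linarith
  have h3 : 1 / 2 ^ Nat.sqrt k ≤ 384 * 16 * (1 / (k : ℝ) ^ 2) := by
    have hlt : (k : ℝ) ≤ (Nat.sqrt k + 1) ^ 2 := by
      have := (Nat.lt_succ_sqrt k).le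
      rw [Nat.succ_eq_add_one, ← sq] at this
      exact_mod_cast this
    have hfour : ∀ n : ℕ, (n + 1) ^ 4 ≤ 384 * 16 * 2 ^ n := by
      intro n
      have hn : ∀ j : ℕ, (j + 8) ^ 4 ≤ 6144 * 2 ^ (j + 7) := by
        intro j
        induction j with
        | zero => norm_num
        | succ j ih =>
          have : (j + 1 + 8) ^ 4 ≤ 2 * (j + 8) ^ 4 := by nlinarith [Nat.zero_le j, sq_nonneg j]
          rw [show j + 1 + 7 = j + 7 + 1 by ring, pow_succ 2 (j + 7)]
          omega
      rcases Nat.lt_or_ge n 7 with h | h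
      · interval_cases n <;> norm_num
      · have := hn (n - 7)
        rwa [show n - 7 + 8 = n + 1 by omega, show n - 7 + 7 = n by omega] at this
    have h4 : ((Nat.sqrt k : ℝ) + 1) ^ 4 ≤ 384 * 16 * 2 ^ Nat.sqrt k := by
      exact_mod_cast hfour (Nat.sqrt k)
    rw [mul_one_div, div_le_div_iff₀ (by positivity) (by positivity), one_mul]
    calc (k : ℝ) ^ 2 ≤ (((Nat.sqrt k : ℝ) + 1) ^ 2) ^ 2 := by gcongr
      _ = ((Nat.sqrt k : ℝ) + 1) ^ 4 := by ring
      _ ≤ _ := h4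
  have h5 : 16 * Real.exp 384 / 2 ^ Nat.sqrt k ≤
      16 * Real.exp 384 * (384 * 16 * (1 / (k : ℝ) ^ 2)) := by
    rw [div_eq_mul_one_div]
    gcongr
  linarith

/-- The optimal matching bound in dimension two. -/
theorem exists_threshold_planar :
    ∃ C : ℝ → ℝ, ∀ (Ω : Type*) [MeasurableSpace Ω] (P : Measure Ω) [IsProbabilityMeasure P]
      (μ : ℕ → Ω → Measure (EuclideanSpace ℝ (Fin 2))),
      (∀ k : ℕ, IsPoissonProcess P (μ k) (volume.restrict (torusBox 2 ((2 : ℝ) ^ k)))) →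
      ∃ r : Ω → ℝ, Measurable r ∧ (∀ ω, 1 ≤ r ω) ∧ ∀ᵐ ω ∂P, ∀ k : ℕ, r ω ≤ 2 ^ k →
        ∀ p : ℝ, 1 ≤ p →
          torusWasserstein (2 ^ k) p (μ k ω) (numberDensity (2 ^ k) (μ k ω) • volume) ^ p ≤
            ENNReal.ofReal (C p * (2 ^ k) ^ 2 * Real.log (2 ^ k) ^ (p / 2)) := by
  refine ⟨fun p => ⌈p⌉₊.factorial * Real.exp 632 * (4 * Real.exp 96 + 1) /
    Real.log 2 ^ (p / 2), ?_⟩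
  intro Ω _ P _ μ hμ
  obtain ⟨r, hr, hr0, hae⟩ := exists_measurable_threshold (P := P)
    (fun k => {ω | ¬ PlanarGood k (planarDepth k) (Nat.sqrt k) fun v =>
      cellCount (2 ^ k) (μ k ω) (planarDepth k) v})
    ((Real.summable_one_div_nat_pow.2 (by norm_num : 1 < 2)).mul_left
      (96 + 192 + 16 * Real.exp 384 * 384 * 16)) 20 (fun k hk => by
      have hX := (hμ k).isSubPoissonFamily (by positivity) (planarDepth k)
      have h1 := clog_add_le hk
      refine (measure_not_planarGood_le hX (by omega) (planarDepth_bounds hk).1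
        (by rw [planarDepth]; omega) ?_).trans
        (ENNReal.ofReal_le_ofReal (planar_probability_le hk))
      have := Nat.sqrt_le_self k
      rw [planarDepth]
      omega)
  refine ⟨r, hr, fun ω => le_trans (by norm_num) (hr0 ω), ?_⟩
  have hfin : ∀ᵐ ω ∂P, ∀ k, μ k ω (torusBox 2 (2 ^ k)) ≠ ∞ := by
    rw [ae_all_iff]
    intro k
    have hms : MeasurableSet (torusBox 2 ((2 : ℝ) ^ k)) := by
      rw [← cell_zero (d := 2) (fun _ _ => 0) _ 0]
      exact measurableSet_cell _ _ _ _
    refine (hμ k).ae_ne_top hms ?_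
    rw [Measure.restrict_apply_self, ← cell_zero (d := 2) (fun _ _ => 1 / 2) _ 0]
    have := volume_dyadicCell (d := 2) (R := 2 ^ k) (by positivity) 0 0
    rw [dyadicCell] at this
    rw [this]
    exact ENNReal.ofReal_ne_top
  filter_upwards [hae, hfin] with ω h1 h2 k hk p hp
  have hk20 : 20 ≤ k := by
    have := (hr0 ω).trans hk
    exact (pow_le_pow_iff_right₀ (by norm_num : (1 : ℝ) < 2)).1 this
  have hgood : PlanarGood k (planarDepth k) (Nat.sqrt k) fun v =>
      cellCount (2 ^ k) (μ k ω) (planarDepth k) v := by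
    by_contra hcon
    exact h1 k hk20 hk hcon
  have hc := clog_add_le hk20
  have hsq := Nat.sqrt_le_self k
  refine (hgood.torusWasserstein_le (h2 k) (by omega) (planarDepth_bounds hk20).1
    (planarDepth_bounds hk20).2 (by rw [planarDepth]; omega) hp).trans_eq ?_
  congr 1
  have hlog2 : 0 < Real.log 2 := Real.log_pos (by norm_num)
  have e : √(k : ℝ) ^ p = (k : ℝ) ^ (p / 2) := by
    rw [Real.sqrt_eq_rpow, ← Real.rpow_mul (by positivity)]
    congr 1; ring
  rw [Real.log_pow, Real.mul_rpow (by positivity) hlog2.le, e]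
  have := (Real.rpow_pos_of_pos hlog2 (p / 2)).ne'
  field_simp

/-- The optimal matching bound in dimension at least three. -/
theorem exists_threshold_spatial {d : ℕ} (hd : 3 ≤ d) :
    ∃ C : ℝ → ℝ, ∀ (Ω : Type*) [MeasurableSpace Ω] (P : Measure Ω) [IsProbabilityMeasure P]
      (μ : ℕ → Ω → Measure (EuclideanSpace ℝ (Fin d))),
      (∀ k : ℕ, IsPoissonProcess P (μ k) (volume.restrict (torusBox d ((2 : ℝ) ^ k)))) →
      ∃ r : Ω → ℝ, Measurable r ∧ (∀ ω, 1 ≤ r ω) ∧ ∀ᵐ ω ∂P, ∀ k : ℕ, r ω ≤ 2 ^ k →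
        ∀ p : ℝ, 1 ≤ p →
          torusWasserstein (2 ^ k) p (μ k ω) (numberDensity (2 ^ k) (μ k ω) • volume) ^ p ≤
            ENNReal.ofReal (C p * (2 ^ k) ^ d) := by
  have : NeZero d := ⟨by omega⟩
  refine ⟨fun p => spatialConst d ⌈p⌉₊, ?_⟩
  intro Ω _ P _ μ hμ
  have hvol : ∀ k S : ℕ, ((2 : ℝ) ^ k) ^ d / 2 ^ S = cellVol (k * d) S := fun k S => by
    rw [cellVol, pow_mul]
  have hsum : Summable fun k : ℕ => (((k * d : ℕ) : ℝ) + 1) * (2 ^ 28 / √2 ^ (k * d)) := by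
    have hg : Summable fun D : ℕ => ((D : ℝ) + 1) * (2 ^ 28 / √2 ^ D) := by
      have hq : ‖(√2)⁻¹‖ < 1 := by
        rw [Real.norm_of_nonneg (by positivity)]
        exact inv_lt_one_of_one_lt₀ (by linarith [sqrt_two_bounds.1])
      have h1 := summable_pow_mul_geometric_of_norm_lt_one 1 hq
      have h0 := summable_pow_mul_geometric_of_norm_lt_one 0 hq
      refine ((h1.add h0).mul_left (2 ^ 28)).congr fun D => ?_
      rw [inv_pow]
      ring
    exact hg.comp_injective (i := fun k : ℕ => k * d) fun a b hab =>
      Nat.eq_of_mul_eq_mul_right (by omega) hab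
  obtain ⟨r, hr, hr0, hae⟩ := exists_measurable_threshold (P := P)
    (fun k => {ω | ¬ SpatialGood (k * d) (k * d - 12) fun v =>
      cellCount (2 ^ k) (μ k ω) (k * d - 12) v}) hsum 8 (fun k hk => by
      have hX := (hμ k).isSubPoissonFamily (by positivity) (k * d - 12)
      rw [hvol] at hX
      exact measure_not_spatialGood_le hX (by omega))
  refine ⟨r, hr, fun ω => le_trans (by norm_num) (hr0 ω), ?_⟩
  have hfin : ∀ᵐ ω ∂P, ∀ k, μ k ω (torusBox d (2 ^ k)) ≠ ∞ := by
    rw [ae_all_iff]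
    intro k
    have hms : MeasurableSet (torusBox d ((2 : ℝ) ^ k)) := by
      rw [← cell_zero (d := d) (fun _ _ => 0) _ 0]
      exact measurableSet_cell _ _ _ _
    refine (hμ k).ae_ne_top hms ?_
    rw [Measure.restrict_apply_self, ← cell_zero (d := d) (fun _ _ => 1 / 2) _ 0]
    have := volume_dyadicCell (d := d) (R := 2 ^ k) (by positivity) 0 0
    rw [dyadicCell] at this
    rw [this]
    exact ENNReal.ofReal_ne_top
  filter_upwards [hae, hfin] with ω h1 h2 k hk p hp
  have hk8 : 8 ≤ k := by
    have := (hr0 ω).trans hk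
    exact (pow_le_pow_iff_right₀ (by norm_num : (1 : ℝ) < 2)).1 this
  have hgood : SpatialGood (k * d) (k * d - 12) fun v =>
      cellCount (2 ^ k) (μ k ω) (k * d - 12) v := by
    by_contra hcon
    exact h1 k hk8 hk hcon
  have h24 : 8 * 3 ≤ k * d := Nat.mul_le_mul hk8 hd
  exact hgood.torusWasserstein_le hd rfl (by omega) (by omega) (h2 k) hp

theorem mainTheorem3 (d : ℕ) (hd : 2 ≤ d) :
    ∃ C : ℝ → ℝ, ∀ (Ω : Type*) [MeasurableSpace Ω] (P : Measure Ω) [IsProbabilityMeasure P]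
      (μ : ℤ → Ω → Measure (EuclideanSpace ℝ (Fin d))),
      (∀ k : ℤ, IsPoissonProcess P (μ k) (volume.restrict (torusBox d ((2 : ℝ) ^ k)))) →
      ∃ r : Ω → ℝ, Measurable r ∧ ∀ᵐ ω ∂P, ∀ (k : ℤ) (R : ℝ), R = (2 : ℝ) ^ k → r ω ≤ R →
        ∀ p : ℝ, 1 ≤ p →
          torusWasserstein R p (μ k ω) (numberDensity R (μ k ω) • volume) ^ p ≤
            ENNReal.ofReal (C p * R ^ d * (if d = 2 then Real.log R ^ (p / 2) else 1)) := by
  -- The thresholds are at least one, so negative exponents never occur above them.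
  have hnat : ∀ (r : ℝ) (k : ℤ), 1 ≤ r → r ≤ (2 : ℝ) ^ k → ∃ n : ℕ, k = n := by
    intro r k h1 h2
    have : (1 : ℝ) ≤ 2 ^ k := h1.trans h2
    exact Int.eq_ofNat_of_zero_le ((one_le_zpow_iff_right₀ (by norm_num)).1 this)
  rcases Nat.lt_or_eq_of_le hd with h3 | rfl
  · obtain ⟨C, hC⟩ := exists_threshold_spatial (show 3 ≤ d from h3)
    refine ⟨C, fun Ω _ P _ μ hμ => ?_⟩
    obtain ⟨r, hr, hr1, hae⟩ := hC Ω P (fun k => μ k) fun k => by simpa using hμ k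
    refine ⟨r, hr, ?_⟩
    filter_upwards [hae] with ω hω k R hR hrR p hp
    obtain ⟨n, rfl⟩ := hnat _ k (hr1 ω) (hrR.trans_eq hR)
    rw [zpow_natCast] at hR
    subst hR
    rw [if_neg (by omega), mul_one]
    exact hω n hrR p hp
  · obtain ⟨C, hC⟩ := exists_threshold_planar
    refine ⟨C, fun Ω _ P _ μ hμ => ?_⟩
    obtain ⟨r, hr, hr1, hae⟩ := hC Ω P (fun k => μ k) fun k => by simpa using hμ k
    refine ⟨r, hr, ?_⟩
    filter_upwards [hae] with ω hω k R hR hrR p hp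
    obtain ⟨n, rfl⟩ := hnat _ k (hr1 ω) (hrR.trans_eq hR)
    rw [zpow_natCast] at hR
    subst hR
    rw [if_pos rfl]
    exact hω n hrR p hp
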